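/- Let $G$ be the graph with two vertices $p,q$, two bounded edges (arcs) joining $p$ to $q$, and two half-infinite edges, one starting at $p$ and one at $q$. A \emph{generalized lens-shaped network} is an embedding $F\colon G\to\mathbb{R}^2$ (or its image $M=F(G)$) which is a homeomorphism onto its image and a smooth diffeomorphism onto its image on each closed edge, such that at each vertex the three edges meet pairwise at $120^\circ$, and such that the two non-compact edges tend to infinity and are asymptotic there to straight half-lines. A family $(M_t)_{t<0}$, $M_t=F(G,t)$, of such networks (with $F$ smooth on each closed edge, jointly with $t$) evolves under curve shortening flow if $\left(\frac{d}{dt}F\right)^\perp=\vec\kappa$ away from the vertices; it is \emph{homothetically shrinking} if moreover for all $t_1,t_2<0$ the network $M_{t_1}$ is the image of $M_{t_2}$ under a homothety of positive ratio. A \emph{shrinking symmetric lens} is such a homothetically shrinking family in which each $M_t$ is symmetric lens-shaped, i.e. $M_t$ consists of a smooth regular embedded arc $\gamma$ whose interior lies in $\{x^2>0\}$ and whose end points lie on the $x^1$-axis, with unit tangents $\left(\frac12,\frac{\sqrt3}2\right)$ at the left and $\left(\frac12,-\frac{\sqrt3}2\right)$ at the right end point, of the reflection of $\gamma$ about the $x^1$-axis,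 and of the two outer half-lines of the $x^1$-axis; and $M_t$ converges to the $x^1$-axis in Hausdorff distance as $t\nearrow0$. \textbf{Theorem.} There exists a family $(M_t)_{t\in(-\infty,0)}$ of generalized lens-shaped networks with the following properties: (i) $(M_t)$ shrinks homothetically under curve shortening flow; (ii) the bounded components of $\mathbb{R}^2\setminus M_t$ shrink to the origin in Hausdorff distance as $t\nearrow0$; (iii) no rotation of $(M_t)$ about the origin is a shrinking symmetric lens. The non-compact edges of each $M_t$ are half-lines which are not parallel. Moreover, $(M_t)$ is unique up to rotations about the origin: every family $(M'_t)_{t\in(-\infty,0)}$ of generalized lens-shaped networks with the properties (i), (ii) and (iii) is of the form $M'_t=R(M_t)$, for all $t<0$, with one rotation $R$ about the origin. -/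

import Mathlib

open Set Filter Topology
open scoped ContDiff

/-! The Euclidean plane is modelled by `ℂ`: the coordinates `x¹`, `x²` are `re`, `im`, and the
inner product is the real inner product of `ℂ`. -/

namespace Network

/-- The edges of the abstract graph `G` underlying a lens-shaped network: two bounded intervals
and two half-lines. -/
inductive Edge : Type
  | arc₁
  | arc₂
  | ray₁
  | ray₂

/-- The parameter interval of an edge. -/
def Edge.dom : Edge → Set ℝ
  | .arc₁ => Icc 0 1
  | .arc₂ => Icc 0 1
  | .ray₁ => Ici 0
  | .ray₂ => Ici 0

/-- The two vertices of `G`, both of degree three. -/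
inductive Vertex : Type
  | p
  | q

/-- `IsEnd v e x σ`: the parameter `x` is an end of the edge `e`, glued to the vertex `v`; the sign
`σ` is `1` or `-1` according to whether the parametrization of `e` leaves or enters `v`.
Both arcs join `p` to `q`; one half-line starts at `p`, the other one at `q`. -/
inductive IsEnd : Vertex → Edge → ℝ → ℝ → Prop
  | arc₁_p : IsEnd .p .arc₁ 0 1
  | arc₂_p : IsEnd .p .arc₂ 0 1
  | ray₁_p : IsEnd .p .ray₁ 0 1
  | arc₁_q : IsEnd .q .arc₁ 1 (-1)
  | arc₂_q : IsEnd .q .arc₂ 1 (-1)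
  | ray₂_q : IsEnd .q .ray₂ 0 1

/-- The parameter `x` on `e` and the parameter `x'` on `e'` describe the same point of `G`. -/
def SamePoint (e : Edge) (x : ℝ) (e' : Edge) (x' : ℝ) : Prop :=
  (e = e' ∧ x = x') ∨ ∃ v σ σ', IsEnd v e x σ ∧ IsEnd v e' x' σ'

/-- The half-line starting at `a` in direction `v`. -/
def halfLine (a v : ℂ) : Set ℂ := {z | ∃ s : ℝ, 0 ≤ s ∧ z = a + s • v}

/-- The image `F(G)`. -/
def trace (F : Edge → ℝ → ℂ) : Set ℂ := ⋃ e, F e '' e.dom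

/-- `F : G → ℝ²`, given edge by edge, is a generalized lens-shaped network. -/
structure IsGeneralizedLens (F : Edge → ℝ → ℂ) : Prop where
  /-- On each closed edge, `F` is smooth. -/
  smooth : ∀ e, ContDiffOn ℝ ∞ (F e) e.dom
  /-- On each closed edge, `F` is an immersion. -/
  regular : ∀ e, ∀ x ∈ e.dom, derivWithin (F e) e.dom x ≠ 0
  /-- `F` is well defined on `G` and injective. As the non-compact edges tend to infinity, such
  an `F` is proper, hence a homeomorphism onto its image. -/
  injective : ∀ e, ∀ x ∈ e.dom, ∀ e', ∀ x' ∈ Edge.dom e',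
    F e x = F e' x' ↔ SamePoint e x e' x'
  /-- At each vertex the three edges meet pairwise at `120°`. -/
  angle : ∀ v e x σ e' x' σ', IsEnd v e x σ → IsEnd v e' x' σ' → e ≠ e' →
    InnerProductGeometry.angle (σ • derivWithin (F e) e.dom x)
      (σ' • derivWithin (F e') e'.dom x') = 2 * Real.pi / 3
  /-- The non-compact edges tend to infinity. -/
  infinite : ∀ e, e = .ray₁ ∨ e = .ray₂ → Tendsto (fun x => ‖F e x‖) atTop atTop
  /-- As approaching infinity, the non-compact edges are close to straight half-lines. -/
  asymptotic : ∀ e, e = .ray₁ ∨ e = .ray₂ → ∃ a v : ℂ, v ≠ 0 ∧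
    Tendsto (fun x => Metric.infDist (F e x) (halfLine a v)) atTop (𝓝 0)

/-- The component of `w` orthogonal to `τ ≠ 0`. -/
noncomputable def normalPart (τ w : ℂ) : ℂ := w - (inner ℝ τ w / ‖τ‖ ^ 2) • τ

/-- The curvature vector at `x` of a regular parametrized curve `c`. -/
noncomputable def curvatureVector (c : ℝ → ℂ) (x : ℝ) : ℂ :=
  (1 / ‖deriv c x‖ ^ 2) • normalPart (deriv c x) (deriv (deriv c) x)

/-- `(M t)`, `t < 0`, is a smooth family of generalized lens-shaped networks `M t = F(G, t)` such
that away from the vertices the normal part of `dF/dt` is the curvature vector. -/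
def EvolvesByCurveShortening (M : ℝ → Set ℂ) : Prop :=
  ∃ F : ℝ → Edge → ℝ → ℂ,
    (∀ e, ContDiffOn ℝ ∞ (fun p : ℝ × ℝ => F p.1 e p.2) (Iio 0 ×ˢ e.dom)) ∧
    (∀ t < 0, IsGeneralizedLens (F t) ∧ M t = trace (F t)) ∧
    ∀ t < 0, ∀ e, ∀ x ∈ interior (Edge.dom e),
      normalPart (deriv (F t e) x) (deriv (fun s => F s e x) t) = curvatureVector (F t e) x

/-- Any two networks of the family `(M t)`, `t < 0`, are images of each other under a homothety
(of any centre, with positive ratio). -/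
def IsHomotheticFamily (M : ℝ → Set ℂ) : Prop :=
  ∀ t₁ < 0, ∀ t₂ < 0, ∃ (c : ℂ) (k : ℝ), 0 < k ∧ M t₁ = AffineMap.homothety c k '' M t₂

/-- The union of the bounded connected components of `ℝ² ∖ M`. -/
def boundedPart (M : Set ℂ) : Set ℂ :=
  {z | z ∈ Mᶜ ∧ Bornology.IsBounded (connectedComponentIn Mᶜ z)}

/-- The bounded components of `ℝ² ∖ M t` converge to the origin in Hausdorff distance as `t ↗ 0`.
(The extended distance is `⊤` if there is no bounded component.) -/
def ShrinksToOrigin (M : ℝ → Set ℂ) : Prop :=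
  Tendsto (fun t => Metric.hausdorffEDist (boundedPart (M t)) {0}) (𝓝[<] 0) (𝓝 0)

/-- `M` is a symmetric lens-shaped network: an arc `γ` over the `x¹`-axis which meets the axis at
`60°`, its reflection about the axis, and the two outer half-lines of the axis. -/
def IsSymmetricLens (M : Set ℂ) : Prop :=
  ∃ γ : ℝ → ℂ,
    ContDiffOn ℝ ∞ γ (Icc (-1) 1) ∧
    (∀ x ∈ Icc (-1 : ℝ) 1, derivWithin γ (Icc (-1) 1) x ≠ 0) ∧
    InjOn γ (Icc (-1) 1) ∧
    (∀ x ∈ Ioo (-1 : ℝ) 1, 0 < (γ x).im) ∧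
    (γ (-1)).im = 0 ∧ (γ 1).im = 0 ∧ (γ (-1)).re < (γ 1).re ∧
    (‖derivWithin γ (Icc (-1) 1) (-1)‖⁻¹ • derivWithin γ (Icc (-1) 1) (-1) =
      ⟨1 / 2, Real.sqrt 3 / 2⟩) ∧
    (‖derivWithin γ (Icc (-1) 1) 1‖⁻¹ • derivWithin γ (Icc (-1) 1) 1 =
      ⟨1 / 2, -(Real.sqrt 3 / 2)⟩) ∧
    M = γ '' Icc (-1) 1 ∪ (fun x => (starRingEnd ℂ) (γ x)) '' Icc (-1) 1 ∪
      {z | z.im = 0 ∧ z.re ≤ (γ (-1)).re} ∪ {z | z.im = 0 ∧ (γ 1).re ≤ z.re}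

/-- `(N t)`, `t < 0`, is a self-similarly shrinking family of symmetric lens-shaped networks that
evolves under curve shortening flow and converges to the `x¹`-axis in Hausdorff distance as
`t ↗ 0`. -/
def IsShrinkingSymmetricLens (N : ℝ → Set ℂ) : Prop :=
  EvolvesByCurveShortening N ∧ IsHomotheticFamily N ∧ (∀ t < 0, IsSymmetricLens (N t)) ∧
    Tendsto (fun t => Metric.hausdorffEDist (N t) {z | z.im = 0}) (𝓝[<] 0) (𝓝 0)

/-- `(M t)`, `t < 0`, is a homothetically shrinking family of generalized lens-shaped networks
under curve shortening flow whose bounded components shrink to the origin, and it is not a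
self-similarly shrinking symmetric lens, in whatever rotated position. -/
structure IsNonLensShrinker (M : ℝ → Set ℂ) : Prop where
  evolves : EvolvesByCurveShortening M
  homothetic : IsHomotheticFamily M
  shrinks : ShrinksToOrigin M
  ne_lens : ∀ a : Circle, ¬ IsShrinkingSymmetricLens (fun t => rotation a '' M t)

/-- `M` is a generalized lens-shaped network whose non-compact edges are half-lines that are not
parallel. -/
def HasNonParallelHalfLines (M : Set ℂ) : Prop :=
  ∃ F : Edge → ℝ → ℂ, IsGeneralizedLens F ∧ M = trace F ∧
    ∃ v w : ℂ, LinearIndependent ℝ ![v, w] ∧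
      F .ray₁ '' Edge.dom .ray₁ = halfLine (F .ray₁ 0) v ∧
      F .ray₂ '' Edge.dom .ray₂ = halfLine (F .ray₂ 0) w

end Network

/-!
The vertices, the tangent lines and the curvature of a network are determined by its image. A family
of networks which is homothetic as a family of sets is therefore of the form `k(t) • M + b(t)`, and
the flow equation says that the curvature of `M` is the normal part of the affine vector field
`k(t) • (k'(t) • z + b'(t))`. Two such fields for different times differ by an affine field which is
tangent to all three edges at both vertices, hence vanishes there, so that `k * k'` and `k • b'` are
constant; shrinking to the origin forces `k(t) = √(-t)` and `b = 0`. The problem becomes the static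
one of networks whose edges have the curvature vector `-c^⊥ / 2` (`exists_static`).

For such a curve the support function times `exp (-|c|² / 4)` is constant. An edge which tends to
infinity is thus contained in a line through the origin, while the arcs, which make an angle of
`120°` with these half-lines, have a nonvanishing support function and can be parametrized by the
polar angle. There `X = log (|c|² / 2)` and the cotangent `Y` of the angle between `c` and the tangent
solve the autonomous system `X' = 2 Y`, `Y' = (1 + Y²) (1 - exp X)` (`IsOrbit`). Its orbits are
closed, and phase and level coordinates `(α, B)` turn each of them into a circle: the polar angle as
a function of the phase is the integral `ang B` of the density `angDensity (B * sin α)`.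

The angle condition says that `Y = ± 1 / √3` at the vertices, which happens at the distance `beta B`
from the phases `∓ π / 2` of the closest and the farthest point. Embeddedness forces the half-lines
to point outwards and the two arcs to run along the same orbit and together once around the origin
(`IsShrinkingNetwork.exists_normal_form`). As the angular period exceeds `π`, only two cases remain
(`turns_eq`): the arcs are congruent and form a symmetric lens, or one of them is the short arc
around the closest point, of angle `2 * halfShort B`, and the other one is longer by a full period.
In the second case the arcs close up if and only if `fishAngle B = period B + 4 * halfShort B` equals
`2π`.

Both `period` (`period_strictAntiOn`) and `halfShort` (`halfShort_strictAntiOn`) are strictly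
decreasing in the level. For the period this rests on the density, symmetrized in `± z`, being
decreasing in `z ≥ 0`; for the short arc, on a change of variables to the cosine of the angle between
tangent and position vector. Since `fishAngle` exceeds `2π` at the lowest admissible level and is
below `2π` for large levels, exactly one level closes up (`exists_fishAngle_eq`,
`fishAngle_strictAntiOn`). The corresponding network, `fish`, has a loop which is star-shaped about
the origin, so that its rescalings by `√(-t)` form a family as required; its half-lines enclose the
angle `2 * halfShort B < π`, are therefore not parallel, and the network is not a lens.
-/

namespace Network

/-! ### The exponential profile of a level set -/

/-- The continuous extension of `(1 - (1 + s) * exp (-s)) / s ^ 2` to `s = 0`. -/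
noncomputable def phi (s : ℝ) : ℝ := ∫ t in (0 : ℝ)..1, t * Real.exp (-(t * s))

/-- Integration by parts in the definition of `phi`. -/
lemma phi_mul_sq (s : ℝ) : phi s * s ^ 2 = 1 - (1 + s) * Real.exp (-s) := by
  have h : ∀ t ∈ uIcc (0 : ℝ) 1, HasDerivAt (fun t => -((1 + t * s) * Real.exp (-(t * s))))
      (t * Real.exp (-(t * s)) * s ^ 2) t := by
    intro t _
    have h1 : HasDerivAt (fun t : ℝ => t * s) s t := by simpa using (hasDerivAt_id t).mul_const s
    have h2 := ((h1.const_add 1).mul h1.neg.exp).neg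
    refine h2.congr_deriv ?_
    simp only [Pi.neg_apply]
    ring
  have := intervalIntegral.integral_eq_sub_of_hasDerivAt h
    (Continuous.intervalIntegrable (by fun_prop) _ _)
  rw [intervalIntegral.integral_mul_const] at this
  rw [phi, this]
  simp
  ring

lemma phi_pos (s : ℝ) : 0 < phi s := by
  refine intervalIntegral.intervalIntegral_pos_of_pos_on
    (Continuous.intervalIntegrable (by fun_prop) _ _) (fun t ht => ?_) one_pos
  exact mul_pos ht.1 (Real.exp_pos _)

lemma continuous_phi : Continuous phi := by
  unfold phi
  exact intervalIntegral.continuous_parametric_intervalIntegral_of_continuous' (by fun_prop) _ _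

lemma phi_antitone : Antitone phi := by
  intro a b hab
  refine intervalIntegral.integral_mono_on zero_le_one
    (Continuous.intervalIntegrable (by fun_prop) _ _)
    (Continuous.intervalIntegrable (by fun_prop) _ _) (fun t ht => ?_)
  have := ht.1
  gcongr

lemma phi_le_one {s : ℝ} (hs : -1 ≤ s) : phi s ≤ 1 := by
  have h := phi_mul_sq (-1)
  have h1 : phi (-1) = 1 := by norm_num at h; exact h
  exact h1 ▸ phi_antitone hs

/-- The exponential of the potential energy `exp x - 1 - x`. -/
noncomputable def bigW (x : ℝ) : ℝ := Real.exp (Real.exp x - 1 - x)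

lemma hasDerivAt_bigW (x : ℝ) : HasDerivAt bigW (bigW x * (Real.exp x - 1)) x := by
  have := (((Real.hasDerivAt_exp x).sub_const 1).sub (hasDerivAt_id x)).exp
  exact this

lemma bigW_pos (x : ℝ) : 0 < bigW x := Real.exp_pos _

lemma bigW_mul_exp (x : ℝ) : bigW x * Real.exp x = Real.exp (Real.exp x - 1) := by
  rw [bigW, ← Real.exp_add]; ring_nf

lemma continuous_bigW : Continuous bigW := by unfold bigW; fun_prop

/-- The signed square root of `bigW x - 1`, written so that its smoothness at `0` is visible. -/
noncomputable def bigZ (x : ℝ) : ℝ :=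
  Real.sqrt (bigW x) * Real.sqrt (phi (Real.exp x - 1)) * (Real.exp x - 1)

lemma bigZ_sq (x : ℝ) : bigZ x ^ 2 = bigW x - 1 := by
  have h1 := Real.sq_sqrt (bigW_pos x).le
  have h2 := Real.sq_sqrt (phi_pos (Real.exp x - 1)).le
  have h3 := phi_mul_sq (Real.exp x - 1)
  have h4 : bigW x * (Real.exp x * Real.exp (-(Real.exp x - 1))) = 1 := by
    rw [← mul_assoc, bigW_mul_exp, ← Real.exp_add]; simp
  calc bigZ x ^ 2 = bigW x * (phi (Real.exp x - 1) * (Real.exp x - 1) ^ 2) := by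
        rw [bigZ, mul_pow, mul_pow, h1, h2]; ring
    _ = bigW x - 1 := by rw [h3]; linear_combination -h4

lemma continuous_bigZ : Continuous bigZ := by
  unfold bigZ
  have := continuous_phi
  have := continuous_bigW
  fun_prop

lemma bigZ_zero : bigZ 0 = 0 := by simp [bigZ]

lemma bigZ_pos {x : ℝ} (hx : 0 < x) : 0 < bigZ x := by
  have := Real.one_lt_exp_iff.2 hx
  exact mul_pos (mul_pos (Real.sqrt_pos.2 (bigW_pos x)) (Real.sqrt_pos.2 (phi_pos _)))
    (by linarith)

lemma bigZ_neg {x : ℝ} (hx : x < 0) : bigZ x < 0 := by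
  have := Real.exp_lt_one_iff.2 hx
  exact mul_neg_of_pos_of_neg (mul_pos (Real.sqrt_pos.2 (bigW_pos x)) (Real.sqrt_pos.2 (phi_pos _)))
    (by linarith)

lemma hasDerivAt_bigZ {x : ℝ} (hx : x ≠ 0) :
    HasDerivAt bigZ (bigW x * (Real.exp x - 1) / (2 * bigZ x)) x := by
  have hW : bigW x - 1 ≠ 0 := by
    rw [← bigZ_sq]
    rcases lt_or_gt_of_ne hx with h | h
    · exact pow_ne_zero 2 (bigZ_neg h).ne
    · exact pow_ne_zero 2 (bigZ_pos h).ne'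
  have hd := ((hasDerivAt_bigW x).sub_const 1).sqrt hW
  rcases lt_or_gt_of_ne hx with h | h
  · have heq : bigZ =ᶠ[𝓝 x] fun y => -Real.sqrt (bigW y - 1) := by
      filter_upwards [Iio_mem_nhds h] with y hy
      rw [← bigZ_sq, Real.sqrt_sq_eq_abs, abs_of_neg (bigZ_neg hy), neg_neg]
    have h2 : Real.sqrt (bigW x - 1) = -bigZ x := by
      rw [← bigZ_sq, Real.sqrt_sq_eq_abs, abs_of_neg (bigZ_neg h)]
    refine (hd.neg.congr_of_eventuallyEq heq).congr_deriv ?_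
    rw [h2]; ring_nf
  · have heq : bigZ =ᶠ[𝓝 x] fun y => Real.sqrt (bigW y - 1) := by
      filter_upwards [Ioi_mem_nhds h] with y hy
      rw [← bigZ_sq, Real.sqrt_sq_eq_abs, abs_of_pos (bigZ_pos hy)]
    have h2 : Real.sqrt (bigW x - 1) = bigZ x := by
      rw [← bigZ_sq, Real.sqrt_sq_eq_abs, abs_of_pos (bigZ_pos h)]
    refine (hd.congr_of_eventuallyEq heq).congr_deriv ?_
    rw [h2]

lemma strictMono_bigZ : StrictMono bigZ := by
  have key : ∀ x, x ≠ 0 → 0 < deriv bigZ x := by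
    intro x hx
    rw [(hasDerivAt_bigZ hx).deriv]
    rcases lt_or_gt_of_ne hx with h | h
    · have := Real.exp_lt_one_iff.2 h
      exact div_pos_of_neg_of_neg (mul_neg_of_pos_of_neg (bigW_pos x) (by linarith))
        (by linarith [bigZ_neg h])
    · have := Real.one_lt_exp_iff.2 h
      exact div_pos (mul_pos (bigW_pos x) (by linarith)) (by linarith [bigZ_pos h])
  have h1 : StrictMonoOn bigZ (Iic 0) :=
    strictMonoOn_of_deriv_pos (convex_Iic 0) continuous_bigZ.continuousOn
      (fun x hx => key x (by simp at hx; exact hx.ne))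
  have h2 : StrictMonoOn bigZ (Ici 0) :=
    strictMonoOn_of_deriv_pos (convex_Ici 0) continuous_bigZ.continuousOn
      (fun x hx => key x (by simp at hx; exact hx.ne'))
  exact StrictMonoOn.Iic_union_Ici h1 h2

lemma tendsto_abs_bigZ {l : Filter ℝ} (h : Tendsto bigW l atTop) :
    Tendsto (fun x => |bigZ x|) l atTop := by
  have : (fun x => |bigZ x|) = fun x => Real.sqrt (bigW x + -1) := by
    ext x; rw [← sub_eq_add_neg, ← bigZ_sq, Real.sqrt_sq_eq_abs]
  rw [this]
  exact Real.tendsto_sqrt_atTop.comp (tendsto_atTop_add_const_right _ _ h)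

lemma surjective_bigZ : Function.Surjective bigZ := by
  apply continuous_bigZ.surjective
  · have hW : Tendsto bigW atTop atTop := by
      refine Real.tendsto_exp_atTop.comp ?_
      refine tendsto_atTop_mono' atTop ?_ (tendsto_id.atTop_div_const (show (0:ℝ) < 2 by norm_num))
      filter_upwards [eventually_ge_atTop 1] with x hx
      have := Real.quadratic_le_exp_of_nonneg (show 0 ≤ x by linarith)
      simp only [id]; nlinarith
    refine (tendsto_abs_bigZ hW).congr' ?_
    filter_upwards [eventually_gt_atTop 0] with x hx
    exact abs_of_pos (bigZ_pos hx)
  · have hW : Tendsto bigW atBot atTop := by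
      refine Real.tendsto_exp_atTop.comp ?_
      refine tendsto_atTop_mono (f := fun x => -1 + -x) (fun x => ?_)
        (tendsto_atTop_add_const_left _ _ tendsto_neg_atBot_atTop)
      linarith [Real.exp_pos x]
    have := tendsto_neg_atTop_atBot.comp (tendsto_abs_bigZ hW)
    refine this.congr' ?_
    filter_upwards [eventually_lt_atBot 0] with x hx
    simp [abs_of_neg (bigZ_neg hx)]

/-- The inverse function of `bigZ`. -/
noncomputable def xi : ℝ → ℝ := (strictMono_bigZ.orderIsoOfSurjective bigZ surjective_bigZ).symm

@[simp] lemma bigZ_xi (z : ℝ) : bigZ (xi z) = z :=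
  (strictMono_bigZ.orderIsoOfSurjective bigZ surjective_bigZ).apply_symm_apply z

@[simp] lemma xi_bigZ (x : ℝ) : xi (bigZ x) = x :=
  (strictMono_bigZ.orderIsoOfSurjective bigZ surjective_bigZ).symm_apply_apply x

lemma continuous_xi : Continuous xi :=
  (strictMono_bigZ.orderIsoOfSurjective bigZ surjective_bigZ).symm.continuous

lemma strictMono_xi : StrictMono xi :=
  (strictMono_bigZ.orderIsoOfSurjective bigZ surjective_bigZ).symm.strictMono

@[simp] lemma xi_zero : xi 0 = 0 := by simpa [bigZ_zero] using xi_bigZ 0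

lemma bigW_xi (z : ℝ) : bigW (xi z) = 1 + z ^ 2 := by
  have := bigZ_sq (xi z); rw [bigZ_xi] at this; linarith

/-- The angular density: along the orbit at energy level `B`, with phase `α`, the polar angle
grows at the rate `angDensity (B * sin α)`. -/
noncomputable def angDensity (z : ℝ) : ℝ := Real.sqrt (phi (Real.exp (xi z) - 1))

lemma angDensity_pos (z : ℝ) : 0 < angDensity z := Real.sqrt_pos.2 (phi_pos _)

lemma continuous_angDensity : Continuous angDensity := by
  unfold angDensity
  have := continuous_phi
  have := continuous_xi
  fun_prop

lemma angDensity_mul (z : ℝ) :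
    angDensity z * Real.sqrt (1 + z ^ 2) * (Real.exp (xi z) - 1) = z := by
  conv_rhs => rw [← bigZ_xi z]
  rw [bigZ, bigW_xi, angDensity]; ring

lemma angDensity_le_one (z : ℝ) : angDensity z ≤ 1 := by
  exact Real.sqrt_le_one.2 <| phi_le_one (by linarith [Real.exp_pos (xi z)])

lemma angDensity_antitone : Antitone angDensity := by
  intro a b hab
  exact Real.sqrt_le_sqrt (phi_antitone (by gcongr; exact strictMono_xi.monotone hab))

lemma exp_xi_sub_one_ne {z : ℝ} (hz : z ≠ 0) : Real.exp (xi z) - 1 ≠ 0 := by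
  intro h
  have := angDensity_mul z
  rw [h, mul_zero] at this
  exact hz this.symm

/-- Away from `0` this is the derivative of the inverse function; the formula persists at `0`, where
the derivative of `bigZ` is a removable singularity, because its right-hand side is continuous. -/
lemma hasDerivAt_xi (z : ℝ) : HasDerivAt xi (2 * angDensity z / Real.sqrt (1 + z ^ 2)) z := by
  have key : ∀ z, z ≠ 0 → HasDerivAt xi (2 * angDensity z / Real.sqrt (1 + z ^ 2)) z := by
    intro z hz
    have hx : xi z ≠ 0 := fun h => hz (by rw [← bigZ_xi z, h, bigZ_zero])
    have h1 := hasDerivAt_bigZ hx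
    have hs := exp_xi_sub_one_ne hz
    have hW := bigW_pos (xi z)
    rw [bigZ_xi] at h1
    have h2 := HasDerivAt.of_local_left_inverse (f := bigZ) (g := xi) continuous_xi.continuousAt h1
      (div_ne_zero (mul_ne_zero hW.ne' hs) (by simpa using hz))
      (Eventually.of_forall bigZ_xi)
    refine h2.congr_deriv ?_
    rw [bigW_xi] at *
    have h3 := angDensity_mul z
    have h4 : Real.sqrt (1 + z ^ 2) ^ 2 = 1 + z ^ 2 := Real.sq_sqrt hW.le
    have h5 : 0 < Real.sqrt (1 + z ^ 2) := Real.sqrt_pos.2 hW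
    rw [inv_div, div_eq_div_iff (by positivity) h5.ne']
    linear_combination (-2 * Real.sqrt (1 + z ^ 2)) * h3 +
      2 * angDensity z * (Real.exp (xi z) - 1) * h4
  by_cases hz : z = 0
  · subst hz
    refine hasDerivAt_of_hasDerivAt_of_ne (fun y hy => key y hy) continuous_xi.continuousAt ?_
    have := continuous_angDensity
    refine Continuous.continuousAt (Continuous.div (by fun_prop) (by fun_prop) fun y => ?_)
    positivity
  · exact key z hz

lemma tendsto_xi_atTop : Tendsto xi atTop atTop :=
  (strictMono_bigZ.orderIsoOfSurjective bigZ surjective_bigZ).symm.tendsto_atTop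

lemma tendsto_xi_atBot : Tendsto xi atBot atBot :=
  (strictMono_bigZ.orderIsoOfSurjective bigZ surjective_bigZ).symm.tendsto_atBot

lemma tendsto_angDensity_atTop : Tendsto angDensity atTop (𝓝 0) := by
  have h1 : Tendsto (fun z => Real.exp (xi z) - 1) atTop atTop :=
    tendsto_atTop_add_const_right _ _ (Real.tendsto_exp_atTop.comp tendsto_xi_atTop)
  refine tendsto_of_tendsto_of_tendsto_of_le_of_le' tendsto_const_nhds h1.inv_tendsto_atTop
    (Eventually.of_forall fun z => (angDensity_pos z).le) ?_
  filter_upwards [h1.eventually_gt_atTop 0, eventually_gt_atTop 0] with z hz hz0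
  rw [Pi.inv_apply, ← one_div, le_div_iff₀ hz]
  have h2 := angDensity_mul z
  have h3 : z ≤ Real.sqrt (1 + z ^ 2) := Real.le_sqrt_of_sq_le (by linarith)
  have h4 := mul_pos (angDensity_pos z) hz
  by_contra! h
  nlinarith

lemma tendsto_angDensity_atBot : Tendsto angDensity atBot (𝓝 1) := by
  have h1 : Tendsto (fun z => Real.exp (xi z) - 1) atBot (𝓝 (0 - 1)) :=
    (Real.tendsto_exp_atBot.comp tendsto_xi_atBot).sub_const 1
  have h2 : phi (0 - 1) = 1 := by have h := phi_mul_sq (-1); norm_num at h ⊢; exact h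
  have := ((continuous_phi.tendsto _).comp h1).sqrt
  rw [h2, Real.sqrt_one] at this
  exact this

/-! ### Monotonicity of the symmetrized angular density -/

/-- The angular density, symmetrized over the two branches of the orbit. -/
noncomputable def symDensity (z : ℝ) : ℝ := angDensity z + angDensity (-z)

lemma continuous_symDensity : Continuous symDensity := by
  unfold symDensity
  have := continuous_angDensity
  fun_prop

/-- The derivative of the density is `(1 + z ^ 2) ^ (-3 / 2)` times the function
`(s ^ 2 - 2 * (exp s - 1 - s)) / s ^ 3` of `s = exp (xi z) - 1`. -/
lemma hasDerivAt_angDensity {z : ℝ} (hz : z ≠ 0) :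
    HasDerivAt angDensity
      (((Real.exp (xi z) - 1) ^ 2 - 2 * (Real.exp (Real.exp (xi z) - 1) - 1 -
        (Real.exp (xi z) - 1))) / (Real.exp (xi z) - 1) ^ 3 / Real.sqrt (1 + z ^ 2) ^ 3) z := by
  have hs := exp_xi_sub_one_ne hz
  have hsq : 0 < Real.sqrt (1 + z ^ 2) := Real.sqrt_pos.2 (by positivity)
  have hP : ∀ y, y ≠ 0 → angDensity y = y / (Real.sqrt (1 + y ^ 2) * (Real.exp (xi y) - 1)) := by
    intro y hy
    have hs := exp_xi_sub_one_ne hy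
    have hsq : 0 < Real.sqrt (1 + y ^ 2) := Real.sqrt_pos.2 (by positivity)
    rw [eq_div_iff (mul_ne_zero hsq.ne' hs), ← mul_assoc, angDensity_mul]
  have heq : angDensity =ᶠ[𝓝 z] fun y => y / (Real.sqrt (1 + y ^ 2) * (Real.exp (xi y) - 1)) := by
    filter_upwards [isOpen_ne.mem_nhds hz] with y hy using hP y hy
  have h1 : HasDerivAt (fun y : ℝ => Real.sqrt (1 + y ^ 2)) (z / Real.sqrt (1 + z ^ 2)) z := by
    have := (((hasDerivAt_id z).pow 2).const_add 1).sqrt (show (1 + z ^ 2 : ℝ) ≠ 0 by positivity)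
    refine this.congr_deriv ?_
    simp; field_simp
  have h2 := (hasDerivAt_id z).div (h1.mul ((hasDerivAt_xi z).exp.sub_const 1))
    (mul_ne_zero hsq.ne' hs)
  refine (h2.congr_of_eventuallyEq heq).congr_deriv ?_
  have h4 : Real.sqrt (1 + z ^ 2) ^ 2 = 1 + z ^ 2 := Real.sq_sqrt (by positivity)
  have h5 : Real.exp (Real.exp (xi z) - 1) = Real.sqrt (1 + z ^ 2) ^ 2 * Real.exp (xi z) := by
    rw [h4, ← bigW_xi, bigW_mul_exp]
  have h6 : z ^ 2 = Real.sqrt (1 + z ^ 2) ^ 2 - 1 := by rw [h4]; ring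
  rw [h5, hP z hz]
  simp only [id, Pi.mul_apply]
  generalize Real.sqrt (1 + z ^ 2) = w at *
  obtain ⟨s, hs'⟩ : ∃ s, s = Real.exp (xi z) - 1 := ⟨_, rfl⟩
  have he : Real.exp (xi z) = s + 1 := by rw [hs']; ring
  rw [he] at hs ⊢
  have hs0 : s ≠ 0 := by simpa using hs
  have hss : s + 1 - 1 = s := by ring
  rw [hss]
  field_simp
  rw [h6]
  ring

/-- Up to a positive factor, the derivative of the symmetrized density is `q(s₊) - q(s₋)`, with
`q(s) = (s ^ 2 - 2 * (exp s - 1 - s)) / s ^ 3` and `s₋ < 0 < s₊`. The limit of `q` at `0` is `-1 / 3`,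
and the Taylor expansion of the exponential puts `q(s₊)` below and `q(s₋)` not below it. -/
lemma symDensity_strictAntiOn : StrictAntiOn symDensity (Ici 0) := by
  apply strictAntiOn_of_deriv_neg (convex_Ici 0) continuous_symDensity.continuousOn
  intro z hz
  simp only [interior_Ici, mem_Ioi] at hz
  have h1 := hasDerivAt_angDensity hz.ne'
  have h2 := (hasDerivAt_angDensity (neg_ne_zero.2 hz.ne')).comp z (hasDerivAt_neg z)
  have h3 : HasDerivAt symDensity _ z := h1.add h2
  rw [h3.deriv, neg_sq]
  have hw : 0 < Real.sqrt (1 + z ^ 2) ^ 3 := by positivity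
  have hpos : 0 < Real.exp (xi z) - 1 := by
    have := strictMono_xi hz; rw [xi_zero] at this
    linarith [Real.one_lt_exp_iff.2 this]
  have hneg : Real.exp (xi (-z)) - 1 < 0 := by
    have := strictMono_xi (neg_lt_zero.2 hz); rw [xi_zero] at this
    linarith [Real.exp_lt_one_iff.2 this]
  have q1 : ∀ s : ℝ, 0 < s → (s ^ 2 - 2 * (Real.exp s - 1 - s)) / s ^ 3 < -(1 / 3) := by
    intro s hs
    rw [div_lt_iff₀ (by positivity)]
    have := Real.sum_le_exp_of_nonneg hs.le 5
    norm_num [Finset.sum_range_succ, Nat.factorial] at this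
    nlinarith [pow_pos hs 4]
  have q2 : ∀ s : ℝ, s < 0 → -(1 / 3) ≤ (s ^ 2 - 2 * (Real.exp s - 1 - s)) / s ^ 3 := by
    intro s hs
    have h3 : s ^ 3 < 0 := by have := pow_pos (neg_pos.2 hs) 3; nlinarith
    rw [le_div_iff_of_neg h3]
    have : 1 + s + s ^ 2 / 2 + s ^ 3 / 6 ≤ Real.exp s := by
      have hd : ∀ x : ℝ, HasDerivAt (fun s => Real.exp s - (1 + s + s ^ 2 / 2 + s ^ 3 / 6))
          (Real.exp x - (1 + x + x ^ 2 / 2)) x := by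
        intro x
        have := (Real.hasDerivAt_exp x).sub ((((hasDerivAt_id x).const_add 1).add
          (((hasDerivAt_id x).pow 2).div_const 2)).add (((hasDerivAt_id x).pow 3).div_const 6))
        refine this.congr_deriv ?_
        simp; ring
      have hd2 : ∀ x : ℝ, HasDerivAt (fun s => Real.exp s - (1 + s + s ^ 2 / 2))
          (Real.exp x - (1 + x)) x := by
        intro x
        have := (Real.hasDerivAt_exp x).sub (((hasDerivAt_id x).const_add 1).add
          (((hasDerivAt_id x).pow 2).div_const 2))
        refine this.congr_deriv ?_
        simp
      have m2 : Monotone (fun s => Real.exp s - (1 + s + s ^ 2 / 2)) :=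
        monotone_of_deriv_nonneg (fun x => (hd2 x).differentiableAt) fun x => by
          rw [(hd2 x).deriv]; linarith [Real.add_one_le_exp x]
      have m3 : AntitoneOn (fun s => Real.exp s - (1 + s + s ^ 2 / 2 + s ^ 3 / 6)) (Iic 0) := by
        apply antitoneOn_of_deriv_nonpos (convex_Iic 0)
          (fun x _ => (hd x).continuousAt.continuousWithinAt)
          (fun x _ => (hd x).differentiableAt.differentiableWithinAt)
        intro x hx
        simp only [interior_Iic, mem_Iio] at hx
        rw [(hd x).deriv]
        have := m2 hx.le
        simpa using this
      have := m3 (mem_Iic.2 hs.le) (mem_Iic.2 le_rfl) hs.le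
      simp at this
      linarith
    linarith
  have e1 := q1 _ hpos
  have e2 := q2 _ hneg
  have := div_lt_div_of_pos_right (e1.trans_le e2) hw
  linarith

/-- As `z` tends to infinity, the symmetrized density decreases to `0 + 1`. -/
lemma one_lt_symDensity {z : ℝ} (hz : 0 ≤ z) : 1 < symDensity z := by
  have h1 : symDensity (z + 1) < symDensity z :=
    symDensity_strictAntiOn (mem_Ici.2 hz) (mem_Ici.2 (by linarith)) (by linarith)
  have h2 : Tendsto symDensity atTop (𝓝 (0 + 1)) :=
    tendsto_angDensity_atTop.add (tendsto_angDensity_atBot.comp tendsto_neg_atTop_atBot)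
  have h3 : 0 + 1 ≤ symDensity (z + 1) := by
    refine le_of_tendsto h2 ?_
    filter_upwards [eventually_ge_atTop (z + 1)] with y hy
    exact symDensity_strictAntiOn.antitoneOn (mem_Ici.2 (by linarith)) (mem_Ici.2 (by linarith)) hy
  linarith

end Network
namespace Network

/-! ### The polar angle along an orbit -/

/-- The polar angle swept out along the orbit at level `B`, as a function of the phase `α`. It is
normalized to vanish at the phase `-π/2`, where the distance to the origin is minimal. -/
noncomputable def ang (B α : ℝ) : ℝ :=
  ∫ s in (-(Real.pi / 2))..α, angDensity (B * Real.sin s)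

lemma continuous_angDensity_sin (B : ℝ) : Continuous fun s => angDensity (B * Real.sin s) := by
  have := continuous_angDensity
  fun_prop

lemma hasDerivAt_ang (B α : ℝ) : HasDerivAt (ang B) (angDensity (B * Real.sin α)) α :=
  intervalIntegral.integral_hasDerivAt_right
    ((continuous_angDensity_sin B).intervalIntegrable _ _)
    ((continuous_angDensity_sin B).stronglyMeasurableAtFilter _ _)
    (continuous_angDensity_sin B).continuousAt

lemma continuous_ang (B : ℝ) : Continuous (ang B) :=
  continuous_iff_continuousAt.2 fun α => (hasDerivAt_ang B α).continuousAt

lemma continuous_ang_uncurry : Continuous fun p : ℝ × ℝ => ang p.1 p.2 := by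
  have h : Continuous (Function.uncurry fun (p : ℝ × ℝ) (s : ℝ) =>
      angDensity (p.1 * Real.sin s)) := by
    have := continuous_angDensity
    simp only [Function.uncurry_def]
    fun_prop
  exact intervalIntegral.continuous_parametric_intervalIntegral_of_continuous h continuous_snd

lemma strictMono_ang (B : ℝ) : StrictMono (ang B) :=
  strictMono_of_deriv_pos fun α => by
    rw [(hasDerivAt_ang B α).deriv]; exact angDensity_pos _

@[simp] lemma ang_neg_pi_div_two (B : ℝ) : ang B (-(Real.pi / 2)) = 0 := by simp [ang]

lemma ang_sub (B a b : ℝ) : ang B b - ang B a = ∫ s in a..b, angDensity (B * Real.sin s) := by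
  rw [ang, ang]
  exact intervalIntegral.integral_interval_sub_left
    ((continuous_angDensity_sin B).intervalIntegrable _ _)
    ((continuous_angDensity_sin B).intervalIntegrable _ _)

lemma ang_reflect (B α : ℝ) : ang B (-Real.pi - α) = -ang B α := by
  have h := intervalIntegral.integral_comp_sub_left (a := -(Real.pi / 2)) (b := α)
    (fun s => angDensity (B * Real.sin s)) (-Real.pi)
  have h2 : ∀ s, Real.sin (-Real.pi - s) = Real.sin s := by
    intro s; rw [← neg_add', Real.sin_neg, add_comm, Real.sin_add_pi, neg_neg]
  simp only [h2] at h
  rw [ang, ang, h, intervalIntegral.integral_symm]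
  congr 2
  ring

/-- The polar angle swept out during one full oscillation at level `B`. -/
noncomputable def period (B : ℝ) : ℝ := ang B (3 * Real.pi / 2)

lemma ang_add_two_pi (B α : ℝ) : ang B (α + 2 * Real.pi) = ang B α + period B := by
  have hp : Function.Periodic (fun s => angDensity (B * Real.sin s)) (2 * Real.pi) := by
    intro s; simp
  have h1 := hp.intervalIntegral_add_eq α (-(Real.pi / 2))
  rw [← ang_sub, ← ang_sub] at h1
  have h2 : -(Real.pi / 2) + 2 * Real.pi = 3 * Real.pi / 2 := by ring
  rw [h2] at h1
  simp [period] at *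
  linarith

lemma ang_add_nat_mul (B α : ℝ) (n : ℕ) :
    ang B (α + n * (2 * Real.pi)) = ang B α + n * period B := by
  induction n with
  | zero => simp
  | succ n ih =>
    have : α + (n + 1 : ℕ) * (2 * Real.pi) = α + n * (2 * Real.pi) + 2 * Real.pi := by
      push_cast; ring
    rw [this, ang_add_two_pi, ih]; push_cast; ring

lemma ang_pi_sub (B α : ℝ) : ang B (Real.pi - α) = period B - ang B α := by
  have : Real.pi - α = (-Real.pi - α) + 2 * Real.pi := by ring
  rw [this, ang_add_two_pi, ang_reflect]; ring

lemma two_mul_ang_pi_div_two (B : ℝ) : 2 * ang B (Real.pi / 2) = period B := by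
  have := ang_pi_sub B (Real.pi / 2)
  rw [sub_half] at this
  linarith

lemma period_pos (B : ℝ) : 0 < period B := by
  have := strictMono_ang B (show -(Real.pi / 2) < 3 * Real.pi / 2 by linarith [Real.pi_pos])
  simpa [period] using this

lemma ang_add_int_mul (B α : ℝ) (n : ℤ) :
    ang B (α + n * (2 * Real.pi)) = ang B α + n * period B := by
  obtain ⟨k, rfl | rfl⟩ := n.eq_nat_or_neg
  · exact_mod_cast ang_add_nat_mul B α k
  · have := ang_add_nat_mul B (α + (-(k : ℤ) : ℤ) * (2 * Real.pi)) k
    push_cast at this ⊢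
    rw [show α + -(k : ℝ) * (2 * Real.pi) + k * (2 * Real.pi) = α by ring] at this
    linarith

lemma period_eq (B : ℝ) :
    period B = 2 * ∫ s in (0 : ℝ)..(Real.pi / 2), symDensity (B * Real.sin s) := by
  rw [← two_mul_ang_pi_div_two]
  have hc := continuous_angDensity_sin B
  have h1 : ang B (Real.pi / 2) = (∫ s in (-(Real.pi / 2))..0, angDensity (B * Real.sin s)) +
      ∫ s in (0 : ℝ)..(Real.pi / 2), angDensity (B * Real.sin s) :=
    (intervalIntegral.integral_add_adjacent_intervals (hc.intervalIntegrable _ _)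
      (hc.intervalIntegrable _ _)).symm
  have h2 := intervalIntegral.integral_comp_neg (a := 0) (b := Real.pi / 2)
    (fun s => angDensity (B * Real.sin s))
  simp only [Real.sin_neg, neg_zero] at h2
  have hc2 : Continuous fun s => angDensity (B * -Real.sin s) := by
    have := continuous_angDensity
    fun_prop
  rw [h1, ← h2, add_comm, ← intervalIntegral.integral_add (hc.intervalIntegrable _ _)
    (hc2.intervalIntegrable _ _)]
  simp [symDensity]

lemma continuous_symDensity_sin (B : ℝ) : Continuous fun s => symDensity (B * Real.sin s) := by
  have := continuous_symDensity
  fun_prop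

/-- The angular period decreases strictly with the energy level. -/
lemma period_strictAntiOn : StrictAntiOn period (Ici 0) := by
  intro a ha b hb hab
  simp only [mem_Ici] at ha hb
  rw [period_eq, period_eq]
  refine mul_lt_mul_of_pos_left ?_ two_pos
  have hsin : ∀ s ∈ Ioc (0 : ℝ) (Real.pi / 2), 0 < Real.sin s := fun s hs =>
    Real.sin_pos_of_pos_of_lt_pi hs.1 (by linarith [hs.2, Real.pi_pos])
  have hlt : ∀ s ∈ Ioc (0 : ℝ) (Real.pi / 2),
      symDensity (b * Real.sin s) < symDensity (a * Real.sin s) := by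
    intro s hs
    have := hsin s hs
    exact symDensity_strictAntiOn (mem_Ici.2 (by positivity)) (mem_Ici.2 (by positivity))
      (by gcongr)
  refine intervalIntegral.integral_lt_integral_of_continuousOn_of_le_of_exists_lt
    (by positivity) (continuous_symDensity_sin b).continuousOn
    (continuous_symDensity_sin a).continuousOn (fun s hs => (hlt s hs).le)
    ⟨Real.pi / 2, ⟨by positivity, le_rfl⟩, hlt _ ⟨by positivity, le_rfl⟩⟩

/-- The infimum `π` of the periods is approached as the level tends to infinity. -/
lemma pi_lt_period {B : ℝ} (hB : 0 ≤ B) : Real.pi < period B := by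
  rw [period_eq]
  have h : (∫ s in (0 : ℝ)..(Real.pi / 2), (1 : ℝ)) <
      ∫ s in (0 : ℝ)..(Real.pi / 2), symDensity (B * Real.sin s) := by
    have hlt : ∀ s ∈ Icc (0 : ℝ) (Real.pi / 2), 1 < symDensity (B * Real.sin s) := by
      intro s hs
      have := Real.sin_nonneg_of_nonneg_of_le_pi hs.1 (by linarith [hs.2, Real.pi_pos])
      exact one_lt_symDensity (by positivity)
    refine intervalIntegral.integral_lt_integral_of_continuousOn_of_le_of_exists_lt
      (by positivity) continuousOn_const
      (continuous_symDensity_sin B).continuousOn (fun s hs => (hlt s ⟨hs.1.le, hs.2⟩).le)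
      ⟨0, ⟨le_rfl, by positivity⟩, hlt _ ⟨le_rfl, by positivity⟩⟩
  simp at h
  linarith

/-! ### The phases at which the tangent makes an angle of `60°` with the position vector -/

/-- The phase distance from the apsides at which the tangent makes an angle of `60°` or `120°` with
the position vector; such points exist for `1 ≤ 3 * B ^ 2`. -/
noncomputable def beta (B : ℝ) : ℝ := Real.arcsin (Real.sqrt (1 + B ^ 2) / (2 * B))

lemma sin_beta_aux {B : ℝ} (hB : 0 < B) (h3 : 1 ≤ 3 * B ^ 2) :
    Real.sqrt (1 + B ^ 2) / (2 * B) ≤ 1 := by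
  rw [div_le_one (by positivity), Real.sqrt_le_left (by positivity)]
  nlinarith

lemma sin_beta {B : ℝ} (hB : 0 < B) (h3 : 1 ≤ 3 * B ^ 2) :
    Real.sin (beta B) = Real.sqrt (1 + B ^ 2) / (2 * B) :=
  Real.sin_arcsin (by linarith [show 0 ≤ Real.sqrt (1 + B ^ 2) / (2 * B) by positivity])
    (sin_beta_aux hB h3)

lemma beta_pos {B : ℝ} (hB : 0 < B) : 0 < beta B := Real.arcsin_pos.2 (by positivity)

lemma beta_le (B : ℝ) : beta B ≤ Real.pi / 2 := Real.arcsin_le_pi_div_two _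

lemma ang_neg_pi_div_two_add (B y : ℝ) :
    ang B (-(Real.pi / 2) + y) = ∫ s in (0 : ℝ)..y, angDensity (-(B * Real.cos s)) := by
  have h := intervalIntegral.integral_comp_add_left (a := 0) (b := y)
    (fun s => angDensity (B * Real.sin s)) (-(Real.pi / 2))
  rw [ang, ← add_zero (-(Real.pi / 2)), add_assoc, zero_add, ← h]
  congr 1; ext s
  rw [add_comm, ← sub_eq_add_neg, Real.sin_sub_pi_div_two, mul_neg]

lemma ang_pi_div_two_sub (B y : ℝ) :
    ang B (Real.pi / 2) - ang B (Real.pi / 2 - y) =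
      ∫ s in (0 : ℝ)..y, angDensity (B * Real.cos s) := by
  have h := intervalIntegral.integral_comp_sub_left (a := 0) (b := y)
    (fun s => angDensity (B * Real.sin s)) (Real.pi / 2)
  rw [ang_sub]
  simp only [Real.sin_pi_div_two_sub, sub_zero] at h
  exact h.symm

/-- The angle swept out near the closest point to the origin is at least the one swept out near the
farthest point. -/
lemma ang_pi_div_two_sub_le {B y : ℝ} (hB : 0 ≤ B) (hy : 0 ≤ y) (hy2 : y ≤ Real.pi / 2) :
    ang B (Real.pi / 2) - ang B (Real.pi / 2 - y) ≤ ang B (-(Real.pi / 2) + y) := by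
  rw [ang_neg_pi_div_two_add, ang_pi_div_two_sub]
  have := continuous_angDensity
  refine intervalIntegral.integral_mono_on hy
    (Continuous.intervalIntegrable (by fun_prop) _ _)
    (Continuous.intervalIntegrable (by fun_prop) _ _) (fun s hs => ?_)
  have := Real.cos_nonneg_of_mem_Icc (x := s)
    ⟨by linarith [hs.1, Real.pi_pos], by linarith [hs.2]⟩
  exact angDensity_antitone (by nlinarith [mul_nonneg hB this])

/-- Half of the polar angle swept out by a short arc around the closest point to the origin, between
the phases at which the tangent makes an angle of `60°` with the position vector. -/
noncomputable def halfShort (B : ℝ) : ℝ := ang B (-(Real.pi / 2) + beta B)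

lemma halfShort_pos {B : ℝ} (hB : 0 < B) : 0 < halfShort B := by
  have := strictMono_ang B (show -(Real.pi / 2) < -(Real.pi / 2) + beta B by linarith [beta_pos hB])
  simpa [halfShort] using this

/-- The phases `-π/2 + β`, `π/2 - β` cut half a period into the pieces next to the closest and the
farthest point and a middle piece; the piece next to the farthest point is the one which turns less. -/
lemma half_period_le {B : ℝ} (hB : 0 < B) :
    period B / 2 ≤ ang B (Real.pi / 2 - beta B) + halfShort B := by
  have := ang_pi_div_two_sub_le hB.le (beta_pos hB).le (beta_le B)
  have := two_mul_ang_pi_div_two B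
  unfold halfShort
  linarith

/-- In terms of the cosine `y` of the angle between tangent and position vector, the polar angle has
a derivative which is visibly decreasing in `B`. -/
lemma hasDerivAt_ang_arcsin {B y : ℝ} (hB : 0 < B) (h3 : 1 ≤ 3 * B ^ 2) (hy : 0 ≤ y)
    (hy2 : y < 1 / 2) :
    HasDerivAt (fun y => ang B (-(Real.pi / 2) + Real.arcsin (y * (Real.sqrt (1 + B ^ 2) / B))))
      (1 / (Real.sqrt (1 - y ^ 2) *
        (1 - Real.exp (xi (-Real.sqrt (B ^ 2 * (1 - y ^ 2) - y ^ 2)))))) y := by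
  set m := Real.sqrt (1 + B ^ 2) / B with hm
  have hm0 : 0 < m := by positivity
  have hmsq : m ^ 2 * B ^ 2 = 1 + B ^ 2 := by
    rw [hm, div_pow, Real.sq_sqrt (by positivity)]; field_simp
  have hym : y * m < 1 := by
    have := sin_beta_aux hB h3
    have h2 : m / 2 ≤ 1 := by rw [hm, div_div, mul_comm B]; exact this
    nlinarith
  have hym0 : 0 ≤ y * m := by positivity
  have h1 := ((Real.hasDerivAt_arcsin (show y * m ≠ -1 by linarith) hym.ne).comp y
    ((hasDerivAt_id y).mul_const m)).const_add (-(Real.pi / 2))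
  have h2 := (hasDerivAt_ang B _).comp y h1
  refine h2.congr_deriv ?_
  have hsin : Real.sin (-(Real.pi / 2) + Real.arcsin (y * m)) = -Real.sqrt (1 - (y * m) ^ 2) := by
    rw [add_comm, ← sub_eq_add_neg, Real.sin_sub_pi_div_two, Real.cos_arcsin]
  have hq : 0 < 1 - (y * m) ^ 2 := by nlinarith
  have hz : B * Real.sqrt (1 - (y * m) ^ 2) = Real.sqrt (B ^ 2 * (1 - y ^ 2) - y ^ 2) := by
    rw [← Real.sqrt_sq hB.le, ← Real.sqrt_mul (sq_nonneg B), Real.sqrt_sq hB.le]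
    congr 1
    linear_combination -y ^ 2 * hmsq
  simp only [Function.comp, id, one_mul] at *
  rw [hsin, mul_neg, hz]
  set z := -Real.sqrt (B ^ 2 * (1 - y ^ 2) - y ^ 2) with hzdef
  have hz0 : z < 0 := by
    rw [hzdef, ← hz]
    have : 0 < Real.sqrt (1 - (y * m) ^ 2) := Real.sqrt_pos.2 hq
    nlinarith
  have hP := angDensity_mul z
  have hnn : 0 ≤ B ^ 2 * (1 - y ^ 2) - y ^ 2 := by nlinarith
  have hzsq : 1 + z ^ 2 = (1 + B ^ 2) * (1 - y ^ 2) := by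
    rw [hzdef, neg_sq, Real.sq_sqrt hnn]; ring
  rw [hzsq, Real.sqrt_mul (by positivity)] at hP
  have hE : Real.exp (xi z) - 1 < 0 := by
    have := strictMono_xi hz0; rw [xi_zero] at this
    linarith [Real.exp_lt_one_iff.2 this]
  have e1 : 0 < Real.sqrt (1 - (y * m) ^ 2) := Real.sqrt_pos.2 hq
  have e2 : 0 < Real.sqrt (1 - y ^ 2) := Real.sqrt_pos.2 (by nlinarith)
  have e3 : Real.sqrt (1 + B ^ 2) = m * B := by rw [hm]; field_simp
  rw [e3] at hP
  have e4 : z = -(B * Real.sqrt (1 - (y * m) ^ 2)) := by rw [hzdef, hz]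
  rw [eq_div_iff (mul_ne_zero e2.ne' (by linarith))]
  have h : angDensity z * m * Real.sqrt (1 - y ^ 2) * (1 - Real.exp (xi z)) =
      Real.sqrt (1 - (y * m) ^ 2) :=
    mul_left_cancel₀ hB.ne' (by linear_combination -hP - e4)
  rw [one_div_mul_eq_div, mul_div_assoc', div_mul_eq_mul_div, div_eq_one_iff_eq e1.ne', ← h]
  ring

/-- In the variable `y` of `hasDerivAt_ang_arcsin` the short arc corresponds to the interval
`[0, 1 / 2]` for every level, so that the derivatives can be compared pointwise. -/
lemma halfShort_strictAntiOn : StrictAntiOn halfShort {B | 0 < B ∧ 1 ≤ 3 * B ^ 2} := by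
  intro a ha b hb hab
  obtain ⟨ha0, ha3⟩ := ha
  obtain ⟨hb0, hb3⟩ := hb
  set f : ℝ → ℝ → ℝ := fun B y =>
    ang B (-(Real.pi / 2) + Real.arcsin (y * (Real.sqrt (1 + B ^ 2) / B))) with hf
  have hf0 : ∀ B, f B 0 = 0 := fun B => by simp [hf]
  have hfe : ∀ B, f B (1 / 2) = halfShort B := fun B => by
    simp only [hf, halfShort, beta]
    congr 3
    rw [one_div, ← div_eq_inv_mul, div_div, mul_comm B]
  have hmono : StrictMonoOn (fun y => f a y - f b y) (Icc 0 (1 / 2)) := by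
    apply strictMonoOn_of_deriv_pos (convex_Icc _ _)
    · apply Continuous.continuousOn
      have h1 := continuous_ang a
      have h2 := continuous_ang b
      have h3 := Real.continuous_arcsin
      fun_prop
    · intro y hy
      rw [interior_Icc] at hy
      have hd : HasDerivAt (fun y => f a y - f b y) _ y :=
        (hasDerivAt_ang_arcsin ha0 ha3 hy.1.le hy.2).sub
          (hasDerivAt_ang_arcsin hb0 hb3 hy.1.le hy.2)
      rw [hd.deriv, sub_pos]
      have hy1 : 0 < 1 - y ^ 2 := by nlinarith [hy.1, hy.2]
      have hq : 0 < a ^ 2 * (1 - y ^ 2) - y ^ 2 := by nlinarith [hy.1, hy.2]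
      have hlt : -Real.sqrt (b ^ 2 * (1 - y ^ 2) - y ^ 2) <
          -Real.sqrt (a ^ 2 * (1 - y ^ 2) - y ^ 2) := by
        apply neg_lt_neg
        apply Real.sqrt_lt_sqrt hq.le
        have : a ^ 2 < b ^ 2 := by gcongr
        nlinarith
      have hz : xi (-Real.sqrt (a ^ 2 * (1 - y ^ 2) - y ^ 2)) < 0 := by
        rw [← xi_zero]
        exact strictMono_xi (neg_lt_zero.2 (Real.sqrt_pos.2 hq))
      have hE := Real.exp_lt_one_iff.2 hz
      have hE2 := Real.exp_lt_exp.2 (strictMono_xi hlt)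
      have hs : 0 < Real.sqrt (1 - y ^ 2) := Real.sqrt_pos.2 hy1
      apply one_div_lt_one_div_of_lt
      · exact mul_pos hs (by linarith)
      · exact mul_lt_mul_of_pos_left (by linarith) hs
  have := hmono ⟨le_rfl, by norm_num⟩ ⟨by norm_num, le_rfl⟩ (show (0 : ℝ) < 1 / 2 by norm_num)
  simp only [hf0, hfe] at this
  linarith

/-! ### The energy level of the fish -/

/-- The angle swept out by a short arc and a long arc (longer by one period) with the same end
points. The two arcs close up around the origin when it is `2π`. -/
noncomputable def fishAngle (B : ℝ) : ℝ := period B + 4 * halfShort B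

lemma fishAngle_strictAntiOn : StrictAntiOn fishAngle {B | 0 < B ∧ 1 ≤ 3 * B ^ 2} := by
  intro a ha b hb hab
  have h1 := halfShort_strictAntiOn ha hb hab
  have h2 := period_strictAntiOn (mem_Ici.2 ha.1.le) (mem_Ici.2 hb.1.le) hab
  unfold fishAngle
  linarith

/-- As `B` tends to infinity, the period tends to at most `π` (the density stays below `1` near the
closest point and vanishes in the limit near the farthest one) and `beta B` tends to `π / 6`, so that
the limit of `fishAngle` is at most `π + 4 * π / 6`. -/
lemma exists_fishAngle_lt : ∃ B, 1 ≤ B ∧ fishAngle B < 2 * Real.pi := by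
  have hbeta : Tendsto beta atTop (𝓝 (Real.pi / 6)) := by
    have h1 : Tendsto (fun B : ℝ => Real.sqrt (1 + (B⁻¹) ^ 2) / 2) atTop (𝓝 (1 / 2)) := by
      have : Tendsto (fun x : ℝ => Real.sqrt (1 + x ^ 2) / 2) (𝓝 0) (𝓝 (1 / 2)) :=
        Continuous.tendsto' (by fun_prop) _ _ (by simp)
      exact this.comp tendsto_inv_atTop_zero
    have h2 : Real.arcsin (1 / 2) = Real.pi / 6 := by
      rw [← Real.sin_pi_div_six]
      exact Real.arcsin_sin (by linarith [Real.pi_pos]) (by linarith [Real.pi_pos])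
    rw [← h2]
    refine ((Real.continuous_arcsin.tendsto _).comp h1).congr' ?_
    filter_upwards [eventually_gt_atTop 0] with B hB
    simp only [Function.comp, beta]
    congr 1
    have h3 : 1 + B ^ 2 = B ^ 2 * (1 + B⁻¹ ^ 2) := by field_simp; ring
    rw [h3, Real.sqrt_mul (sq_nonneg B), Real.sqrt_sq hB.le]
    field_simp
  have hint : Tendsto (fun B => ∫ s in (0 : ℝ)..(Real.pi / 2), angDensity (B * Real.sin s)) atTop
      (𝓝 (∫ s in (0 : ℝ)..(Real.pi / 2), (0 : ℝ))) := by
    refine intervalIntegral.tendsto_integral_filter_of_dominated_convergence (fun _ => 1)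
      (Eventually.of_forall fun B => (continuous_angDensity_sin B).aestronglyMeasurable)
      (Eventually.of_forall fun B => Eventually.of_forall fun s _ => ?_) (by simp)
      (Eventually.of_forall fun s hs => ?_)
    · rw [Real.norm_of_nonneg (angDensity_pos _).le]; exact angDensity_le_one _
    · rw [uIoc_of_le (by positivity)] at hs
      have := Real.sin_pos_of_pos_of_lt_pi hs.1 (by linarith [hs.2, Real.pi_pos])
      exact tendsto_angDensity_atTop.comp (tendsto_id.atTop_mul_const this)
  rw [intervalIntegral.integral_zero] at hint
  have hlim := (hint.const_mul 2).add (hbeta.const_mul 4)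
  have hev := hlim.eventually (gt_mem_nhds (show 2 * 0 + 4 * (Real.pi / 6) < Real.pi by
    linarith [Real.pi_pos]))
  obtain ⟨B, hB, hB1⟩ := (hev.and (eventually_ge_atTop 1)).exists
  refine ⟨B, hB1, ?_⟩
  have hc := continuous_angDensity_sin B
  have hc2 : Continuous fun s => angDensity (-(B * Real.sin s)) := by
    have := continuous_angDensity
    fun_prop
  have h1 : period B ≤ 2 * (∫ s in (0 : ℝ)..(Real.pi / 2), angDensity (B * Real.sin s)) +
      Real.pi := by
    rw [period_eq]
    simp only [symDensity]
    rw [intervalIntegral.integral_add (hc.intervalIntegrable _ _) (hc2.intervalIntegrable _ _)]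
    have : (∫ s in (0 : ℝ)..(Real.pi / 2), angDensity (-(B * Real.sin s))) ≤
        ∫ s in (0 : ℝ)..(Real.pi / 2), (1 : ℝ) :=
      intervalIntegral.integral_mono_on (by positivity) (hc2.intervalIntegrable _ _)
        (by simp) (fun s _ => angDensity_le_one _)
    simp at this
    linarith
  have h2 : halfShort B ≤ beta B := by
    rw [halfShort, ang_neg_pi_div_two_add]
    have hc3 : Continuous fun s => angDensity (-(B * Real.cos s)) := by
      have := continuous_angDensity
      fun_prop
    have : (∫ s in (0 : ℝ)..(beta B), angDensity (-(B * Real.cos s))) ≤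
        ∫ s in (0 : ℝ)..(beta B), (1 : ℝ) :=
      intervalIntegral.integral_mono_on (beta_pos (by linarith)).le (hc3.intervalIntegrable _ _)
        (by simp) (fun s _ => angDensity_le_one _)
    simpa using this
  unfold fishAngle
  linarith

/-- The intermediate value theorem between a large level and the level `1 / √3`, for which
`beta B = π / 2` and hence `fishAngle B` is at least `2 * period B`. -/
lemma exists_fishAngle_eq : ∃ B, 0 < B ∧ 1 ≤ 3 * B ^ 2 ∧ fishAngle B = 2 * Real.pi := by
  obtain ⟨B₁, hB₁, hlt⟩ := exists_fishAngle_lt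
  set B₀ : ℝ := Real.sqrt (1 / 3) with hB₀
  have hB₀pos : 0 < B₀ := by positivity
  have hB₀sq : 3 * B₀ ^ 2 = 1 := by rw [hB₀, Real.sq_sqrt (by norm_num)]; norm_num
  have hle : B₀ ≤ B₁ := by
    by_contra! h
    nlinarith
  have hβ : beta B₀ = Real.pi / 2 := by
    rw [beta, Real.arcsin_eq_pi_div_two, le_div_iff₀ (by positivity)]
    apply Real.le_sqrt_of_sq_le
    nlinarith
  have hge : 2 * Real.pi ≤ fishAngle B₀ := by
    have h1 := half_period_le hB₀pos
    have h2 := pi_lt_period hB₀pos.le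
    have h3 : ang B₀ (Real.pi / 2 - beta B₀) = halfShort B₀ := by
      rw [halfShort, hβ]; congr 1; ring
    unfold fishAngle
    linarith
  have hcont : ContinuousOn fishAngle (Icc B₀ B₁) := by
    have h1 : Continuous period := by
      have := continuous_ang_uncurry.comp
        (show Continuous fun B : ℝ => (B, 3 * Real.pi / 2) by fun_prop)
      rw [show period = fun B => ang B (3 * Real.pi / 2) from funext fun _ => rfl]
      simpa only [Function.comp_def] using this
    have h2 : ContinuousOn beta (Icc B₀ B₁) := by
      refine Real.continuous_arcsin.comp_continuousOn (ContinuousOn.div (by fun_prop)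
        (by fun_prop) fun x hx => ?_)
      have := hx.1
      have : 0 < x := hB₀pos.trans_le this
      positivity
    have h3 : ContinuousOn halfShort (Icc B₀ B₁) := by
      have := continuous_ang_uncurry.comp_continuousOn
        (show ContinuousOn (fun B : ℝ => (B, -(Real.pi / 2) + beta B)) (Icc B₀ B₁) by fun_prop)
      rw [show halfShort = fun B => ang B (-(Real.pi / 2) + beta B) from funext fun _ => rfl]
      simpa only [Function.comp_def] using this
    exact h1.continuousOn.add (continuousOn_const.mul h3)
  obtain ⟨B, hB, hBeq⟩ := intermediate_value_Icc' hle hcont ⟨hlt.le, hge⟩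
  refine ⟨B, hB₀pos.trans_le hB.1, ?_, hBeq⟩
  have : B₀ ^ 2 ≤ B ^ 2 := by
    have := hB.1
    gcongr
  linarith

end Network
namespace Network

/-! ### The orbits in terms of the polar angle -/

/-- The phase at a given polar angle: the inverse function of `ang B`. -/
noncomputable def phaseIso (B : ℝ) : ℝ ≃o ℝ :=
  ((strictMono_ang B).orderIsoOfSurjective (ang B) (by
    have h1 : Tendsto (ang B) atTop atTop := by
      refine tendsto_atTop_mono' _ ?_ ((tendsto_nat_floor_atTop (α := ℝ)).comp
        (tendsto_id.atTop_div_const Real.two_pi_pos) |> tendsto_natCast_atTop_atTop.comp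
        |>.atTop_mul_const (period_pos B) |> tendsto_atTop_add_const_left _ (ang B 0))
      filter_upwards [eventually_ge_atTop 0] with x hx
      simp only [Function.comp, id]
      rw [← ang_add_nat_mul]
      refine (strictMono_ang B).monotone ?_
      rw [zero_add, ← le_div_iff₀ Real.two_pi_pos]
      exact Nat.floor_le (by positivity)
    have h2 : Tendsto (ang B) atBot atBot := by
      have h3 : Tendsto (fun α => -Real.pi - α) atBot atTop :=
        tendsto_atTop_add_const_left _ _ tendsto_neg_atBot_atTop
      refine (tendsto_neg_atTop_atBot.comp (h1.comp h3)).congr fun α => ?_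
      simp [ang_reflect]
    exact (continuous_ang B).surjective h1 h2)).symm

/-- The phase at the polar angle `θ`, at level `B`. -/
noncomputable def phase (B θ : ℝ) : ℝ := phaseIso B θ

@[simp] lemma ang_phase (B θ : ℝ) : ang B (phase B θ) = θ := (phaseIso B).symm_apply_apply θ

@[simp] lemma phase_ang (B α : ℝ) : phase B (ang B α) = α := (phaseIso B).apply_symm_apply α

lemma strictMono_phase (B : ℝ) : StrictMono (phase B) := (phaseIso B).strictMono

lemma continuous_phase (B : ℝ) : Continuous (phase B) := (phaseIso B).continuous

lemma hasDerivAt_phase (B θ : ℝ) :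
    HasDerivAt (phase B) (angDensity (B * Real.sin (phase B θ)))⁻¹ θ :=
  HasDerivAt.of_local_left_inverse (continuous_phase B).continuousAt (hasDerivAt_ang B _)
    (angDensity_pos _).ne' (Eventually.of_forall (ang_phase B))

/-- The logarithm of half the squared distance to the origin, at phase `α` and level `B`. -/
noncomputable def orbX (B α : ℝ) : ℝ := xi (B * Real.sin α)

/-- The cotangent of the angle between position vector and tangent, at phase `α` and level `B`. -/
noncomputable def orbY (B α : ℝ) : ℝ := B * Real.cos α / Real.sqrt (1 + (B * Real.sin α) ^ 2)

/-- The pair `(X, Y)` solves the system which describes shrinking curves in polar coordinates: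
`X` is the logarithm of half the squared distance to the origin and `Y` the cotangent of the angle
between position vector and tangent, both as functions of the polar angle. -/
structure IsOrbit (X Y : ℝ → ℝ) : Prop where
  hasDerivAt_fst : ∀ θ, HasDerivAt X (2 * Y θ) θ
  hasDerivAt_snd : ∀ θ, HasDerivAt Y ((1 + Y θ ^ 2) * (1 - Real.exp (X θ))) θ

lemma isOrbit_orb (B : ℝ) :
    IsOrbit (fun θ => orbX B (phase B θ)) (fun θ => orbY B (phase B θ)) := by
  constructor
  · intro θ
    have h1 := (((Real.hasDerivAt_sin _).comp θ (hasDerivAt_phase B θ)).const_mul B)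
    have h2 := (hasDerivAt_xi _).comp θ h1
    refine h2.congr_deriv ?_
    have := angDensity_pos (B * Real.sin (phase B θ))
    simp only [Function.comp, orbY]
    field_simp
  · intro θ
    set α := phase B θ with hα
    set z := B * Real.sin α with hz
    have hw : 0 < Real.sqrt (1 + z ^ 2) := Real.sqrt_pos.2 (by positivity)
    have hw2 : Real.sqrt (1 + z ^ 2) ^ 2 = 1 + z ^ 2 := Real.sq_sqrt (by positivity)
    have h0 : HasDerivAt (fun α => B * Real.sin α) (B * Real.cos α) α :=
      (Real.hasDerivAt_sin α).const_mul B
    have h1 : HasDerivAt (fun α => Real.sqrt (1 + (B * Real.sin α) ^ 2))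
        (z * (B * Real.cos α) / Real.sqrt (1 + z ^ 2)) α := by
      refine (((h0.pow 2).const_add 1).sqrt (show (1 + (B * Real.sin α) ^ 2) ≠ 0 by
        positivity)).congr_deriv ?_
      rw [← hz]
      norm_num
      ring
    have h2 : HasDerivAt (orbY B) _ α := ((Real.hasDerivAt_cos α).const_mul B).div h1 hw.ne'
    refine (h2.comp θ (hasDerivAt_phase B θ)).congr_deriv ?_
    have hP := angDensity_mul z
    have hp := angDensity_pos z
    rw [← hα, ← hz]
    simp only [orbY, orbX]
    rw [← hz]
    set P := angDensity z
    set w := Real.sqrt (1 + z ^ 2)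
    set E := Real.exp (xi z)
    have hsin : B * -Real.sin α = -z := by rw [hz]; ring
    rw [hsin]
    field_simp
    linear_combination (w ^ 2 + B ^ 2 * Real.cos α ^ 2) * hP

lemma isOrbit_shift {X Y : ℝ → ℝ} (h : IsOrbit X Y) (a : ℝ) :
    IsOrbit (fun θ => X (a + θ)) (fun θ => Y (a + θ)) :=
  ⟨fun θ => (h.hasDerivAt_fst (a + θ)).comp_const_add a θ,
    fun θ => (h.hasDerivAt_snd (a + θ)).comp_const_add a θ⟩

lemma IsOrbit.contDiff {X Y : ℝ → ℝ} (h : IsOrbit X Y) : ContDiff ℝ ∞ X ∧ ContDiff ℝ ∞ Y := by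
  have key : ∀ n : ℕ, ContDiff ℝ n X ∧ ContDiff ℝ n Y := by
    intro n
    induction n with
    | zero =>
      simp only [Nat.cast_zero, contDiff_zero]
      exact ⟨continuous_iff_continuousAt.2 fun θ => (h.hasDerivAt_fst θ).continuousAt,
        continuous_iff_continuousAt.2 fun θ => (h.hasDerivAt_snd θ).continuousAt⟩
    | succ n ih =>
      obtain ⟨ihX, ihY⟩ := ih
      have hX : deriv X = fun θ => 2 * Y θ := funext fun θ => (h.hasDerivAt_fst θ).deriv
      have hY : deriv Y = fun θ => (1 + Y θ ^ 2) * (1 - Real.exp (X θ)) :=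
        funext fun θ => (h.hasDerivAt_snd θ).deriv
      push_cast
      rw [contDiff_succ_iff_deriv, contDiff_succ_iff_deriv, hX, hY]
      refine ⟨⟨fun θ => (h.hasDerivAt_fst θ).differentiableAt, by simp, by fun_prop⟩,
        ⟨fun θ => (h.hasDerivAt_snd θ).differentiableAt, by simp, by fun_prop⟩⟩
  exact ⟨contDiff_infty.2 fun n => (key n).1, contDiff_infty.2 fun n => (key n).2⟩

/-- Every initial condition other than the equilibrium lies on an orbit with positive level; only
the case of a nonvanishing cotangent is needed. -/
lemma exists_level_phase (x y : ℝ) (hy : y ≠ 0) :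
    ∃ B α, 0 < B ∧ orbX B α = x ∧ orbY B α = y := by
  set ζ := bigZ x
  set η := Real.sqrt (1 + ζ ^ 2) * y
  have hw : 0 < Real.sqrt (1 + ζ ^ 2) := Real.sqrt_pos.2 (by positivity)
  have hη : η ≠ 0 := mul_ne_zero hw.ne' hy
  set c : ℂ := ⟨η, ζ⟩
  have hc : c ≠ 0 := fun h => hη (congrArg Complex.re h)
  refine ⟨‖c‖, c.arg, norm_pos_iff.2 hc, ?_, ?_⟩
  · rw [orbX, Complex.norm_mul_sin_arg]; exact xi_bigZ x
  · rw [orbY, Complex.norm_mul_sin_arg, Complex.norm_mul_cos_arg]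
    exact mul_div_cancel_left₀ y hw.ne'

/-- Solutions of the system of `IsOrbit`, in an arbitrary parametrization `t` for which the polar
angle has speed `g`, are determined by their initial values. -/
lemma orbit_unique {a b : ℝ} {g X₁ Y₁ X₂ Y₂ : ℝ → ℝ} (hg : ContinuousOn g (Icc a b))
    (hX₁ : ∀ t ∈ Icc a b, HasDerivWithinAt X₁ (g t * (2 * Y₁ t)) (Icc a b) t)
    (hY₁ : ∀ t ∈ Icc a b,
      HasDerivWithinAt Y₁ (g t * ((1 + Y₁ t ^ 2) * (1 - Real.exp (X₁ t)))) (Icc a b) t)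
    (hX₂ : ∀ t ∈ Icc a b, HasDerivWithinAt X₂ (g t * (2 * Y₂ t)) (Icc a b) t)
    (hY₂ : ∀ t ∈ Icc a b,
      HasDerivWithinAt Y₂ (g t * ((1 + Y₂ t ^ 2) * (1 - Real.exp (X₂ t)))) (Icc a b) t)
    (h0X : X₁ a = X₂ a) (h0Y : Y₁ a = Y₂ a) {t : ℝ} (ht : t ∈ Icc a b) :
    X₁ t = X₂ t ∧ Y₁ t = Y₂ t := by
  set v : ℝ × ℝ → ℝ × ℝ := fun p => (2 * p.2, (1 + p.2 ^ 2) * (1 - Real.exp p.1)) with hv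
  have hvc : ContDiff ℝ 1 v := by rw [hv]; fun_prop
  have c1 : ContinuousOn (fun t => (X₁ t, Y₁ t)) (Icc a b) := fun t ht =>
    (hX₁ t ht).continuousWithinAt.prodMk (hY₁ t ht).continuousWithinAt
  have c2 : ContinuousOn (fun t => (X₂ t, Y₂ t)) (Icc a b) := fun t ht =>
    (hX₂ t ht).continuousWithinAt.prodMk (hY₂ t ht).continuousWithinAt
  set S := (fun t => (X₁ t, Y₁ t)) '' Icc a b ∪ (fun t => (X₂ t, Y₂ t)) '' Icc a b with hS
  have hSc : IsCompact S :=
    (isCompact_Icc.image_of_continuousOn c1).union (isCompact_Icc.image_of_continuousOn c2)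
  obtain ⟨K, hK⟩ := LocallyLipschitzOn.exists_lipschitzOnWith_of_compact hSc
    (hvc.locallyLipschitz.locallyLipschitzOn (s := S))
  obtain ⟨M, hM⟩ := isCompact_Icc.exists_bound_of_continuousOn hg
  have hlip : ∀ t ∈ Ico a b, LipschitzOnWith (Real.toNNReal M * K) (fun p => g t • v p) S := by
    intro t ht
    refine LipschitzOnWith.of_dist_le_mul fun p hp q hq => ?_
    have h1 := hK.dist_le_mul p hp q hq
    have h2 := hM t ⟨ht.1, ht.2.le⟩
    rw [dist_smul₀, NNReal.coe_mul, mul_assoc]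
    exact mul_le_mul (h2.trans (Real.le_coe_toNNReal M)) h1 dist_nonneg (NNReal.coe_nonneg _)
  have nb : ∀ t ∈ Ico a b, Icc a b ∈ 𝓝[Ici t] t := fun t ht =>
    mem_of_superset (Icc_mem_nhdsGE ht.2) (Icc_subset_Icc_left ht.1)
  have := ODE_solution_unique_of_mem_Icc_right (v := fun t p => g t • v p) (s := fun _ => S)
    (f := fun t => (X₁ t, Y₁ t)) (g := fun t => (X₂ t, Y₂ t)) hlip c1
    (fun t ht => ((hX₁ t ⟨ht.1, ht.2.le⟩).prodMk (hY₁ t ⟨ht.1, ht.2.le⟩)).mono_of_mem_nhdsWithin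
      (nb t ht))
    (fun t ht => Or.inl ⟨t, ⟨ht.1, ht.2.le⟩, rfl⟩) c2
    (fun t ht => ((hX₂ t ⟨ht.1, ht.2.le⟩).prodMk (hY₂ t ⟨ht.1, ht.2.le⟩)).mono_of_mem_nhdsWithin
      (nb t ht))
    (fun t ht => Or.inr ⟨t, ⟨ht.1, ht.2.le⟩, rfl⟩) (by simp [h0X, h0Y]) ht
  simpa using this

end Network
namespace Network

/-! ### Plane vectors -/

/-- The signed area of the parallelogram spanned by two plane vectors. -/
def cross (a b : ℂ) : ℝ := a.re * b.im - a.im * b.re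

/-- The inner product of two plane vectors, in coordinates. -/
def dot (a b : ℂ) : ℝ := a.re * b.re + a.im * b.im

lemma dot_self (a : ℂ) : dot a a = ‖a‖ ^ 2 := by
  rw [← Complex.normSq_eq_norm_sq, Complex.normSq_apply]; rfl

lemma inner_eq_dot (a b : ℂ) : inner ℝ a b = dot a b := by
  rw [Complex.inner, dot]; simp; ring

lemma dot_self_pos {a : ℂ} (ha : a ≠ 0) : 0 < dot a a := by
  rw [dot_self]; positivity

lemma cross_comm (a b : ℂ) : cross b a = -cross a b := by simp [cross]; ring
lemma cross_self (a : ℂ) : cross a a = 0 := by simp [cross]; ring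
lemma cross_add_right (a b c : ℂ) : cross a (b + c) = cross a b + cross a c := by
  simp [cross]; ring
lemma cross_sub_right (a b c : ℂ) : cross a (b - c) = cross a b - cross a c := by
  simp [cross]; ring
lemma cross_smul_right (a b : ℂ) (r : ℝ) : cross a (r • b) = r * cross a b := by
  simp [cross]; ring
lemma cross_smul_left (a b : ℂ) (r : ℝ) : cross (r • a) b = r * cross a b := by
  simp [cross]; ring
lemma dot_smul_left (a b : ℂ) (r : ℝ) : dot (r • a) b = r * dot a b := by
  simp [dot]; ring
lemma dot_smul_right (a b : ℂ) (r : ℝ) : dot a (r • b) = r * dot a b := by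
  simp [dot]; ring

lemma cross_sq_add_dot_sq (a b : ℂ) : cross a b ^ 2 + dot a b ^ 2 = dot a a * dot b b := by
  simp [cross, dot]; ring

lemma hasDerivWithinAt_re {f : ℝ → ℂ} {f' : ℂ} {s : Set ℝ} {x : ℝ} (h : HasDerivWithinAt f f' s x) :
    HasDerivWithinAt (fun x => (f x).re) f'.re s x :=
  Complex.reCLM.hasFDerivAt.comp_hasDerivWithinAt x h

lemma hasDerivWithinAt_im {f : ℝ → ℂ} {f' : ℂ} {s : Set ℝ} {x : ℝ} (h : HasDerivWithinAt f f' s x) :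
    HasDerivWithinAt (fun x => (f x).im) f'.im s x :=
  Complex.imCLM.hasFDerivAt.comp_hasDerivWithinAt x h

lemma hasDerivWithinAt_cross {f g : ℝ → ℂ} {f' g' : ℂ} {s : Set ℝ} {x : ℝ}
    (hf : HasDerivWithinAt f f' s x) (hg : HasDerivWithinAt g g' s x) :
    HasDerivWithinAt (fun x => cross (f x) (g x)) (cross f' (g x) + cross (f x) g') s x := by
  refine (((hasDerivWithinAt_re hf).mul (hasDerivWithinAt_im hg)).sub
    ((hasDerivWithinAt_im hf).mul (hasDerivWithinAt_re hg))).congr_deriv ?_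
  simp only [cross]; ring

lemma hasDerivWithinAt_dot {f g : ℝ → ℂ} {f' g' : ℂ} {s : Set ℝ} {x : ℝ}
    (hf : HasDerivWithinAt f f' s x) (hg : HasDerivWithinAt g g' s x) :
    HasDerivWithinAt (fun x => dot (f x) (g x)) (dot f' (g x) + dot (f x) g') s x := by
  refine (((hasDerivWithinAt_re hf).mul (hasDerivWithinAt_re hg)).add
    ((hasDerivWithinAt_im hf).mul (hasDerivWithinAt_im hg))).congr_deriv ?_
  simp only [dot]; ring

lemma continuousOn_cross {f g : ℝ → ℂ} {s : Set ℝ} (hf : ContinuousOn f s)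
    (hg : ContinuousOn g s) : ContinuousOn (fun x => cross (f x) (g x)) s := by
  unfold cross
  have := Complex.continuous_re.comp_continuousOn hf
  have := Complex.continuous_im.comp_continuousOn hf
  have := Complex.continuous_re.comp_continuousOn hg
  have := Complex.continuous_im.comp_continuousOn hg
  simp only [Function.comp_def] at *
  fun_prop

lemma continuousOn_dot {f g : ℝ → ℂ} {s : Set ℝ} (hf : ContinuousOn f s)
    (hg : ContinuousOn g s) : ContinuousOn (fun x => dot (f x) (g x)) s := by
  unfold dot
  have := Complex.continuous_re.comp_continuousOn hf
  have := Complex.continuous_im.comp_continuousOn hf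
  have := Complex.continuous_re.comp_continuousOn hg
  have := Complex.continuous_im.comp_continuousOn hg
  simp only [Function.comp_def] at *
  fun_prop

/-- The normal part of `w` is the multiple of the normal vector `I * τ` given by the cross
product. -/
lemma normalPart_eq {τ : ℂ} (hτ : τ ≠ 0) (w : ℂ) :
    normalPart τ w = (cross τ w / ‖τ‖ ^ 2) • (Complex.I * τ) := by
  rw [normalPart, inner_eq_dot, ← dot_self]
  have h := dot_self_pos hτ
  apply Complex.ext <;> simp <;> field_simp <;> simp [cross, dot] <;> ring

/-- The curvature vector is the normal part of `w` if and only if the signed curvatures agree, here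
without denominators. -/
lemma curvature_eq_iff {c : ℝ → ℂ} {x : ℝ} (h : deriv c x ≠ 0) (w : ℂ) :
    curvatureVector c x = normalPart (deriv c x) w ↔
      cross (deriv c x) (deriv (deriv c) x) = dot (deriv c x) (deriv c x) * cross (deriv c x) w := by
  have hd := dot_self_pos h
  have hn := h
  rw [curvatureVector, normalPart_eq h, normalPart_eq h, smul_smul, ← dot_self]
  constructor
  · intro heq
    have := congrArg (cross (deriv c x)) heq
    have hI : cross (deriv c x) (Complex.I * deriv c x) = dot (deriv c x) (deriv c x) := by
      simp [cross, dot]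
    rw [cross_smul_right, cross_smul_right, hI] at this
    field_simp at this
    linarith
  · intro heq
    rw [heq]; congr 1; field_simp

/-! ### Shrinking curves -/

/-- The curve `c` is, on the interval `D`, a regular curve with the derivatives `c₁` and `c₂` whose
curvature vector is the normal part of `-c / 2`; networks through such curves shrink
homothetically towards the origin and have extinction time `0` if they are the time `-1` slice. -/
structure IsShrinkerOn (D : Set ℝ) (c c₁ c₂ : ℝ → ℂ) : Prop where
  hasDeriv : ∀ x ∈ D, HasDerivWithinAt c (c₁ x) D x
  hasDeriv₂ : ∀ x ∈ D, HasDerivWithinAt c₁ (c₂ x) D x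
  continuousOn : ContinuousOn c₂ D
  ne_zero : ∀ x ∈ D, c₁ x ≠ 0
  eq : ∀ x ∈ D, cross (c₁ x) (c₂ x) = dot (c₁ x) (c₁ x) * cross (c x) (c₁ x) / 2

lemma eq_of_hasDerivWithinAt_zero {E : Type*} [NormedAddCommGroup E] [NormedSpace ℝ E]
    {D : Set ℝ} (hD : Convex ℝ D) {f : ℝ → E}
    (h : ∀ x ∈ D, HasDerivWithinAt f 0 D x) {x y : ℝ} (hx : x ∈ D) (hy : y ∈ D) : f x = f y := by
  have := hD.norm_image_sub_le_of_norm_hasDerivWithin_le (C := 0) h (fun x _ => by simp) hy hx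
  rw [zero_mul] at this
  exact sub_eq_zero.1 (norm_le_zero_iff.1 this)

section
variable {D : Set ℝ} {c c₁ c₂ : ℝ → ℂ}

/-- The first integral of shrinking curves: support function times `exp (-|c| ^ 2 / 4)`. -/
lemma IsShrinkerOn.first_integral (h : IsShrinkerOn D c c₁ c₂) (hD : Convex ℝ D) {x y : ℝ}
    (hx : x ∈ D) (hy : y ∈ D) :
    cross (c x) (c₁ x) / Real.sqrt (dot (c₁ x) (c₁ x)) * Real.exp (-(dot (c x) (c x) / 4)) =
    cross (c y) (c₁ y) / Real.sqrt (dot (c₁ y) (c₁ y)) * Real.exp (-(dot (c y) (c y) / 4)) := by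
  refine eq_of_hasDerivWithinAt_zero (f := fun x => cross (c x) (c₁ x) /
    Real.sqrt (dot (c₁ x) (c₁ x)) * Real.exp (-(dot (c x) (c x) / 4))) hD (fun z hz => ?_) hx hy
  have hN := dot_self_pos (h.ne_zero z hz)
  have h1 := h.hasDeriv z hz
  have h2 := h.hasDeriv₂ z hz
  have hd := ((hasDerivWithinAt_cross h1 h2).div ((hasDerivWithinAt_dot h2 h2).sqrt hN.ne')
    (Real.sqrt_pos.2 hN).ne').mul (((hasDerivWithinAt_dot h1 h1).div_const 4).neg.exp)
  refine hd.congr_deriv ?_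
  have hs := Real.sq_sqrt hN.le
  have hs0 := Real.sqrt_pos.2 hN
  have heq := h.eq z hz
  set S := Real.sqrt (dot (c₁ z) (c₁ z))
  -- the component of `c₂` along the curve only changes the parametrization and drops out
  have l1 : dot (c₁ z) (c₁ z) * cross (c z) (c₂ z) = cross (c z) (c₁ z) * dot (c₁ z) (c₂ z) +
      dot (c z) (c₁ z) * cross (c₁ z) (c₂ z) := by simp [cross, dot]; ring
  rw [heq, ← hs] at l1
  have hdc : dot (c₁ z) (c z) = dot (c z) (c₁ z) := by simp [dot]; ring
  have hdc2 : dot (c₂ z) (c₁ z) = dot (c₁ z) (c₂ z) := by simp [dot]; ring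
  rw [cross_self, hdc, hdc2]
  simp only [Pi.neg_apply, Pi.div_apply]
  have hl : S ^ 2 * cross (c z) (c₂ z) - cross (c z) (c₁ z) * dot (c₁ z) (c₂ z) -
      S ^ 2 * cross (c z) (c₁ z) * dot (c z) (c₁ z) / 2 = 0 := by linear_combination l1
  generalize Real.exp (-(dot (c z) (c z) / 4)) = E
  field_simp
  linear_combination (8 * E * S) * hl

lemma IsShrinkerOn.cross_pos (h : IsShrinkerOn D c c₁ c₂) (hD : Convex ℝ D) {x y : ℝ}
    (hx : x ∈ D) (hy : y ∈ D) (hpos : 0 < cross (c x) (c₁ x)) : 0 < cross (c y) (c₁ y) := by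
  have h1 := h.first_integral hD hx hy
  have hx' := Real.sqrt_pos.2 (dot_self_pos (h.ne_zero x hx))
  have hy' := Real.sqrt_pos.2 (dot_self_pos (h.ne_zero y hy))
  have h2 : 0 < cross (c y) (c₁ y) / Real.sqrt (dot (c₁ y) (c₁ y)) *
      Real.exp (-(dot (c y) (c y) / 4)) := by rw [← h1]; positivity
  have h3 := pos_of_mul_pos_left h2 (Real.exp_pos _).le
  exact (div_pos_iff_of_pos_right hy').1 h3

lemma IsShrinkerOn.cross_eq_zero (h : IsShrinkerOn D c c₁ c₂) (hD : Convex ℝ D) {x y : ℝ}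
    (hx : x ∈ D) (hy : y ∈ D) (h0 : cross (c x) (c₁ x) = 0) : cross (c y) (c₁ y) = 0 := by
  have h1 := h.first_integral hD hx hy
  have hy' := Real.sqrt_pos.2 (dot_self_pos (h.ne_zero y hy))
  rw [h0, zero_div, zero_mul, eq_comm, mul_eq_zero] at h1
  have h2 := h1.resolve_right (Real.exp_pos _).ne'
  exact (div_eq_zero_iff.1 h2).resolve_right hy'.ne'

/-- A shrinking curve which is radial at one point is straight. -/
lemma IsShrinkerOn.straight (h : IsShrinkerOn D c c₁ c₂) (hD : Convex ℝ D) {x₀ : ℝ}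
    (hx₀ : x₀ ∈ D) (h0 : cross (c x₀) (c₁ x₀) = 0) {x : ℝ} (hx : x ∈ D) :
    c₁ x = (Real.sqrt (dot (c₁ x) (c₁ x)) / Real.sqrt (dot (c₁ x₀) (c₁ x₀))) • c₁ x₀ := by
  have key : (Real.sqrt (dot (c₁ x) (c₁ x)))⁻¹ • c₁ x =
      (Real.sqrt (dot (c₁ x₀) (c₁ x₀)))⁻¹ • c₁ x₀ := by
    refine eq_of_hasDerivWithinAt_zero (f := fun x => (Real.sqrt (dot (c₁ x) (c₁ x)))⁻¹ • c₁ x) hD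
      (fun z hz => ?_) hx hx₀
    have hN := dot_self_pos (h.ne_zero z hz)
    have h2 := h.hasDeriv₂ z hz
    have hc : cross (c₁ z) (c₂ z) = 0 := by
      rw [h.eq z hz, h.cross_eq_zero hD hx₀ hz h0]; simp
    have hs0 := Real.sqrt_pos.2 hN
    have hd := (((hasDerivWithinAt_dot h2 h2).sqrt hN.ne').inv hs0.ne').smul h2
    refine hd.congr_deriv ?_
    have hs := Real.sq_sqrt hN.le
    have hdc2 : dot (c₂ z) (c₁ z) = dot (c₁ z) (c₂ z) := by simp [dot]; ring
    have e1 : dot (c₁ z) (c₁ z) * (c₂ z).re = dot (c₁ z) (c₂ z) * (c₁ z).re -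
      cross (c₁ z) (c₂ z) * (c₁ z).im := by simp [cross, dot]; ring
    have e2 : dot (c₁ z) (c₁ z) * (c₂ z).im = dot (c₁ z) (c₂ z) * (c₁ z).im +
      cross (c₁ z) (c₂ z) * (c₁ z).re := by simp [cross, dot]; ring
    rw [hc, ← hs] at e1 e2
    rw [hdc2]
    set S := Real.sqrt (dot (c₁ z) (c₁ z))
    apply Complex.ext
    · simp only [Pi.inv_apply, Complex.add_re, Complex.smul_re, smul_eq_mul, Complex.zero_re]
      change S⁻¹ * _ + _ = _
      field_simp
      linear_combination 2 * e1
    · simp only [Pi.inv_apply, Complex.add_im, Complex.smul_im, smul_eq_mul, Complex.zero_im]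
      change S⁻¹ * _ + _ = _
      field_simp
      linear_combination 2 * e2
  have hN := Real.sqrt_pos.2 (dot_self_pos (h.ne_zero x hx))
  rw [div_eq_mul_inv, mul_smul, ← key, smul_smul, mul_inv_cancel₀ hN.ne', one_smul]

/-- A shrinking curve which is not straight is bounded: the support function is at most the distance
`r` from the origin, and `r * exp (-r ^ 2 / 4)` tends to `0` at infinity. -/
lemma IsShrinkerOn.bounded (h : IsShrinkerOn D c c₁ c₂) (hD : Convex ℝ D) {x₀ : ℝ}
    (hx₀ : x₀ ∈ D) (h0 : cross (c x₀) (c₁ x₀) ≠ 0) : ∃ R, ∀ x ∈ D, ‖c x‖ ≤ R := by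
  set C := cross (c x₀) (c₁ x₀) / Real.sqrt (dot (c₁ x₀) (c₁ x₀)) *
    Real.exp (-(dot (c x₀) (c x₀) / 4)) with hC
  have hC0 : C ≠ 0 := mul_ne_zero (div_ne_zero h0
    (Real.sqrt_pos.2 (dot_self_pos (h.ne_zero x₀ hx₀))).ne') (Real.exp_pos _).ne'
  refine ⟨4 / |C|, fun x hx => ?_⟩
  have h1 := h.first_integral hD hx₀ hx
  rw [← hC] at h1
  have hN := dot_self_pos (h.ne_zero x hx)
  have hs0 := Real.sqrt_pos.2 hN
  have hle : |cross (c x) (c₁ x)| ≤ ‖c x‖ * Real.sqrt (dot (c₁ x) (c₁ x)) := by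
    apply abs_le_of_sq_le_sq _ (by positivity)
    rw [mul_pow, Real.sq_sqrt hN.le, ← dot_self, ← cross_sq_add_dot_sq]
    nlinarith [sq_nonneg (dot (c x) (c₁ x))]
  have h2 : |C| ≤ ‖c x‖ * Real.exp (-(‖c x‖ ^ 2 / 4)) := by
    rw [h1, abs_mul, abs_div, abs_of_pos hs0, Real.abs_exp, dot_self (c x)]
    gcongr
    rwa [div_le_iff₀ hs0]
  have hCpos : 0 < |C| := abs_pos.2 hC0
  rw [le_div_iff₀ hCpos]
  rw [Real.exp_neg, ← div_eq_mul_inv, le_div_iff₀ (Real.exp_pos _)] at h2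
  have h3 := Real.add_one_le_exp (‖c x‖ ^ 2 / 4)
  rcases (norm_nonneg (c x)).eq_or_lt with h4 | h4
  · rw [← h4]; norm_num
  · have h5 : |C| * (‖c x‖ ^ 2 / 4 + 1) ≤ ‖c x‖ :=
      (mul_le_mul_of_nonneg_left h3 hCpos.le).trans h2
    have h6 : ‖c x‖ * (‖c x‖ * |C|) ≤ ‖c x‖ * 4 := by nlinarith
    exact le_of_mul_le_mul_left h6 h4

end

/-! ### Polar coordinates -/

/-- The point with polar angle `θ` at distance `√2 * exp (X / 2)` from the origin. -/
noncomputable def polar (X θ : ℝ) : ℂ :=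
  Real.sqrt 2 * Complex.exp ((X / 2 : ℝ) + θ * Complex.I)

lemma polar_eq (X θ : ℝ) :
    polar X θ = (Real.sqrt 2 * Real.exp (X / 2)) • Complex.exp (θ * Complex.I) := by
  rw [polar, Complex.exp_add, ← Complex.ofReal_exp]
  simp [mul_assoc]

lemma polar_ne_zero (X θ : ℝ) : polar X θ ≠ 0 := by
  rw [polar]
  exact mul_ne_zero (by simp) (Complex.exp_ne_zero _)

lemma norm_polar (X θ : ℝ) : ‖polar X θ‖ = Real.sqrt 2 * Real.exp (X / 2) := by
  rw [polar_eq, norm_smul, Complex.norm_exp_ofReal_mul_I, mul_one, Real.norm_of_nonneg]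
  positivity

lemma dot_polar_self (X θ : ℝ) : dot (polar X θ) (polar X θ) = 2 * Real.exp X := by
  rw [dot_self, norm_polar, mul_pow, Real.sq_sqrt (by norm_num), ← Real.exp_nat_mul]
  congr 2; push_cast; ring

lemma polar_eq_polar_iff {X θ X' θ' : ℝ} :
    polar X θ = polar X' θ' ↔ X = X' ∧ ∃ n : ℤ, θ = θ' + n * (2 * Real.pi) := by
  constructor
  · intro h
    have h1 : X = X' := by
      have := congrArg norm h
      rw [norm_polar, norm_polar] at this
      have h2 := mul_left_cancel₀ (by positivity) this
      linarith [Real.exp_injective h2]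
    refine ⟨h1, ?_⟩
    subst h1
    rw [polar_eq, polar_eq] at h
    have h2 := smul_right_injective ℂ
      (show Real.sqrt 2 * Real.exp (X / 2) ≠ 0 by positivity) h
    obtain ⟨n, hn⟩ := Complex.exp_eq_exp_iff_exists_int.1 h2
    refine ⟨n, ?_⟩
    have := congrArg Complex.im hn
    simpa using this
  · rintro ⟨rfl, n, rfl⟩
    rw [polar, polar]
    congr 1
    rw [Complex.exp_eq_exp_iff_exists_int]
    exact ⟨n, by push_cast; ring⟩

lemma exists_polar {z : ℂ} (hz : z ≠ 0) :
    z = polar (Real.log (dot z z / 2)) z.arg := by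
  rw [polar_eq, Real.exp_half, Real.exp_log (by have := dot_self_pos hz; positivity),
    ← Real.sqrt_mul (by norm_num), mul_div_cancel₀ _ (by norm_num), dot_self,
    Real.sqrt_sq (norm_nonneg z)]
  simp [Complex.norm_mul_exp_arg_mul_I]

lemma polar_add (X θ φ : ℝ) : polar X (φ + θ) = Complex.exp (φ * Complex.I) * polar X θ := by
  rw [polar_eq, polar_eq, mul_smul_comm, ← Complex.exp_add]
  congr 2; push_cast; ring

lemma hasDerivAt_polar {X Y : ℝ → ℝ} (h : IsOrbit X Y) (θ : ℝ) :
    HasDerivAt (fun θ => polar (X θ) θ) ((Y θ + Complex.I) * polar (X θ) θ) θ := by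
  have h1 : HasDerivAt (fun θ : ℝ => (((X θ / 2 : ℝ) : ℂ) + θ * Complex.I)) (Y θ + Complex.I) θ := by
    have h2 := (((h.hasDerivAt_fst θ).div_const 2).ofReal_comp).add
      ((hasDerivAt_id θ).ofReal_comp.mul_const Complex.I)
    refine h2.congr_deriv ?_
    push_cast; ring
  refine (h1.cexp.const_mul (Real.sqrt 2 : ℂ)).congr_deriv ?_
  rw [polar]; ring

/-- A solution of the system of `IsOrbit` yields a shrinking curve, here parametrized by an affine
function of the polar angle. -/
lemma IsOrbit.isShrinkerOn {X Y : ℝ → ℝ} (h : IsOrbit X Y) {m : ℝ} (hm : m ≠ 0) (a : ℝ) (D : Set ℝ) :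
    IsShrinkerOn D (fun x => polar (X (a + m * x)) (a + m * x))
      (fun x => m * ((Y (a + m * x) + Complex.I) * polar (X (a + m * x)) (a + m * x)))
      (fun x => m ^ 2 * ((((1 + Y (a + m * x) ^ 2) * (1 - Real.exp (X (a + m * x))) : ℝ) +
        (Y (a + m * x) + Complex.I) ^ 2) * polar (X (a + m * x)) (a + m * x))) := by
  have hl : ∀ x, HasDerivAt (fun x : ℝ => a + m * x) m x := fun x => by
    simpa using ((hasDerivAt_id x).const_mul m).const_add a
  have hc := fun x => (hasDerivAt_polar h (a + m * x)).scomp x (hl x)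
  have hY := fun x => ((h.hasDerivAt_snd (a + m * x)).comp x (hl x)).ofReal_comp
  constructor
  · intro x _
    exact ((hc x).congr_deriv (by simp)).hasDerivWithinAt
  · intro x _
    have := ((((hY x).add_const Complex.I).mul (hc x)).const_mul (m : ℂ)).hasDerivWithinAt (s := D)
    refine this.congr_deriv ?_
    simp only [Function.comp, Complex.real_smul]
    push_cast
    ring
  · obtain ⟨hX, hY⟩ := h.contDiff
    have := hX.continuous
    have := hY.continuous
    unfold polar
    fun_prop
  · intro x _
    refine mul_ne_zero (by exact_mod_cast hm) (mul_ne_zero (fun h0 => ?_) (polar_ne_zero _ _))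
    simpa using congrArg Complex.im h0
  · intro x _
    have hn := dot_polar_self (X (a + m * x)) (a + m * x)
    generalize polar (X (a + m * x)) (a + m * x) = w at *
    generalize Real.exp (X (a + m * x)) = e at *
    generalize Y (a + m * x) = y at *
    have he : e = (w.re * w.re + w.im * w.im) / 2 := by simp only [dot] at hn; linarith
    rw [he]
    simp [cross, dot, pow_two]
    ring

end Network
namespace Network

/-- A shrinking arc with positive support function is described by a phase function `a` at the level
`B` given by its initial point. In terms of the polar angle `Θ`, the quantities
`X = log (|c| ^ 2 / 2)` and the cotangent `Y` of the angle between the position vector and the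
tangent satisfy the system of `IsOrbit`, so that they agree with `orbX` and `orbY`. -/
lemma IsShrinkerOn.exists_phase {c c₁ c₂ : ℝ → ℂ} (h : IsShrinkerOn (Icc 0 1) c c₁ c₂)
    (hpos : ∀ x ∈ Icc (0 : ℝ) 1, 0 < cross (c x) (c₁ x)) {B α ϑ : ℝ}
    (hc : c 0 = polar (orbX B α) ϑ) (hY : dot (c 0) (c₁ 0) = orbY B α * cross (c 0) (c₁ 0)) :
    ∃ a : ℝ → ℝ, ContinuousOn a (Icc 0 1) ∧ StrictMonoOn a (Icc 0 1) ∧ a 0 = α ∧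
      ∀ x ∈ Icc (0 : ℝ) 1, c x = polar (orbX B (a x)) (ϑ + (ang B (a x) - ang B α)) ∧
        dot (c x) (c₁ x) = orbY B (a x) * cross (c x) (c₁ x) := by
  have cc : ContinuousOn c (Icc 0 1) := fun x hx => (h.hasDeriv x hx).continuousWithinAt
  have cc₁ : ContinuousOn c₁ (Icc 0 1) := fun x hx => (h.hasDeriv₂ x hx).continuousWithinAt
  have hne : ∀ x ∈ Icc (0 : ℝ) 1, c x ≠ 0 := by
    intro x hx h0
    have := hpos x hx
    simp [h0, cross] at this
  have hdd : ∀ x ∈ Icc (0 : ℝ) 1, 0 < dot (c x) (c x) := fun x hx => dot_self_pos (hne x hx)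
  -- the speed `g` of the polar angle, extended by constants so that its integral `Θ` is differentiable
  set g : ℝ → ℝ := fun x => cross (c x) (c₁ x) / dot (c x) (c x) with hg
  have cg : ContinuousOn g (Icc 0 1) :=
    (continuousOn_cross cc cc₁).div (continuousOn_dot cc cc) fun x hx => (hdd x hx).ne'
  have hgpos : ∀ x ∈ Icc (0 : ℝ) 1, 0 < g x := fun x hx => div_pos (hpos x hx) (hdd x hx)
  set G : ℝ → ℝ := IccExtend (zero_le_one (α := ℝ)) ((Icc 0 1).domRestrict g)
  have cG : Continuous G := (continuousOn_iff_continuous_domRestrict.1 cg).Icc_extend'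
  have hGg : ∀ x ∈ Icc (0 : ℝ) 1, G x = g x := fun x hx => IccExtend_of_mem _ _ hx
  set Θ : ℝ → ℝ := fun x => ∫ s in (0 : ℝ)..x, G s with hΘ
  have dΘ : ∀ x, HasDerivAt Θ (G x) x := fun x =>
    intervalIntegral.integral_hasDerivAt_right (cG.intervalIntegrable _ _)
      (cG.stronglyMeasurableAtFilter _ _) cG.continuousAt
  have dΘ' : ∀ x ∈ Icc (0 : ℝ) 1, HasDerivWithinAt Θ (g x) (Icc 0 1) x := fun x hx => by
    rw [← hGg x hx]; exact (dΘ x).hasDerivWithinAt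
  have hΘ0 : Θ 0 = 0 := by simp [hΘ]
  have cΘ : Continuous Θ := continuous_iff_continuousAt.2 fun x => (dΘ x).continuousAt
  have mΘ : StrictMonoOn Θ (Icc 0 1) := by
    apply strictMonoOn_of_deriv_pos (convex_Icc _ _) cΘ.continuousOn
    intro x hx
    rw [interior_Icc] at hx
    rw [(dΘ x).deriv, hGg x (Ioo_subset_Icc_self hx)]
    exact hgpos x (Ioo_subset_Icc_self hx)
  set X : ℝ → ℝ := fun x => Real.log (dot (c x) (c x) / 2) with hX
  set Y : ℝ → ℝ := fun x => dot (c x) (c₁ x) / cross (c x) (c₁ x) with hYdef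
  have hexpX : ∀ x ∈ Icc (0 : ℝ) 1, Real.exp (X x) = dot (c x) (c x) / 2 := fun x hx =>
    Real.exp_log (half_pos (hdd x hx))
  have dX : ∀ x ∈ Icc (0 : ℝ) 1, HasDerivWithinAt X (g x * (2 * Y x)) (Icc 0 1) x := by
    intro x hx
    have h1 := h.hasDeriv x hx
    have hd := hdd x hx
    have hp := hpos x hx
    refine (((hasDerivWithinAt_dot h1 h1).div_const 2).log (half_pos hd).ne').congr_deriv ?_
    have : dot (c₁ x) (c x) = dot (c x) (c₁ x) := by simp [dot]; ring
    rw [this]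
    simp only [hg, hYdef]
    field_simp
    ring
  have dY : ∀ x ∈ Icc (0 : ℝ) 1, HasDerivWithinAt Y
      (g x * ((1 + Y x ^ 2) * (1 - Real.exp (X x)))) (Icc 0 1) x := by
    intro x hx
    have h1 := h.hasDeriv x hx
    have h2 := h.hasDeriv₂ x hx
    have hd := hdd x hx
    have hp := hpos x hx
    refine ((hasDerivWithinAt_dot h1 h2).div (hasDerivWithinAt_cross h1 h2) hp.ne').congr_deriv ?_
    rw [hexpX x hx, cross_self]
    simp only [hg, hYdef]
    have heq := h.eq x hx
    have hN := dot_self_pos (h.ne_zero x hx)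
    have l1 : dot (c₁ x) (c₁ x) * (dot (c x) (c₂ x) * cross (c x) (c₁ x) -
        dot (c x) (c₁ x) * cross (c x) (c₂ x)) = -(cross (c₁ x) (c₂ x) *
        (dot (c x) (c x) * dot (c₁ x) (c₁ x))) := by simp [cross, dot]; ring
    rw [heq] at l1
    have l2 : dot (c x) (c₂ x) * cross (c x) (c₁ x) - dot (c x) (c₁ x) * cross (c x) (c₂ x) =
        -(cross (c x) (c₁ x) / 2 * (dot (c x) (c x) * dot (c₁ x) (c₁ x))) := by
      apply mul_left_cancel₀ hN.ne'
      rw [l1]; ring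
    have l3 := cross_sq_add_dot_sq (c x) (c₁ x)
    field_simp
    rw [l3]
    linear_combination 2 * dot (c x) (c x) * l2
  have hO := isOrbit_orb B
  have hX0 : X 0 = orbX B α := by
    simp only [hX]
    rw [hc, dot_polar_self, mul_div_cancel_left₀ _ two_ne_zero, Real.log_exp]
  have hY0 : Y 0 = orbY B α := by
    simp only [hYdef]
    rw [hY, mul_div_cancel_right₀ _ (hpos 0 (by simp)).ne']
  have key : ∀ x ∈ Icc (0 : ℝ) 1, X x = orbX B (phase B (ang B α + Θ x)) ∧
      Y x = orbY B (phase B (ang B α + Θ x)) := fun x hx =>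
    orbit_unique (X₂ := fun x => orbX B (phase B (ang B α + Θ x)))
      (Y₂ := fun x => orbY B (phase B (ang B α + Θ x))) cg dX dY
      (fun t ht => ((hO.hasDerivAt_fst _).comp_hasDerivWithinAt t
        ((dΘ' t ht).const_add (ang B α))).congr_deriv (mul_comm _ _))
      (fun t ht => ((hO.hasDerivAt_snd _).comp_hasDerivWithinAt t
        ((dΘ' t ht).const_add (ang B α))).congr_deriv (mul_comm _ _))
      (by simp [hX0, hΘ0]) (by simp [hY0, hΘ0]) hx
  -- `c` divided by its polar expression is constant
  have hpolar : ∀ x ∈ Icc (0 : ℝ) 1, c x = polar (X x) (ϑ + Θ x) := by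
    intro x hx
    have hu := eq_of_hasDerivWithinAt_zero (convex_Icc (0 : ℝ) 1)
      (f := fun x => c x * Complex.exp (-((X x / 2 : ℝ) + Θ x * Complex.I))) (fun z hz => ?_)
      hx (left_mem_Icc.2 zero_le_one)
    · simp only [hΘ0] at hu
      rw [hc, hX0, polar, mul_assoc, ← Complex.exp_add] at hu
      have h2 : c x = (c x * Complex.exp (-((X x / 2 : ℝ) + Θ x * Complex.I))) *
          Complex.exp ((X x / 2 : ℝ) + Θ x * Complex.I) := by
        rw [mul_assoc, ← Complex.exp_add]; simp
      rw [h2, hu, mul_assoc, ← Complex.exp_add, polar]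
      congr 2
      push_cast; ring
    · have e1 : HasDerivWithinAt (fun x => (((X x / 2 : ℝ) : ℂ) + Θ x * Complex.I))
          (((g z * (2 * Y z) / 2 : ℝ) : ℂ) + g z * Complex.I) (Icc 0 1) z :=
        ((dX z hz).div_const 2).ofReal_comp.add ((dΘ' z hz).ofReal_comp.mul_const _)
      refine ((h.hasDeriv z hz).mul e1.neg.cexp).congr_deriv ?_
      simp only [Pi.neg_apply]
      rw [mul_left_comm, mul_comm (c₁ z), ← mul_add]
      convert mul_zero _
      have hd := hdd z hz
      have hp := hpos z hz
      simp only [hg, hYdef]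
      apply Complex.ext
      · simp
        field_simp
        simp [cross, dot]
        ring
      · simp
        field_simp
        simp [cross, dot]
        ring
  refine ⟨fun x => phase B (ang B α + Θ x),
    ((continuous_phase B).comp (continuous_const.add cΘ)).continuousOn,
    fun x hx y hy hxy => strictMono_phase B (by linarith [mΘ hx hy hxy]), by simp [hΘ0],
    fun x hx => ⟨?_, ?_⟩⟩
  · rw [hpolar x hx, (key x hx).1]; simp
  · rw [← (key x hx).2]; exact (div_mul_cancel₀ _ (hpos x hx).ne').symm

end Network
namespace Network

/-! ### Local geometry of a network -/

instance : Finite Edge :=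
  Finite.of_surjective (fun i : Fin 4 => match i with
    | 0 => Edge.arc₁ | 1 => Edge.arc₂ | 2 => Edge.ray₁ | 3 => Edge.ray₂)
    (by rintro (_ | _ | _ | _); exacts [⟨0, rfl⟩, ⟨1, rfl⟩, ⟨2, rfl⟩, ⟨3, rfl⟩])

lemma isClosed_dom (e : Edge) : IsClosed e.dom := by
  cases e
  exacts [isClosed_Icc, isClosed_Icc, isClosed_Ici, isClosed_Ici]

lemma convex_dom (e : Edge) : Convex ℝ e.dom := by
  cases e
  exacts [convex_Icc _ _, convex_Icc _ _, convex_Ici _, convex_Ici _]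

lemma zero_mem_dom (e : Edge) : (0 : ℝ) ∈ e.dom := by cases e <;> simp [Edge.dom]

lemma uniqueDiffOn_dom (e : Edge) : UniqueDiffOn ℝ e.dom := by
  cases e
  exacts [uniqueDiffOn_Icc_zero_one, uniqueDiffOn_Icc_zero_one, uniqueDiffOn_Ici _,
    uniqueDiffOn_Ici _]

lemma dom_subset_closure (e : Edge) : e.dom ⊆ closure (interior e.dom) := by
  cases e <;> simp [Edge.dom, closure_Ioo, closure_Ioi]

lemma IsEnd.mem_dom {v : Vertex} {e : Edge} {x σ : ℝ} (h : IsEnd v e x σ) : x ∈ e.dom := by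
  cases h <;> simp [Edge.dom]

lemma IsEnd.notMem_interior {v : Vertex} {e : Edge} {x σ : ℝ} (h : IsEnd v e x σ) :
    x ∉ interior e.dom := by
  cases h <;> simp [Edge.dom]

/-- A parameter which is not interior is an end of the edge. -/
lemma isEnd_of_notMem_interior {e : Edge} {x : ℝ} (hx : x ∈ e.dom) (h : x ∉ interior e.dom) :
    ∃ v σ, IsEnd v e x σ := by
  have aux : ∀ y : ℝ, y ∈ Icc (0 : ℝ) 1 → y ∉ Ioo (0 : ℝ) 1 → y = 0 ∨ y = 1 := by
    intro y hy hy2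
    by_contra! hne
    exact hy2 ⟨lt_of_le_of_ne hy.1 hne.1.symm, lt_of_le_of_ne hy.2 hne.2⟩
  have aux2 : ∀ y : ℝ, y ∈ Ici (0 : ℝ) → y ∉ Ioi (0 : ℝ) → y = 0 := by
    intro y hy hy2
    simp at hy hy2
    linarith
  cases e
  · rw [Edge.dom, interior_Icc] at h
    rcases aux x hx h with rfl | rfl
    exacts [⟨_, _, .arc₁_p⟩, ⟨_, _, .arc₁_q⟩]
  · rw [Edge.dom, interior_Icc] at h
    rcases aux x hx h with rfl | rfl
    exacts [⟨_, _, .arc₂_p⟩, ⟨_, _, .arc₂_q⟩]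
  · rw [Edge.dom, interior_Ici] at h
    obtain rfl := aux2 x hx h
    exact ⟨_, _, .ray₁_p⟩
  · rw [Edge.dom, interior_Ici] at h
    obtain rfl := aux2 x hx h
    exact ⟨_, _, .ray₂_q⟩

lemma isEnd_arc₁ {v : Vertex} {x σ : ℝ} (h : IsEnd v .arc₁ x σ) :
    v = .p ∧ x = 0 ∨ v = .q ∧ x = 1 := by
  cases h <;> simp

lemma isEnd_ray₁ {v : Vertex} {x σ : ℝ} (h : IsEnd v .ray₁ x σ) : v = .p ∧ x = 0 := by
  cases h; simp

lemma isEnd_ray₂ {v : Vertex} {x σ : ℝ} (h : IsEnd v .ray₂ x σ) : v = .q ∧ x = 0 := by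
  cases h; simp

/-- The position of a vertex. -/
def vertexPos (F : Edge → ℝ → ℂ) : Vertex → ℂ
  | .p => F .arc₁ 0
  | .q => F .arc₁ 1

section
variable {F : Edge → ℝ → ℂ}

lemma mem_trace {e : Edge} {x : ℝ} (hx : x ∈ e.dom) : F e x ∈ trace F :=
  mem_iUnion.2 ⟨e, x, hx, rfl⟩

lemma IsGeneralizedLens.eq_vertexPos (hF : IsGeneralizedLens F) {v : Vertex} {e : Edge} {x σ : ℝ}
    (h : IsEnd v e x σ) : F e x = vertexPos F v := by
  cases v
  · exact (hF.injective e x h.mem_dom .arc₁ 0 (zero_mem_dom _)).2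
      (Or.inr ⟨_, _, _, h, .arc₁_p⟩)
  · exact (hF.injective e x h.mem_dom .arc₁ 1 (by simp [Edge.dom])).2
      (Or.inr ⟨_, _, _, h, .arc₁_q⟩)

lemma IsGeneralizedLens.p_ne_q (hF : IsGeneralizedLens F) : F .arc₁ 0 ≠ F .arc₁ 1 := by
  intro h
  rcases (hF.injective .arc₁ 0 (zero_mem_dom _) .arc₁ 1 (by simp [Edge.dom])).1 h with
    ⟨_, h⟩ | ⟨v, σ, σ', h1, h2⟩
  · norm_num at h
  · rcases isEnd_arc₁ h1 with ⟨rfl, h⟩ | ⟨rfl, h⟩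
    · rcases isEnd_arc₁ h2 with ⟨h, _⟩ | ⟨h, _⟩ <;> simp_all
    · norm_num at h

/-- On each edge a generalized lens-shaped network is a proper map. -/
lemma IsGeneralizedLens.isClosed_image (hF : IsGeneralizedLens F) {e : Edge} {S : Set ℝ}
    (hS : IsClosed S) (hSe : S ⊆ e.dom) : IsClosed (F e '' S) := by
  have hc : ContinuousOn (F e) S := (hF.smooth e).continuousOn.mono hSe
  have hray : (e = .ray₁ ∨ e = .ray₂) → IsClosed (F e '' S) := by
    intro he
    rw [isClosed_iff_frequently]
    intro z hz
    have hlim := hF.infinite e he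
    obtain ⟨R, hR⟩ := eventually_atTop.1 (hlim.eventually_gt_atTop (‖z‖ + 1))
    have hK : IsCompact (F e '' (S ∩ Icc 0 R)) :=
      (isCompact_Icc.inter_left hS).image_of_continuousOn (hc.mono inter_subset_left)
    have h2 : ∃ᶠ y in 𝓝 z, y ∈ F e '' (S ∩ Icc 0 R) := by
      refine (hz.and_eventually (Metric.ball_mem_nhds z one_pos)).mono ?_
      rintro y ⟨⟨x, hx, rfl⟩, hy⟩
      refine ⟨x, ⟨hx, ?_, ?_⟩, rfl⟩
      · have := hSe hx
        rcases he with rfl | rfl <;> exact this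
      · by_contra! h
        have h3 := hR x h.le
        have h4 := norm_sub_norm_le (F e x) z
        rw [← dist_eq_norm] at h4
        have : dist (F e x) z < 1 := hy
        linarith
    exact image_mono inter_subset_left
      (hK.isClosed.closure_subset (mem_closure_iff_frequently.2 h2))
  cases e
  · exact ((isCompact_Icc.of_isClosed_subset hS hSe).image_of_continuousOn hc).isClosed
  · exact ((isCompact_Icc.of_isClosed_subset hS hSe).image_of_continuousOn hc).isClosed
  · exact hray (Or.inl rfl)
  · exact hray (Or.inr rfl)

lemma IsGeneralizedLens.isClosed_trace (hF : IsGeneralizedLens F) : IsClosed (trace F) :=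
  isClosed_iUnion_of_finite fun e => hF.isClosed_image (isClosed_dom e) Subset.rfl

/-- Near a point in the interior of an edge the network consists of this edge only. -/
lemma IsGeneralizedLens.nhdsWithin_le (hF : IsGeneralizedLens F) {e : Edge} {x : ℝ}
    (hx : x ∈ interior e.dom) : 𝓝[trace F] (F e x) ≤ map (F e) (𝓝 x) := by
  intro U hU
  obtain ⟨N, hNU, hNo, hxN⟩ := mem_nhds_iff.1 (mem_map.1 hU)
  set S : Edge → Set ℝ := fun e' => e'.dom \ {y | e' = e ∧ y ∈ N} with hS
  have hSc : ∀ e', IsClosed (S e') := by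
    intro e'
    refine (isClosed_dom e').sdiff ?_
    by_cases h : e' = e
    · simpa [h] using hNo
    · simp [h]
  have hK : IsClosed (⋃ e', F e' '' S e') :=
    isClosed_iUnion_of_finite fun e' => hF.isClosed_image (hSc e') sdiff_subset
  have hnot : F e x ∉ ⋃ e', F e' '' S e' := by
    rw [mem_iUnion]
    rintro ⟨e', y, hy, hyx⟩
    rcases (hF.injective e' y hy.1 e x (interior_subset hx)).1 hyx with
      ⟨h1, h2⟩ | ⟨v, σ, σ', _, h2⟩
    · exact hy.2 ⟨h1, h2 ▸ hxN⟩
    · exact h2.notMem_interior hx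
  refine mem_of_superset (inter_mem_nhdsWithin _ (hK.isOpen_compl.mem_nhds hnot)) ?_
  rintro z ⟨hz, hzK⟩
  obtain ⟨e', y, hy, rfl⟩ := mem_iUnion.1 hz
  by_cases h : e' = e ∧ y ∈ N
  · obtain ⟨rfl, hyN⟩ := h
    exact hNU hyN
  · exact (hzK (mem_iUnion.2 ⟨e', y, ⟨hy, h⟩, rfl⟩)).elim

end

/-! ### Tangent lines and curvature of a planar set -/

/-- The set `M` is tangent at `z` to the line in direction `τ`. -/
def HasTangentLine (M : Set ℂ) (z τ : ℂ) : Prop :=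
  (fun y => cross τ (y - z)) =o[𝓝[M] z] fun y => y - z

/-- The set `M`, which is tangent to `τ` at `z`, has at `z` the second order contact `L` with this
tangent: the signed distance to the tangent line, in units of `1 / ‖τ‖`, is `L` times the squared
distance to `z`, to leading order. This determines the curvature in terms of the set `M` only. -/
def HasContact (M : Set ℂ) (z τ : ℂ) (L : ℝ) : Prop :=
  Tendsto (fun y => cross τ (y - z) / dot (y - z) (y - z)) (𝓝[M \ {z}] z) (𝓝 L)

/-- A curve in `M` has a velocity parallel to the tangent line. -/
lemma HasTangentLine.cross_eq_zero {M : Set ℂ} {z τ : ℂ} (h : HasTangentLine M z τ) {m : ℝ → ℂ}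
    {m' : ℂ} {S : Set ℝ} {t : ℝ} (hm : HasDerivWithinAt m m' S t) (hS : UniqueDiffWithinAt ℝ S t)
    (hmt : m t = z) (hM : ∀ᶠ s in 𝓝[S] t, m s ∈ M) : cross τ m' = 0 := by
  have h1 : Tendsto m (𝓝[S] t) (𝓝[M] z) :=
    tendsto_nhdsWithin_iff.2 ⟨hmt ▸ hm.continuousWithinAt, hM⟩
  have h2 := h.comp_tendsto h1
  have h3 : (fun s => m s - z) =O[𝓝[S] t] fun s => s - t := by
    rw [← hmt]; exact hm.hasFDerivWithinAt.isBigO_sub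
  have h4 := h2.trans_isBigO h3
  have h5 : HasDerivWithinAt (fun s => cross τ (m s - z)) 0 S t := by
    rw [hasDerivWithinAt_iff_isLittleO]
    simpa [hmt, cross, Function.comp_def] using h4
  have h6 := hasDerivWithinAt_cross (hasDerivWithinAt_const t S τ) (hm.sub_const z)
  have h7 := hS.eq_deriv S h6 h5
  simpa [cross] using h7

lemma hasTangentLine_of_hasDerivAt {M : Set ℂ} {c : ℝ → ℂ} {τ : ℂ} {x : ℝ} (hc : HasDerivAt c τ x)
    (hτ : τ ≠ 0) (hM : 𝓝[M] (c x) ≤ map c (𝓝 x)) : HasTangentLine M (c x) τ := by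
  refine Asymptotics.IsLittleO.mono ?_ hM
  rw [Asymptotics.isLittleO_map]
  have h1 : (fun y => y - x) =O[𝓝 x] fun y => c y - c x :=
    (HasDerivAtFilter.isTheta_sub hc hτ).isBigO_symm.comp_tendsto
      (tendsto_id.prodMk (tendsto_pure.2 (Eventually.of_forall fun _ => rfl)))
  have h2 := hasDerivWithinAt_cross (hasDerivWithinAt_const x univ τ)
    (hc.hasDerivWithinAt.sub_const (c x))
  rw [cross_self, add_zero, hasDerivWithinAt_univ, hasDerivAt_iff_isLittleO] at h2
  have h3 : (fun y => cross τ (c y - c x)) =o[𝓝 x] fun y => y - x := by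
    simpa [cross] using h2
  exact h3.trans_isBigO h1

lemma nhdsWithin_sdiff_le {M : Set ℂ} {c : ℝ → ℂ} {x : ℝ} (hM : 𝓝[M] (c x) ≤ map c (𝓝 x)) :
    𝓝[M \ {c x}] (c x) ≤ map c (𝓝[≠] x) := by
  have h1 : 𝓝[M \ {c x}] (c x) = 𝓝[M] (c x) ⊓ 𝓟 {c x}ᶜ := by
    rw [nhdsWithin, nhdsWithin, sdiff_eq, inf_assoc, inf_principal]
  rw [h1]
  refine (inf_le_inf_right _ hM).trans ?_
  rw [← map_inf_principal_preimage]
  refine map_mono (inf_le_inf_left _ (principal_mono.2 fun y hy => ?_))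
  rintro rfl
  exact hy rfl

/-- The second order contact of a regular curve with its tangent is half its signed curvature in the
units of `HasContact`. -/
lemma hasContact_of_hasDerivAt {M : Set ℂ} {c c₁ : ℝ → ℂ} {c₂ : ℂ} {x : ℝ}
    (hc : ∀ᶠ y in 𝓝 x, HasDerivAt c (c₁ y) y) (hc₁ : HasDerivAt c₁ c₂ x)
    (hτ : c₁ x ≠ 0) (hM : 𝓝[M] (c x) ≤ map c (𝓝 x)) :
    HasContact M (c x) (c₁ x) (cross (c₁ x) c₂ / dot (c₁ x) (c₁ x) / 2) := by
  have hcx := hc.self_of_nhds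
  have hd : ∀ᶠ y in 𝓝[≠] x, HasDerivAt (fun y => cross (c₁ x) (c y - c x))
      (cross (c₁ x) (c₁ y)) y := by
    filter_upwards [hc.filter_mono nhdsWithin_le_nhds] with y hy
    have := hasDerivWithinAt_cross (hasDerivWithinAt_const y univ (c₁ x))
      (hy.hasDerivWithinAt.sub_const (c x))
    simpa [cross] using this
  have hslope : Tendsto (fun y => cross (c₁ x) (c₁ y) / (2 * (y - x))) (𝓝[≠] x)
      (𝓝 (cross (c₁ x) c₂ / 2)) := by
    have h1 := hasDerivWithinAt_cross (hasDerivWithinAt_const x univ (c₁ x)) hc₁.hasDerivWithinAt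
    rw [hasDerivWithinAt_univ, hasDerivAt_iff_tendsto_slope] at h1
    have h2 := h1.div_const 2
    rw [show cross 0 (c₁ x) + cross (c₁ x) c₂ = cross (c₁ x) c₂ by simp [cross]] at h2
    refine h2.congr fun y => ?_
    rw [slope_def_field, cross_self, sub_zero, div_div, mul_comm 2]
  have hcont : Tendsto c (𝓝 x) (𝓝 (c x)) := hcx.continuousAt
  have hlim : Tendsto (fun y => cross (c₁ x) (c y - c x) / (y - x) ^ 2) (𝓝[≠] x)
      (𝓝 (cross (c₁ x) c₂ / 2)) := by
    refine HasDerivAt.lhopital_zero_nhdsNE (f' := fun y => cross (c₁ x) (c₁ y))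
      (g' := fun y => 2 * (y - x)) hd ?_ ?_ ?_ ?_ hslope
    · refine Eventually.of_forall fun y => ?_
      exact (((hasDerivAt_id y).sub_const x).pow 2).congr_deriv (by simp)
    · filter_upwards [self_mem_nhdsWithin] with y hy
      exact mul_ne_zero two_ne_zero (sub_ne_zero.2 hy)
    · refine Tendsto.mono_left ?_ nhdsWithin_le_nhds
      have : Continuous fun w => cross (c₁ x) (w - c x) := by unfold cross; fun_prop
      have h := (this.tendsto (c x)).comp hcont
      simpa [cross, Function.comp_def] using h
    · refine Tendsto.mono_left ?_ nhdsWithin_le_nhds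
      exact Continuous.tendsto' (by fun_prop) _ _ (by simp)
  have hlim2 : Tendsto (fun y => dot (c y - c x) (c y - c x) / (y - x) ^ 2) (𝓝[≠] x)
      (𝓝 (dot (c₁ x) (c₁ x))) := by
    have h1 := hasDerivAt_iff_tendsto_slope.1 hcx
    have : Continuous fun w : ℂ => dot w w := by unfold dot; fun_prop
    refine ((this.tendsto _).comp h1).congr fun y => ?_
    simp only [Function.comp, slope_def_module, dot_smul_left, dot_smul_right]
    field_simp
  have h3 := hlim.div hlim2 (dot_self_pos hτ).ne'
  refine Tendsto.mono_left (x := map c (𝓝[≠] x)) (y := 𝓝[M \ {c x}] c x) ?_ (nhdsWithin_sdiff_le hM)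
  rw [tendsto_map'_iff]
  rw [div_right_comm] at h3
  refine h3.congr' ?_
  filter_upwards [self_mem_nhdsWithin] with y hy
  have : (y - x) ^ 2 ≠ 0 := pow_ne_zero 2 (sub_ne_zero.2 hy)
  simp only [Pi.div_apply, Function.comp]
  rw [div_div_div_cancel_right₀ this]

lemma nhdsWithin_sdiff_neBot {M : Set ℂ} {c : ℝ → ℂ} {τ : ℂ} {x : ℝ} (hc : HasDerivAt c τ x)
    (hτ : τ ≠ 0) (hM : ∀ᶠ y in 𝓝 x, c y ∈ M) : (𝓝[M \ {c x}] (c x)).NeBot := by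
  have h1 : Tendsto c (𝓝[≠] x) (𝓝[M \ {c x}] (c x)) := by
    refine tendsto_nhdsWithin_iff.2 ⟨hc.continuousAt.tendsto.mono_left nhdsWithin_le_nhds, ?_⟩
    filter_upwards [hM.filter_mono nhdsWithin_le_nhds, hc.eventually_ne hτ (c := c x)] with y h1 h2
    exact ⟨h1, h2⟩
  exact h1.neBot

lemma HasContact.smul {M : Set ℂ} {z τ : ℂ} {L : ℝ} (h : HasContact M z τ L) (r : ℝ) :
    HasContact M z (r • τ) (r * L) := by
  refine (Tendsto.const_mul r h).congr fun y => ?_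
  rw [cross_smul_left]; ring

/-! ### Similarities -/

/-- The orientation preserving similarity without rotational part `z ↦ k • z + b`. -/
noncomputable def simil (k : ℝ) (b z : ℂ) : ℂ := k • z + b

lemma simil_sub (k : ℝ) (b z w : ℂ) : simil k b z - simil k b w = k • (z - w) := by
  simp [simil]; ring

lemma continuous_simil (k : ℝ) (b : ℂ) : Continuous (simil k b) := by unfold simil; fun_prop

lemma homothety_eq_simil (c : ℂ) (k : ℝ) :
    (AffineMap.homothety c k : ℂ → ℂ) = simil k (c - k • c) := by
  ext z
  simp [AffineMap.homothety_apply, simil]; ring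

lemma simil_inv {k : ℝ} (hk : k ≠ 0) (b z : ℂ) : simil k⁻¹ (-(k⁻¹ • b)) (simil k b z) = z := by
  have : (k : ℂ) ≠ 0 := by exact_mod_cast hk
  simp [simil]; field_simp

lemma simil_inv' {k : ℝ} (hk : k ≠ 0) (b z : ℂ) : simil k b (simil k⁻¹ (-(k⁻¹ • b)) z) = z := by
  have : (k : ℂ) ≠ 0 := by exact_mod_cast hk
  simp [simil]; field_simp; ring

/-- The inverse similarity maps the punctured neighbourhoods of the image back. -/
lemma tendsto_simil_inv {k : ℝ} (hk : k ≠ 0) (b z : ℂ) (M : Set ℂ) :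
    Tendsto (simil k⁻¹ (-(k⁻¹ • b))) (𝓝[simil k b '' M] (simil k b z)) (𝓝[M] z) := by
  refine tendsto_nhdsWithin_iff.2 ⟨?_, ?_⟩
  · have := (continuous_simil k⁻¹ (-(k⁻¹ • b))).tendsto (simil k b z)
    rw [simil_inv hk] at this
    exact this.mono_left nhdsWithin_le_nhds
  · filter_upwards [self_mem_nhdsWithin] with y hy
    obtain ⟨w, hw, rfl⟩ := hy
    rwa [simil_inv hk]

lemma HasTangentLine.simil {M : Set ℂ} {z τ : ℂ} (h : HasTangentLine M z τ) {k : ℝ} (hk : k ≠ 0)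
    (b : ℂ) : HasTangentLine (simil k b '' M) (simil k b z) τ := by
  have h1 := h.comp_tendsto (tendsto_simil_inv hk b z M)
  have h2 : ∀ y, y - Network.simil k b z =
      k • (Network.simil k⁻¹ (-(k⁻¹ • b)) y - z) := by
    intro y
    rw [← simil_sub k b, simil_inv' hk]
  unfold HasTangentLine
  simp only [h2, cross_smul_right]
  rw [Asymptotics.isLittleO_const_smul_right hk]
  exact h1.const_mul_left k

lemma HasContact.simil {M : Set ℂ} {z τ : ℂ} {L : ℝ} (h : HasContact M z τ L) {k : ℝ} (hk : k ≠ 0)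
    (b : ℂ) : HasContact (simil k b '' M) (simil k b z) τ (L / k) := by
  have h0 : Network.simil k b '' M \ {Network.simil k b z} =
      Network.simil k b '' (M \ {z}) := by
    rw [image_sdiff (fun x y hxy => by rw [← simil_inv hk b x, hxy, simil_inv hk]), image_singleton]
  have h1 := (Tendsto.div_const h k).comp (tendsto_simil_inv hk b z (M \ {z}))
  rw [← h0] at h1
  refine h1.congr fun y => ?_
  have h2 : y - Network.simil k b z = k • (Network.simil k⁻¹ (-(k⁻¹ • b)) y - z) := by
    rw [← simil_sub k b, simil_inv' hk]
  rw [h2]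
  simp only [Function.comp, cross_smul_right, dot_smul_left, dot_smul_right]
  field_simp

end Network
namespace Network

/-! ### Vertices -/

lemma dot_of_angle {u v : ℂ} (h : InnerProductGeometry.angle u v = 2 * Real.pi / 3) :
    dot u v = -(1 / 2) * (‖u‖ * ‖v‖) := by
  rw [← inner_eq_dot, ← InnerProductGeometry.cos_angle_mul_norm_mul_norm, h,
    show 2 * Real.pi / 3 = Real.pi - Real.pi / 3 by ring, Real.cos_pi_sub, Real.cos_pi_div_three]

lemma cross_ne_zero_of_angle {u v : ℂ} (hu : u ≠ 0) (hv : v ≠ 0)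
    (h : InnerProductGeometry.angle u v = 2 * Real.pi / 3) : cross u v ≠ 0 := by
  intro h0
  have h1 := cross_sq_add_dot_sq u v
  rw [h0, dot_of_angle h, dot_self, dot_self] at h1
  have := norm_pos_iff.2 hu
  have := norm_pos_iff.2 hv
  have : 0 < (‖u‖ * ‖v‖) ^ 2 := by positivity
  nlinarith

lemma eq_zero_of_cross {u v w : ℂ} (h : cross u v ≠ 0) (hu : cross u w = 0) (hv : cross v w = 0) :
    w = 0 := by
  apply Complex.ext
  · apply mul_left_cancel₀ h
    simp only [cross, Complex.zero_re] at *
    linear_combination v.re * hu - u.re * hv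
  · apply mul_left_cancel₀ h
    simp only [cross, Complex.zero_im] at *
    linear_combination v.im * hu - u.im * hv

section
variable {F : Edge → ℝ → ℂ}

/-- At a vertex the tangents span the plane: only `0` is parallel to all of them. -/
lemma IsGeneralizedLens.eq_zero_of_cross (hF : IsGeneralizedLens F) {v : Vertex} {w : ℂ}
    (h : ∀ e x σ, IsEnd v e x σ → cross (derivWithin (F e) e.dom x) w = 0) : w = 0 := by
  have key : ∀ x σ, IsEnd v .arc₁ x σ → IsEnd v .arc₂ x σ → σ ≠ 0 → w = 0 := by
    intro x σ h1 h2 hσ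
    have ha := hF.angle v _ x σ _ x σ h1 h2 (by simp)
    refine Network.eq_zero_of_cross (cross_ne_zero_of_angle
      (smul_ne_zero hσ (hF.regular _ x h1.mem_dom)) (smul_ne_zero hσ (hF.regular _ x h2.mem_dom)) ha)
      ?_ ?_
    · rw [cross_smul_left, h _ _ _ h1, mul_zero]
    · rw [cross_smul_left, h _ _ _ h2, mul_zero]
  cases v
  · exact key 0 1 .arc₁_p .arc₂_p one_ne_zero
  · exact key 1 (-1) .arc₁_q .arc₂_q (by norm_num)

lemma IsGeneralizedLens.hasDerivWithinAt (hF : IsGeneralizedLens F) {e : Edge} {x : ℝ}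
    (hx : x ∈ e.dom) : HasDerivWithinAt (F e) (derivWithin (F e) e.dom x) e.dom x :=
  (((hF.smooth e).differentiableOn (by simp)) x hx).hasDerivWithinAt

lemma IsGeneralizedLens.contDiffOn_derivWithin (hF : IsGeneralizedLens F) (e : Edge) :
    ContDiffOn ℝ ∞ (derivWithin (F e) e.dom) e.dom :=
  ((contDiffOn_infty_iff_derivWithin (uniqueDiffOn_dom e)).1 (hF.smooth e)).2

lemma IsGeneralizedLens.hasDerivWithinAt₂ (hF : IsGeneralizedLens F) {e : Edge} {x : ℝ}
    (hx : x ∈ e.dom) : HasDerivWithinAt (derivWithin (F e) e.dom)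
      (derivWithin (derivWithin (F e) e.dom) e.dom x) e.dom x :=
  (((hF.contDiffOn_derivWithin e).differentiableOn (by simp)) x hx).hasDerivWithinAt

lemma derivWithin_eventuallyEq {e : Edge} {x : ℝ} (hx : x ∈ interior e.dom) (f : ℝ → ℂ) :
    derivWithin f e.dom =ᶠ[𝓝 x] deriv f := by
  filter_upwards [isOpen_interior.mem_nhds hx] with y hy
  exact derivWithin_of_mem_nhds (mem_interior_iff_mem_nhds.1 hy)

lemma IsGeneralizedLens.hasDerivAt (hF : IsGeneralizedLens F) {e : Edge} {x : ℝ}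
    (hx : x ∈ interior e.dom) : HasDerivAt (F e) (deriv (F e) x) x :=
  ((hF.hasDerivWithinAt (interior_subset hx)).hasDerivAt
    (mem_interior_iff_mem_nhds.1 hx)).differentiableAt.hasDerivAt

lemma IsGeneralizedLens.deriv_ne_zero (hF : IsGeneralizedLens F) {e : Edge} {x : ℝ}
    (hx : x ∈ interior e.dom) : deriv (F e) x ≠ 0 := by
  rw [← (derivWithin_eventuallyEq hx (F e)).self_of_nhds]
  exact hF.regular e x (interior_subset hx)

lemma deriv_deriv_eq {e : Edge} {x : ℝ} (hx : x ∈ interior e.dom) (f : ℝ → ℂ) :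
    derivWithin (derivWithin f e.dom) e.dom x = deriv (deriv f) x := by
  rw [(derivWithin_eventuallyEq hx _).self_of_nhds, (derivWithin_eventuallyEq hx f).deriv_eq]

lemma IsGeneralizedLens.hasDerivAt₂ (hF : IsGeneralizedLens F) {e : Edge} {x : ℝ}
    (hx : x ∈ interior e.dom) : HasDerivAt (deriv (F e)) (deriv (deriv (F e)) x) x := by
  have h := (hF.hasDerivWithinAt₂ (interior_subset hx)).hasDerivAt
    (mem_interior_iff_mem_nhds.1 hx)
  rw [deriv_deriv_eq hx] at h
  exact h.congr_of_eventuallyEq (derivWithin_eventuallyEq hx (F e)).symm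

lemma IsGeneralizedLens.hasTangentLine (hF : IsGeneralizedLens F) {e : Edge} {x : ℝ}
    (hx : x ∈ interior e.dom) : HasTangentLine (trace F) (F e x) (deriv (F e) x) :=
  hasTangentLine_of_hasDerivAt (hF.hasDerivAt hx) (hF.deriv_ne_zero hx) (hF.nhdsWithin_le hx)

lemma IsGeneralizedLens.hasContact (hF : IsGeneralizedLens F) {e : Edge} {x : ℝ}
    (hx : x ∈ interior e.dom) : HasContact (trace F) (F e x) (deriv (F e) x)
      (cross (deriv (F e) x) (deriv (deriv (F e)) x) / dot (deriv (F e) x) (deriv (F e) x) / 2) :=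
  hasContact_of_hasDerivAt
    (by filter_upwards [isOpen_interior.mem_nhds hx] with y hy using hF.hasDerivAt hy)
    (hF.hasDerivAt₂ hx) (hF.deriv_ne_zero hx) (hF.nhdsWithin_le hx)

lemma IsGeneralizedLens.eq_zero_of_hasTangentLine (hF : IsGeneralizedLens F) {v : Vertex} {τ : ℂ}
    (h : HasTangentLine (trace F) (vertexPos F v) τ) : τ = 0 := by
  refine hF.eq_zero_of_cross (v := v) fun e x σ hx => ?_
  rw [cross_comm, h.cross_eq_zero (hF.hasDerivWithinAt hx.mem_dom)
    (uniqueDiffOn_dom e x hx.mem_dom) (hF.eq_vertexPos hx)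
    (eventually_nhdsWithin_of_forall fun y hy => mem_trace hy), neg_zero]

end

/-- The points of `M` at which `M` has no tangent line. -/
def singularPoints (M : Set ℂ) : Set ℂ := {z ∈ M | ∀ τ, HasTangentLine M z τ → τ = 0}

/-- The vertices can be recovered from the set: they are the points without a tangent line. -/
lemma IsGeneralizedLens.singularPoints_eq {F : Edge → ℝ → ℂ} (hF : IsGeneralizedLens F) :
    singularPoints (trace F) = {F .arc₁ 0, F .arc₁ 1} := by
  ext z
  constructor
  · rintro ⟨hz, h⟩
    obtain ⟨e, x, hx, rfl⟩ := mem_iUnion.1 hz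
    by_cases hi : x ∈ interior e.dom
    · exact absurd (h _ (hF.hasTangentLine hi)) (hF.deriv_ne_zero hi)
    · obtain ⟨v, σ, hv⟩ := isEnd_of_notMem_interior hx hi
      rw [hF.eq_vertexPos hv]
      cases v <;> simp [vertexPos]
  · rintro (rfl | rfl)
    · exact ⟨mem_trace (zero_mem_dom _), fun τ h => hF.eq_zero_of_hasTangentLine (v := .p) h⟩
    · exact ⟨mem_trace (by simp [Edge.dom]), fun τ h => hF.eq_zero_of_hasTangentLine (v := .q) h⟩

lemma simil_image_inv {k : ℝ} (hk : k ≠ 0) (b : ℂ) (M : Set ℂ) :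
    simil k⁻¹ (-(k⁻¹ • b)) '' (simil k b '' M) = M := by
  rw [image_image]
  simp only [simil_inv hk, image_id']

lemma singularPoints_simil {k : ℝ} (hk : k ≠ 0) (b : ℂ) (M : Set ℂ) :
    singularPoints (simil k b '' M) = simil k b '' singularPoints M := by
  have key : ∀ z τ, HasTangentLine (simil k b '' M) (simil k b z) τ → HasTangentLine M z τ := by
    intro z τ h
    have := h.simil (inv_ne_zero hk) (-(k⁻¹ • b))
    rwa [simil_image_inv hk, simil_inv hk] at this
  ext z
  constructor
  · rintro ⟨⟨w, hw, rfl⟩, h⟩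
    exact ⟨w, ⟨hw, fun τ hτ => h τ (hτ.simil hk b)⟩, rfl⟩
  · rintro ⟨w, ⟨hw, h⟩, rfl⟩
    exact ⟨⟨w, hw, rfl⟩, fun τ hτ => h τ (key w τ hτ)⟩

/-! ### Bounded components -/

lemma simil_mem_boundedPart {k : ℝ} (hk : k ≠ 0) (b : ℂ) {M : Set ℂ} {z : ℂ}
    (hz : z ∈ boundedPart M) : simil k b z ∈ boundedPart (simil k b '' M) := by
  set h : ℂ ≃ₜ ℂ :=
    { toFun := simil k b
      invFun := simil k⁻¹ (-(k⁻¹ • b))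
      left_inv := simil_inv hk b
      right_inv := simil_inv' hk b
      continuous_toFun := continuous_simil _ _
      continuous_invFun := continuous_simil _ _ }
  have hc : h '' Mᶜ = (h '' M)ᶜ := image_compl_eq h.bijective
  refine ⟨?_, ?_⟩
  · change h z ∈ (h '' M)ᶜ
    rw [← hc]
    exact mem_image_of_mem h hz.1
  · change Bornology.IsBounded (connectedComponentIn (h '' M)ᶜ (h z))
    rw [← hc, ← h.image_connectedComponentIn hz.1]
    have hl : LipschitzWith ‖k‖₊ (simil k b) := by
      refine LipschitzWith.of_dist_le_mul fun x y => ?_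
      rw [dist_eq_norm, dist_eq_norm, simil_sub, norm_smul]; simp
    exact hl.isBounded_image hz.2

lemma isOpen_boundedPart {M : Set ℂ} (hM : IsClosed M) : IsOpen (boundedPart M) := by
  rw [isOpen_iff_mem_nhds]
  intro z hz
  have h1 : connectedComponentIn Mᶜ z ∈ 𝓝 z :=
    (hM.isOpen_compl.connectedComponentIn).mem_nhds (mem_connectedComponentIn hz.1)
  filter_upwards [h1] with w hw
  refine ⟨connectedComponentIn_subset _ _ hw, ?_⟩
  rw [← connectedComponentIn_eq hw]
  exact hz.2

lemma exists_ne_mem_boundedPart {M : Set ℂ} (hM : IsClosed M) (h : (boundedPart M).Nonempty) :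
    ∃ z ∈ boundedPart M, ∃ w ∈ boundedPart M, z ≠ w := by
  obtain ⟨z, hz⟩ := h
  have hinf : (boundedPart M).Infinite :=
    infinite_of_mem_nhds z ((isOpen_boundedPart hM).mem_nhds hz)
  obtain ⟨w, hw, hwz⟩ := hinf.exists_notMem_finset {z}
  exact ⟨z, hz, w, hw, fun h => hwz (by simp [h])⟩

end Network
namespace Network

/-! ### Homothetic solutions are centred self-shrinkers -/

section
variable {M : ℝ → Set ℂ} {F : ℝ → Edge → ℝ → ℂ}

/-- The ratio of the homothety which maps the network at time `-1` to the one at time `t`. -/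
noncomputable def ratio (F : ℝ → Edge → ℝ → ℂ) (t : ℝ) : ℝ :=
  ‖F t .arc₁ 0 - F t .arc₁ 1‖ / ‖F (-1) .arc₁ 0 - F (-1) .arc₁ 1‖

/-- The translational part of the homothety which maps the network at time `-1` to the one at time
`t`. -/
noncomputable def shift (F : ℝ → Edge → ℝ → ℂ) (t : ℝ) : ℂ :=
  (1 / 2 : ℝ) • (F t .arc₁ 0 + F t .arc₁ 1 - ratio F t • (F (-1) .arc₁ 0 + F (-1) .arc₁ 1))

lemma pair_sum_diff {a b c d : ℂ} (h : ({a, b} : Set ℂ) = {c, d}) :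
    a + b = c + d ∧ ‖a - b‖ = ‖c - d‖ := by
  rcases Set.pair_eq_pair_iff.1 h with ⟨rfl, rfl⟩ | ⟨rfl, rfl⟩
  · exact ⟨rfl, rfl⟩
  · exact ⟨add_comm _ _, norm_sub_rev _ _⟩

/-- The homothety between two slices is determined by the vertices, since it maps the singular
points of one slice to those of the other. -/
lemma eq_simil_image (hF : ∀ t < 0, IsGeneralizedLens (F t) ∧ M t = trace (F t))
    (hom : IsHomotheticFamily M) {t : ℝ} (ht : t < 0) :
    0 < ratio F t ∧ M t = simil (ratio F t) (shift F t) '' M (-1) := by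
  obtain ⟨c, k, hk, hMt⟩ := hom t ht (-1) (by norm_num)
  rw [homothety_eq_simil] at hMt
  obtain ⟨h1, hM1⟩ := hF (-1) (by norm_num)
  obtain ⟨h2, hM2⟩ := hF t ht
  have hV : ({F t .arc₁ 0, F t .arc₁ 1} : Set ℂ) =
      {simil k (c - k • c) (F (-1) .arc₁ 0), simil k (c - k • c) (F (-1) .arc₁ 1)} := by
    rw [← h2.singularPoints_eq, ← hM2, hMt, singularPoints_simil hk.ne', hM1,
      h1.singularPoints_eq, image_pair]
  obtain ⟨hs, hd⟩ := pair_sum_diff hV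
  have hne : 0 < ‖F (-1) .arc₁ 0 - F (-1) .arc₁ 1‖ := norm_pos_iff.2 (sub_ne_zero.2 h1.p_ne_q)
  have hkr : ratio F t = k := by
    rw [ratio, hd, simil_sub, norm_smul, Real.norm_of_nonneg hk.le]
    field_simp
  have hsh : shift F t = c - k • c := by
    rw [shift, hkr, hs]
    simp [simil]; ring
  rw [hkr, hsh]
  exact ⟨hk, hMt⟩

lemma differentiableAt_edge
    (hs : ∀ e, ContDiffOn ℝ ∞ (fun p : ℝ × ℝ => F p.1 e p.2) (Iio 0 ×ˢ e.dom)) {e : Edge} {x t : ℝ}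
    (hx : x ∈ e.dom) (ht : t < 0) : DifferentiableAt ℝ (fun s => F s e x) t := by
  have h1 : ContDiffOn ℝ ∞ (fun s => F s e x) (Iio 0) :=
    (hs e).comp (f := fun s => (s, x)) (by fun_prop) (fun s hs => ⟨hs, hx⟩)
  exact (h1.differentiableOn (by simp)).differentiableAt (Iio_mem_nhds ht)

lemma differentiableAt_ratio
    (hs : ∀ e, ContDiffOn ℝ ∞ (fun p : ℝ × ℝ => F p.1 e p.2) (Iio 0 ×ˢ e.dom))
    (hF : ∀ t < 0, IsGeneralizedLens (F t) ∧ M t = trace (F t)) {t : ℝ} (ht : t < 0) :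
    DifferentiableAt ℝ (ratio F) t ∧ DifferentiableAt ℝ (shift F) t := by
  have hp := differentiableAt_edge hs (e := .arc₁) (x := 0) (by simp [Edge.dom]) ht
  have hq := differentiableAt_edge hs (e := .arc₁) (x := 1) (by simp [Edge.dom]) ht
  have hr : DifferentiableAt ℝ (ratio F) t :=
    ((hp.sub hq).norm ℝ (sub_ne_zero.2 (hF t ht).1.p_ne_q)).div_const _
  refine ⟨hr, ?_⟩
  unfold shift
  fun_prop

/-- The normal velocity of a point of the network is the one of the family of homotheties. -/
lemma cross_velocity
    (hs : ∀ e, ContDiffOn ℝ ∞ (fun p : ℝ × ℝ => F p.1 e p.2) (Iio 0 ×ˢ e.dom))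
    (hF : ∀ t < 0, IsGeneralizedLens (F t) ∧ M t = trace (F t))
    (hom : IsHomotheticFamily M) {t : ℝ} (ht : t < 0) {z : ℂ} {e : Edge} {x : ℝ}
    (hx : x ∈ interior e.dom) (hz : F t e x = simil (ratio F t) (shift F t) z) :
    cross (deriv (F t e) x) (deriv (fun s => F s e x) t) =
      cross (deriv (F t e) x) (deriv (ratio F) t • z + deriv (shift F) t) := by
  obtain ⟨dr, ds⟩ := differentiableAt_ratio hs hF ht
  have dF := differentiableAt_edge hs (interior_subset hx) ht
  have hpos := (eq_simil_image hF hom ht).1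
  -- the motion seen by an observer who undoes the homotheties stays in the network at time `t`
  set m : ℝ → ℂ := fun s => ratio F t • ((ratio F s)⁻¹ • (F s e x - shift F s)) + shift F t with hm
  have hm' : HasDerivAt m (ratio F t • ((ratio F t)⁻¹ • (deriv (fun s => F s e x) t -
      deriv (shift F) t) + (-deriv (ratio F) t / ratio F t ^ 2) • (F t e x - shift F t))) t :=
    (((dr.hasDerivAt.inv hpos.ne').smul (dF.hasDerivAt.sub ds.hasDerivAt)).const_smul
      (ratio F t)).add_const _
  have hmem : ∀ s < 0, m s ∈ trace (F t) := by
    intro s hs0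
    obtain ⟨hps, hMs⟩ := eq_simil_image hF hom hs0
    have h1 : F s e x ∈ M s := by
      rw [(hF s hs0).2]; exact mem_trace (interior_subset hx)
    rw [hMs] at h1
    obtain ⟨w, hw, hwe⟩ := h1
    rw [← (hF t ht).2, (eq_simil_image hF hom ht).2]
    refine ⟨w, hw, ?_⟩
    rw [hm]
    simp only [← hwe, simil, add_sub_cancel_right]
    rw [inv_smul_smul₀ hps.ne']
  have hmt : m t = F t e x := by
    simp only [hm]
    rw [smul_inv_smul₀ hpos.ne', sub_add_cancel]
  have h0 := ((hF t ht).1.hasTangentLine hx).cross_eq_zero (S := Iio 0) hm'.hasDerivWithinAt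
    (isOpen_Iio.uniqueDiffWithinAt ht) hmt (eventually_nhdsWithin_of_forall hmem)
  have h2 : F t e x - shift F t = ratio F t • z := by rw [hz, simil, add_sub_cancel_right]
  rw [h2, smul_add, smul_inv_smul₀ hpos.ne', smul_smul, smul_smul, cross_add_right,
    cross_sub_right, cross_smul_right] at h0
  rw [cross_add_right, cross_smul_right]
  have h3 : ratio F t * (-deriv (ratio F) t / ratio F t ^ 2) * ratio F t = -deriv (ratio F) t := by
    field_simp
  rw [h3] at h0
  linarith

/-- In terms of the network at time `-1`, the curvature is the normal part of an affine vector
field whose coefficients depend on the chosen time. -/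
lemma cross_affine_eq
    (hs : ∀ e, ContDiffOn ℝ ∞ (fun p : ℝ × ℝ => F p.1 e p.2) (Iio 0 ×ˢ e.dom))
    (hF : ∀ t < 0, IsGeneralizedLens (F t) ∧ M t = trace (F t))
    (hev : ∀ t < 0, ∀ e, ∀ x ∈ interior (Edge.dom e),
      normalPart (deriv (F t e) x) (deriv (fun s => F s e x) t) = curvatureVector (F t e) x)
    (hom : IsHomotheticFamily M) {t : ℝ} (ht : t < 0) {e : Edge} {x : ℝ}
    (hx : x ∈ interior e.dom) :
    cross (deriv (F (-1) e) x) (deriv (deriv (F (-1) e)) x) =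
      dot (deriv (F (-1) e) x) (deriv (F (-1) e) x) *
        (ratio F t * cross (deriv (F (-1) e) x)
          (deriv (ratio F) t • F (-1) e x + deriv (shift F) t)) := by
  have h10 : (-1 : ℝ) < 0 := by norm_num
  obtain ⟨hk, hMt⟩ := eq_simil_image hF hom ht
  obtain ⟨g1, hM1⟩ := hF (-1) h10
  obtain ⟨gt, hMt'⟩ := hF t ht
  set z := F (-1) e x
  set τ := deriv (F (-1) e) x
  have hτ : τ ≠ 0 := g1.deriv_ne_zero hx
  have hzM : simil (ratio F t) (shift F t) z ∈ trace (F t) := by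
    rw [← hMt', hMt]
    exact mem_image_of_mem _ (hM1 ▸ mem_trace (interior_subset hx))
  obtain ⟨e', x', hx', hzx'⟩ := mem_iUnion.1 hzM
  have htan := (g1.hasTangentLine hx).simil hk.ne' (shift F t)
  have hcon := (g1.hasContact hx).simil hk.ne' (shift F t)
  rw [← hM1, ← hMt, hMt', ← hzx'] at htan hcon
  -- the image of a regular point is not a vertex
  have hi : x' ∈ interior e'.dom := by
    by_contra hni
    obtain ⟨v, σ, hv⟩ := isEnd_of_notMem_interior hx' hni
    rw [gt.eq_vertexPos hv] at htan
    exact hτ (gt.eq_zero_of_hasTangentLine htan)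
  have hτ' := gt.deriv_ne_zero hi
  have hpar : cross τ (deriv (F t e') x') = 0 :=
    htan.cross_eq_zero (S := univ) (gt.hasDerivAt hi).hasDerivWithinAt uniqueDiffWithinAt_univ rfl
      (by
        rw [nhdsWithin_univ]
        filter_upwards [isOpen_interior.mem_nhds hi] with y hy
        exact mem_trace (interior_subset hy))
  obtain ⟨r, hr⟩ : ∃ r : ℝ, deriv (F t e') x' = r • τ := by
    refine ⟨dot τ (deriv (F t e') x') / dot τ τ, ?_⟩
    have hd := dot_self_pos hτ
    have h1 := hpar
    simp only [cross] at h1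
    apply Complex.ext
    · simp only [Complex.smul_re, smul_eq_mul]
      field_simp
      simp only [dot]
      linear_combination -τ.im * h1
    · simp only [Complex.smul_im, smul_eq_mul]
      field_simp
      simp only [dot]
      linear_combination τ.re * h1
  have hr0 : r ≠ 0 := by rintro rfl; exact hτ' (by rw [hr, zero_smul])
  have hcon' := gt.hasContact hi
  have hcurv := hev t ht e' x' hi
  have hvel := cross_velocity hs hF hom ht hi hzx'
  have hk2 := (curvature_eq_iff hτ' _).1 hcurv.symm
  rw [hvel] at hk2
  have hd' := dot_self_pos hτ'
  rw [hk2, mul_div_cancel_left₀ _ hd'.ne', hr] at hcon'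
  have := nhdsWithin_sdiff_neBot (M := trace (F t)) (gt.hasDerivAt hi) hτ' (by
    filter_upwards [isOpen_interior.mem_nhds hi] with y hy
    exact mem_trace (interior_subset hy))
  have huniq := tendsto_nhds_unique hcon' (hcon.smul r)
  have hd := dot_self_pos hτ
  rw [cross_smul_left] at huniq
  field_simp at huniq
  change _ = cross τ _ / dot τ τ at huniq
  rw [eq_div_iff hd.ne'] at huniq
  linarith

/-- The coefficients of the affine vector field do not depend on time: the difference `V` of two such
fields is tangent to all edges, hence vanishes at the two vertices. -/
lemma ratio_mul_deriv
    (hs : ∀ e, ContDiffOn ℝ ∞ (fun p : ℝ × ℝ => F p.1 e p.2) (Iio 0 ×ˢ e.dom))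
    (hF : ∀ t < 0, IsGeneralizedLens (F t) ∧ M t = trace (F t))
    (hev : ∀ t < 0, ∀ e, ∀ x ∈ interior (Edge.dom e),
      normalPart (deriv (F t e) x) (deriv (fun s => F s e x) t) = curvatureVector (F t e) x)
    (hom : IsHomotheticFamily M) {t : ℝ} (ht : t < 0) :
    ratio F t * deriv (ratio F) t = ratio F (-1) * deriv (ratio F) (-1) ∧
      ratio F t • deriv (shift F) t = ratio F (-1) • deriv (shift F) (-1) := by
  have h10 : (-1 : ℝ) < 0 := by norm_num
  obtain ⟨g1, hM1⟩ := hF (-1) h10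
  set V : ℂ → ℂ := fun z => ratio F t • (deriv (ratio F) t • z + deriv (shift F) t) -
    ratio F (-1) • (deriv (ratio F) (-1) • z + deriv (shift F) (-1)) with hV
  have hVc : Continuous V := by fun_prop
  have hint : ∀ e, ∀ x ∈ interior (Edge.dom e),
      cross (derivWithin (F (-1) e) e.dom x) (V (F (-1) e x)) = 0 := by
    intro e x hx
    have h1 := cross_affine_eq hs hF hev hom ht hx
    have h2 := cross_affine_eq hs hF hev hom h10 hx
    rw [h1] at h2
    have h3 := mul_left_cancel₀ (dot_self_pos (g1.deriv_ne_zero hx)).ne' h2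
    rw [(derivWithin_eventuallyEq hx _).self_of_nhds, hV]
    simp only
    rw [cross_sub_right, cross_smul_right, cross_smul_right, h3, sub_self]
  have hall : ∀ e, ∀ x ∈ Edge.dom e,
      cross (derivWithin (F (-1) e) e.dom x) (V (F (-1) e x)) = 0 := by
    intro e
    have hc : ContinuousOn (fun x => cross (derivWithin (F (-1) e) e.dom x) (V (F (-1) e x)))
        e.dom :=
      continuousOn_cross (g1.contDiffOn_derivWithin e).continuousOn
        (hVc.comp_continuousOn (g1.smooth e).continuousOn)
    exact fun x hx => Set.EqOn.of_subset_closure (fun y hy => hint e y hy) hc continuousOn_const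
      interior_subset (dom_subset_closure e) hx
  have hVv : ∀ v, V (vertexPos (F (-1)) v) = 0 := by
    intro v
    refine g1.eq_zero_of_cross (v := v) fun e x σ hx => ?_
    rw [← g1.eq_vertexPos hx]
    exact hall e x hx.mem_dom
  have hp := hVv .p
  have hq := hVv .q
  simp only [vertexPos] at hp hq
  have hne := sub_ne_zero.2 g1.p_ne_q
  have hA : (ratio F t * deriv (ratio F) t - ratio F (-1) * deriv (ratio F) (-1)) •
      (F (-1) .arc₁ 0 - F (-1) .arc₁ 1) = 0 := by
    rw [← sub_self (0 : ℂ)]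
    nth_rw 1 [← hp]
    rw [← hq]
    simp only [hV, Complex.real_smul]
    push_cast
    ring
  have hA' := (smul_eq_zero.1 hA).resolve_right hne
  refine ⟨sub_eq_zero.1 hA', ?_⟩
  rw [← sub_eq_zero, ← hp]
  simp only [hV, Complex.real_smul]
  have : ((ratio F t * deriv (ratio F) t - ratio F (-1) * deriv (ratio F) (-1) : ℝ) : ℂ) = 0 := by
    rw [hA']; simp
  push_cast at this
  linear_combination -(F (-1) .arc₁ 0) * this

/-- The bounded part of a slice contains two different points, and the homotheties move both of them to
the origin. -/
lemma tendsto_of_shrinks (hF : ∀ t < 0, IsGeneralizedLens (F t) ∧ M t = trace (F t))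
    (hom : IsHomotheticFamily M) (hsh : ShrinksToOrigin M) :
    Tendsto (ratio F) (𝓝[<] 0) (𝓝 0) ∧ Tendsto (shift F) (𝓝[<] 0) (𝓝 0) := by
  have h10 : (-1 : ℝ) < 0 := by norm_num
  obtain ⟨t₀, ht₀, ht₀'⟩ : ∃ t₀, Metric.hausdorffEDist (boundedPart (M t₀)) {0} < ⊤ ∧ t₀ < 0 :=
    ((hsh.eventually (gt_mem_nhds ENNReal.zero_lt_top)).and self_mem_nhdsWithin).exists
  have hne : (boundedPart (M t₀)).Nonempty := by
    rw [nonempty_iff_ne_empty]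
    intro h
    rw [h, Metric.hausdorffEDist_comm, Metric.hausdorffEDist_empty (singleton_nonempty _)] at ht₀
    exact lt_irrefl _ ht₀
  have hne1 : (boundedPart (M (-1))).Nonempty := by
    obtain ⟨c, k, hk, hM⟩ := hom (-1) h10 t₀ ht₀'
    obtain ⟨z, hz⟩ := hne
    rw [homothety_eq_simil] at hM
    rw [hM]
    exact ⟨_, simil_mem_boundedPart hk.ne' _ hz⟩
  have hcl : IsClosed (M (-1)) := by
    rw [(hF _ h10).2]; exact (hF _ h10).1.isClosed_trace
  obtain ⟨z, hz, w, hw, hzw⟩ := exists_ne_mem_boundedPart hcl hne1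
  have key : ∀ y ∈ boundedPart (M (-1)),
      Tendsto (fun t => simil (ratio F t) (shift F t) y) (𝓝[<] 0) (𝓝 0) := by
    intro y hy
    rw [tendsto_iff_edist_tendsto_0]
    refine tendsto_of_tendsto_of_tendsto_of_le_of_le' tendsto_const_nhds hsh
      (Eventually.of_forall fun _ => zero_le) ?_
    filter_upwards [self_mem_nhdsWithin] with t ht
    obtain ⟨hk, hMt⟩ := eq_simil_image hF hom ht
    have := simil_mem_boundedPart hk.ne' (shift F t) hy
    rw [← hMt] at this
    have h2 := Metric.infEDist_le_hausdorffEDist_of_mem (t := {0}) this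
    rwa [Metric.infEDist_singleton] at h2
  have hd : Tendsto (fun t => ratio F t • (z - w)) (𝓝[<] 0) (𝓝 0) := by
    have := (key z hz).sub (key w hw)
    simp only [simil_sub, sub_self] at this
    exact this
  have hr : Tendsto (ratio F) (𝓝[<] 0) (𝓝 0) := by
    have h1 := hd.norm.div_const ‖z - w‖
    rw [norm_zero, zero_div] at h1
    refine h1.congr' ?_
    filter_upwards [self_mem_nhdsWithin] with t ht
    have hk := (eq_simil_image hF hom ht).1
    have : 0 < ‖z - w‖ := norm_pos_iff.2 (sub_ne_zero.2 hzw)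
    rw [norm_smul, Real.norm_of_nonneg hk.le]
    field_simp
  refine ⟨hr, ?_⟩
  have := (key z hz).sub (hr.smul_const z)
  simpa [simil] using this

/-- A homothetic solution whose bounded components shrink to the origin is given by the scaling
factor `√(-t)`, and its time `-1` slice is a self-shrinker. Indeed `ratio ^ 2` is affine in `t` and
`shift` is affine in `√(-t)`; both tend to `0` as `t` increases to `0`, which fixes the slopes `a`
and `b`. -/
theorem exists_static (hev : EvolvesByCurveShortening M) (hom : IsHomotheticFamily M)
    (hsh : ShrinksToOrigin M) :
    ∃ F : Edge → ℝ → ℂ, IsGeneralizedLens F ∧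
      (∀ e, IsShrinkerOn (Edge.dom e) (F e) (derivWithin (F e) e.dom)
        (derivWithin (derivWithin (F e) e.dom) e.dom)) ∧
      ∀ t < 0, M t = (fun z => Real.sqrt (-t) • z) '' trace F := by
  obtain ⟨F, hs, hF, hev⟩ := hev
  have h10 : (-1 : ℝ) < 0 := by norm_num
  obtain ⟨g1, hM1⟩ := hF (-1) h10
  have hconst := fun t (ht : t < 0) => ratio_mul_deriv hs hF hev hom ht
  obtain ⟨lr, ls⟩ := tendsto_of_shrinks hF hom hsh
  have hr1 : ratio F (-1) = 1 := div_self (norm_pos_iff.2 (sub_ne_zero.2 g1.p_ne_q)).ne'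
  have hs1 : shift F (-1) = 0 := by simp [shift, hr1]
  simp only [hr1, one_mul, one_smul] at hconst
  set a := deriv (ratio F) (-1)
  set b := deriv (shift F) (-1)
  have dsq : ∀ t ∈ Iio (0 : ℝ), HasDerivWithinAt (fun t => ratio F t ^ 2 - 2 * a * t) 0 (Iio 0) t := by
    intro t ht
    have h1 := (differentiableAt_ratio hs hF ht).1.hasDerivAt
    refine (((h1.pow 2).sub ((hasDerivAt_id t).const_mul (2 * a))).congr_deriv ?_).hasDerivWithinAt
    have := (hconst t ht).1
    simp
    linarith
  have hsq : ∀ t < 0, ratio F t ^ 2 = 1 + 2 * a * (t + 1) := by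
    intro t ht
    have := eq_of_hasDerivWithinAt_zero (convex_Iio 0) dsq ht h10
    rw [hr1] at this
    linarith
  have ha : a = -(1 / 2) := by
    have h1 : Tendsto (fun t : ℝ => 1 + 2 * a * (t + 1)) (𝓝[<] 0) (𝓝 0) := by
      have h2 := lr.pow 2
      rw [zero_pow two_ne_zero] at h2
      refine h2.congr' ?_
      filter_upwards [self_mem_nhdsWithin] with t ht using hsq t ht
    have h2 : Tendsto (fun t : ℝ => 1 + 2 * a * (t + 1)) (𝓝[<] 0) (𝓝 (1 + 2 * a * (0 + 1))) :=
      (Continuous.tendsto (by fun_prop) _).mono_left nhdsWithin_le_nhds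
    have := tendsto_nhds_unique h1 h2
    linarith
  have hr : ∀ t < 0, ratio F t = Real.sqrt (-t) := by
    intro t ht
    rw [← Real.sqrt_sq (eq_simil_image hF hom ht).1.le, hsq t ht, ha]
    congr 1
    ring
  have dsh : ∀ t ∈ Iio (0 : ℝ),
      HasDerivWithinAt (fun t => shift F t + (2 * Real.sqrt (-t)) • b) 0 (Iio 0) t := by
    intro t ht
    have ht' : (0 : ℝ) < -t := neg_pos.2 ht
    have h1 := (differentiableAt_ratio hs hF ht).2.hasDerivAt
    have h2 : HasDerivAt (fun t : ℝ => Real.sqrt (-t)) (-1 / (2 * Real.sqrt (-t))) t :=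
      (hasDerivAt_neg t).sqrt ht'.ne'
    refine ((h1.add ((h2.const_mul 2).smul_const b)).congr_deriv ?_).hasDerivWithinAt
    have h3 := (hconst t ht).2
    rw [hr t ht] at h3
    have hpos := Real.sqrt_pos.2 ht'
    rw [← h3, smul_smul]
    have : 2 * (-1 / (2 * Real.sqrt (-t))) * Real.sqrt (-t) = -1 := by field_simp
    rw [this]; simp
  have hsh' : ∀ t < 0, shift F t + (2 * Real.sqrt (-t)) • b = (2 : ℝ) • b := by
    intro t ht
    have := eq_of_hasDerivWithinAt_zero (convex_Iio 0) dsh ht h10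
    simpa [hs1] using this
  have hb : b = 0 := by
    have h1 : Tendsto (fun t : ℝ => shift F t + (2 * Real.sqrt (-t)) • b) (𝓝[<] 0)
        (𝓝 (0 + (2 * Real.sqrt (-0)) • b)) :=
      ls.add ((Continuous.tendsto (by fun_prop) _).mono_left nhdsWithin_le_nhds)
    have h2 : Tendsto (fun t : ℝ => shift F t + (2 * Real.sqrt (-t)) • b) (𝓝[<] 0)
        (𝓝 ((2 : ℝ) • b)) := by
      refine tendsto_const_nhds.congr' ?_
      filter_upwards [self_mem_nhdsWithin] with t ht using (hsh' t ht).symm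
    have := tendsto_nhds_unique h1 h2
    simpa using this.symm
  refine ⟨F (-1), g1, fun e => ⟨fun x hx => g1.hasDerivWithinAt hx,
    fun x hx => g1.hasDerivWithinAt₂ hx, ?_, fun x hx => g1.regular e x hx, ?_⟩, ?_⟩
  · exact ((contDiffOn_infty_iff_derivWithin (uniqueDiffOn_dom e)).1
      (g1.contDiffOn_derivWithin e)).2.continuousOn
  · have c0 := (g1.smooth e).continuousOn
    have c1 := (g1.contDiffOn_derivWithin e).continuousOn
    have c2 := ((contDiffOn_infty_iff_derivWithin (uniqueDiffOn_dom e)).1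
      (g1.contDiffOn_derivWithin e)).2.continuousOn
    refine fun x hx => Set.EqOn.of_subset_closure (fun y hy => ?_) (continuousOn_cross c1 c2)
      (((continuousOn_dot c1 c1).mul (continuousOn_cross c0 c1)).div_const 2)
      interior_subset (dom_subset_closure e) hx
    have := cross_affine_eq hs hF hev hom h10 hy
    change _ = dot (derivWithin (F (-1) e) e.dom y) (derivWithin (F (-1) e) e.dom y) *
      cross (F (-1) e y) (derivWithin (F (-1) e) e.dom y) / 2
    rw [deriv_deriv_eq hy, (derivWithin_eventuallyEq hy _).self_of_nhds, this, hr1]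
    change _ * (1 * cross _ (a • _ + b)) = _
    rw [hb, ha, add_zero, cross_smul_right, cross_comm (F (-1) e y)]
    ring
  · intro t ht
    have h1 := hsh' t ht
    rw [hb, smul_zero, smul_zero, add_zero] at h1
    rw [← hM1, (eq_simil_image hF hom ht).2, hr t ht, h1]
    exact image_congr fun z _ => add_zero _

end

end Network
namespace Network

/-! ### Rotated and rescaled networks -/

section
variable {F : Edge → ℝ → ℂ}

lemma derivWithin_mul_left (a : ℂ) (e : Edge) (x : ℝ) :
    derivWithin (fun x => a * F e x) e.dom x = a * derivWithin (F e) e.dom x :=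
  derivWithin_const_mul_field a

lemma infDist_halfLine_mul {a : ℂ} (ha : a ≠ 0) (b v z : ℂ) :
    Metric.infDist (a * z) (halfLine (a * b) (a * v)) = ‖a‖ * Metric.infDist z (halfLine b v) := by
  have hne : (halfLine b v).Nonempty := ⟨b, 0, le_rfl, by simp⟩
  have himg : halfLine (a * b) (a * v) = (fun z => a • z) '' halfLine b v := by
    ext w
    constructor
    · rintro ⟨s, hs, rfl⟩
      exact ⟨b + s • v, ⟨s, hs, rfl⟩, by simp; ring⟩
    · rintro ⟨_, ⟨s, hs, rfl⟩, rfl⟩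
      exact ⟨s, hs, by simp; ring⟩
  rw [himg, ← infDist_smul₀ ha]
  rfl

lemma IsGeneralizedLens.mul (hF : IsGeneralizedLens F) {a : ℂ} (ha : a ≠ 0) :
    IsGeneralizedLens fun e x => a * F e x where
  smooth e := contDiffOn_const.mul (hF.smooth e)
  regular e x hx := by
    rw [derivWithin_mul_left]
    exact mul_ne_zero ha (hF.regular e x hx)
  injective e x hx e' x' hx' := by
    rw [← hF.injective e x hx e' x' hx']
    exact mul_right_inj' ha
  angle v e x σ e' x' σ' h h' hne := by
    rw [derivWithin_mul_left, derivWithin_mul_left, ← mul_smul_comm, ← mul_smul_comm,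
      Complex.angle_mul_left ha]
    exact hF.angle v e x σ e' x' σ' h h' hne
  infinite e he := by
    simp only [norm_mul]
    exact (hF.infinite e he).const_mul_atTop (norm_pos_iff.2 ha)
  asymptotic e he := by
    obtain ⟨b, v, hv, h⟩ := hF.asymptotic e he
    refine ⟨a * b, a * v, mul_ne_zero ha hv, ?_⟩
    simp only [infDist_halfLine_mul ha]
    simpa using h.const_mul ‖a‖

lemma trace_mul (a : ℂ) : trace (fun e x => a * F e x) = (fun z => a * z) '' trace F := by
  simp only [trace, image_iUnion, image_image]

end

lemma normalPart_mul (a : Circle) (τ w : ℂ) :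
    normalPart (a * τ) (a * w) = a * normalPart τ w := by
  have h : inner ℝ ((a : ℂ) * τ) (a * w) = inner ℝ τ w :=
    (rotation a).inner_map_map τ w
  rw [normalPart, normalPart, h, norm_mul, Circle.norm_coe, one_mul, mul_sub, mul_smul_comm]

lemma EvolvesByCurveShortening.rotate {M : ℝ → Set ℂ} (h : EvolvesByCurveShortening M)
    (a : Circle) : EvolvesByCurveShortening fun t => rotation a '' M t := by
  obtain ⟨F, hs, hF, hev⟩ := h
  refine ⟨fun t e x => a * F t e x, fun e => contDiffOn_const.mul (hs e), fun t ht =>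
    ⟨(hF t ht).1.mul (Circle.coe_ne_zero a), ?_⟩, fun t ht e x hx => ?_⟩
  · change rotation a '' M t = _
    rw [(hF t ht).2]
    exact (trace_mul _).symm
  · have h1 : ∀ f : ℝ → ℂ, deriv (fun x => (a : ℂ) * f x) = fun x => a * deriv f x :=
      fun f => funext fun x => deriv_const_mul_field _
    simp only [curvatureVector, h1, normalPart_mul, norm_mul, Circle.norm_coe, one_mul]
    rw [hev t ht e x hx, curvatureVector, mul_smul_comm]

lemma IsHomotheticFamily.rotate {M : ℝ → Set ℂ} (h : IsHomotheticFamily M)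
    (a : Circle) : IsHomotheticFamily fun t => rotation a '' M t := by
  intro t₁ h₁ t₂ h₂
  obtain ⟨c, k, hk, h3⟩ := h t₁ h₁ t₂ h₂
  refine ⟨a * c, k, hk, ?_⟩
  simp only [h3, image_image]
  refine image_congr fun z _ => ?_
  simp [AffineMap.homothety_apply]
  ring

/-! ### Self-similarly shrinking families -/

/-- The family of networks which shrinks towards the origin, with the time `-1` slice `M` and the
extinction time `0`. -/
def shrinking (M : Set ℂ) (t : ℝ) : Set ℂ := (fun z => Real.sqrt (-t) • z) '' M

lemma shrinking_neg_one (M : Set ℂ) : shrinking M (-1) = M := by simp [shrinking]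

lemma rotation_image_shrinking (a : Circle) (M : Set ℂ) (t : ℝ) :
    rotation a '' shrinking M t = shrinking (rotation a '' M) t := by
  simp only [shrinking, image_image]
  refine image_congr fun z _ => ?_
  simp only [rotation_apply, mul_smul_comm]

lemma shrinking_eq_trace (F : Edge → ℝ → ℂ) (t : ℝ) :
    shrinking (trace F) t = trace fun e x => (Real.sqrt (-t) : ℂ) * F e x := by
  rw [trace_mul]; rfl

lemma IsGeneralizedLens.shrinking {F : Edge → ℝ → ℂ} (hF : IsGeneralizedLens F) {t : ℝ}
    (ht : t < 0) : IsGeneralizedLens fun e x => (Real.sqrt (-t) : ℂ) * F e x :=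
  hF.mul (by exact_mod_cast (Real.sqrt_pos.2 (neg_pos.2 ht)).ne')

lemma isHomotheticFamily_shrinking (M : Set ℂ) : IsHomotheticFamily (shrinking M) := by
  intro t₁ h₁ t₂ h₂
  have p₁ := Real.sqrt_pos.2 (neg_pos.2 h₁)
  have p₂ := Real.sqrt_pos.2 (neg_pos.2 h₂)
  refine ⟨0, Real.sqrt (-t₁) / Real.sqrt (-t₂), div_pos p₁ p₂, ?_⟩
  rw [shrinking, shrinking, image_image]
  refine image_congr fun z _ => ?_
  simp only [AffineMap.homothety_apply, vsub_eq_sub, sub_zero, vadd_eq_add, add_zero, smul_smul]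
  rw [div_mul_cancel₀ _ p₂.ne']

/-- A network of shrinking curves, rescaled by `√(-t)`, solves the curve shortening flow: its velocity
is `-1 / (2 * √(-t))` times the position vector of the unscaled network. -/
lemma evolvesByCurveShortening_shrinking {F : Edge → ℝ → ℂ} (hF : IsGeneralizedLens F)
    (hS : ∀ e, ∃ c₁ c₂, IsShrinkerOn e.dom (F e) c₁ c₂) :
    EvolvesByCurveShortening (shrinking (trace F)) := by
  refine ⟨fun t e x => (Real.sqrt (-t) : ℂ) * F e x, fun e => ?_,
    fun t ht => ⟨hF.shrinking ht, shrinking_eq_trace F t⟩, fun t ht e x hx => ?_⟩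
  · refine ContDiffOn.mul ?_ ((hF.smooth e).comp contDiff_snd.contDiffOn fun p hp => hp.2)
    refine (Complex.ofRealCLM.contDiff (n := ∞)).comp_contDiffOn ?_
    exact contDiff_fst.neg.contDiffOn.sqrt fun p hp => (neg_pos.2 hp.1).ne'
  · have ht' : 0 < -t := neg_pos.2 ht
    set k := Real.sqrt (-t) with hk
    have hkpos : 0 < k := Real.sqrt_pos.2 ht'
    obtain ⟨c₁, c₂, h⟩ := hS e
    have hD : ∀ y ∈ interior e.dom, HasDerivAt (F e) (c₁ y) y := fun y hy =>
      (h.hasDeriv y (interior_subset hy)).hasDerivAt (mem_interior_iff_mem_nhds.1 hy)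
    have hd1 : deriv (F e) =ᶠ[𝓝 x] c₁ := by
      filter_upwards [isOpen_interior.mem_nhds hx] with y hy using (hD y hy).deriv
    have hd2 : deriv (deriv (F e)) x = c₂ x := by
      rw [hd1.deriv_eq]
      exact ((h.hasDeriv₂ x (interior_subset hx)).hasDerivAt
        (mem_interior_iff_mem_nhds.1 hx)).deriv
    have h1 : ∀ f : ℝ → ℂ, deriv (fun x => (k : ℂ) * f x) = fun x => k * deriv f x :=
      fun f => funext fun x => deriv_const_mul_field _
    have hv : deriv (fun s => (Real.sqrt (-s) : ℂ) * F e x) t = (-1 / (2 * k)) • F e x := by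
      have h2 : HasDerivAt (fun t : ℝ => Real.sqrt (-t)) (-1 / (2 * Real.sqrt (-t))) t :=
        (hasDerivAt_neg t).sqrt ht'.ne'
      rw [(h2.ofReal_comp.mul_const (F e x)).deriv]; rfl
    rw [hv, eq_comm, curvature_eq_iff, h1, h1]
    · simp only [hd2, hd1.self_of_nhds, ← Complex.real_smul, cross_smul_right, cross_smul_left, dot_smul_left,
        dot_smul_right, h.eq x (interior_subset hx)]
      rw [cross_comm (F e x)]
      field_simp
    · rw [h1]
      simp only [hd1.self_of_nhds]
      exact mul_ne_zero (by exact_mod_cast hkpos.ne') (h.ne_zero x (interior_subset hx))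

lemma boundedPart_shrinking (M : Set ℂ) {t : ℝ} (ht : t < 0) :
    boundedPart (shrinking M t) = shrinking (boundedPart M) t := by
  have hk : Real.sqrt (-t) ≠ 0 := (Real.sqrt_pos.2 (neg_pos.2 ht)).ne'
  have hs : ∀ S : Set ℂ, shrinking S t = simil (Real.sqrt (-t)) 0 '' S := fun S =>
    image_congr fun z _ => (add_zero _).symm
  rw [hs, hs]
  apply Subset.antisymm
  · intro z hz
    have h1 := simil_mem_boundedPart (inv_ne_zero hk) (-((Real.sqrt (-t))⁻¹ • (0 : ℂ))) hz
    rw [simil_image_inv hk] at h1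
    exact ⟨_, h1, simil_inv' hk 0 z⟩
  · rintro _ ⟨z, hz, rfl⟩
    exact simil_mem_boundedPart hk 0 hz

lemma tendsto_sqrt_neg : Tendsto (fun t : ℝ => Real.sqrt (-t)) (𝓝[<] 0) (𝓝 0) :=
  ((by fun_prop : Continuous fun t : ℝ => Real.sqrt (-t)).tendsto' 0 0 (by simp)).mono_left
    nhdsWithin_le_nhds

lemma shrinksToOrigin_shrinking {M : Set ℂ} (hne : (boundedPart M).Nonempty) {R : ℝ}
    (hR : ∀ z ∈ boundedPart M, ‖z‖ ≤ R) : ShrinksToOrigin (shrinking M) := by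
  obtain ⟨z₀, hz₀⟩ := hne
  have hlim : Tendsto (fun t : ℝ => ENNReal.ofReal (Real.sqrt (-t) * R)) (𝓝[<] 0) (𝓝 0) := by
    have := ENNReal.tendsto_ofReal (tendsto_sqrt_neg.mul_const R)
    simpa using this
  refine tendsto_of_tendsto_of_tendsto_of_le_of_le' tendsto_const_nhds hlim
    (Eventually.of_forall fun _ => zero_le) ?_
  filter_upwards [self_mem_nhdsWithin] with t ht
  rw [boundedPart_shrinking M ht]
  have key : ∀ z ∈ boundedPart M, edist (Real.sqrt (-t) • z) 0 ≤
      ENNReal.ofReal (Real.sqrt (-t) * R) := by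
    intro z hz
    rw [edist_dist, dist_zero_right, norm_smul, Real.norm_of_nonneg (Real.sqrt_nonneg _)]
    exact ENNReal.ofReal_le_ofReal (mul_le_mul_of_nonneg_left (hR z hz) (Real.sqrt_nonneg _))
  refine Metric.hausdorffEDist_le_of_mem_edist ?_ ?_
  · rintro _ ⟨z, hz, rfl⟩
    exact ⟨0, rfl, key z hz⟩
  · rintro _ rfl
    exact ⟨_, ⟨z₀, hz₀, rfl⟩, by rw [edist_comm]; exact key z₀ hz₀⟩

end Network
namespace Network

/-! ### Phases at the vertices -/

/-- A phase with `cos α = ± sin (beta B)` is one where tangent and position vector enclose `60°` or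
`120°`. -/
lemma orbY_of_cos {B : ℝ} (hB : 0 < B) (h3 : 1 ≤ 3 * B ^ 2) {α s : ℝ} (hs : s ^ 2 = 1)
    (h : Real.cos α = s * Real.sin (beta B)) : orbY B α = s / Real.sqrt 3 := by
  have hsin := sin_beta hB h3
  have hpos : 0 < Real.sin (beta B) := by rw [hsin]; positivity
  have hq : 4 * B ^ 2 * Real.sin (beta B) ^ 2 = 1 + B ^ 2 := by
    rw [hsin, div_pow, Real.sq_sqrt (by positivity)]; field_simp; norm_num
  have hw : Real.sqrt (1 + (B * Real.sin α) ^ 2) = Real.sqrt 3 * (B * Real.sin (beta B)) := by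
    rw [Real.sqrt_eq_iff_mul_self_eq (by positivity) (by positivity)]
    have h1 := Real.sin_sq_add_cos_sq α
    rw [h, mul_pow, hs, one_mul] at h1
    have h2 := Real.mul_self_sqrt (show (0 : ℝ) ≤ 3 by norm_num)
    linear_combination B ^ 2 * h1 - (B * Real.sin (beta B)) ^ 2 * h2 - hq
  have h3' : (0 : ℝ) < Real.sqrt 3 := by positivity
  rw [orbY, hw, h]
  field_simp

lemma cos_of_orbY {B : ℝ} (hB : 0 < B) {α s : ℝ} (hs : s ^ 2 = 1)
    (h : orbY B α = s / Real.sqrt 3) :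
    1 ≤ 3 * B ^ 2 ∧ Real.cos α = s * Real.sin (beta B) := by
  have h3' : (0 : ℝ) < Real.sqrt 3 := by positivity
  have h3s := Real.mul_self_sqrt (show (0 : ℝ) ≤ 3 by norm_num)
  have hw := Real.mul_self_sqrt (show 0 ≤ 1 + (B * Real.sin α) ^ 2 by positivity)
  have hwpos : 0 < Real.sqrt (1 + (B * Real.sin α) ^ 2) := by positivity
  rw [orbY, div_eq_div_iff hwpos.ne' h3'.ne'] at h
  set w := Real.sqrt (1 + (B * Real.sin α) ^ 2)
  have h1 := Real.sin_sq_add_cos_sq α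
  have hq : 4 * B ^ 2 * Real.cos α ^ 2 = 1 + B ^ 2 := by
    have : (B * Real.cos α * Real.sqrt 3) ^ 2 = (s * w) ^ 2 := by rw [h]
    linear_combination this - B ^ 2 * Real.cos α ^ 2 * h3s + w ^ 2 * hs + hw + B ^ 2 * h1
  have h3 : 1 ≤ 3 * B ^ 2 := by nlinarith [Real.cos_sq_le_one α, sq_nonneg B]
  refine ⟨h3, ?_⟩
  have hsin := sin_beta hB h3
  have hpos : 0 < Real.sin (beta B) := by rw [hsin]; positivity
  have hq' : 4 * B ^ 2 * Real.sin (beta B) ^ 2 = 1 + B ^ 2 := by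
    rw [hsin, div_pow, Real.sq_sqrt (by positivity)]; field_simp; norm_num
  have hsc : 0 < s * Real.cos α := by
    have : 0 < s * (B * Real.cos α * Real.sqrt 3) := by
      rw [h, ← mul_assoc, ← pow_two, hs, one_mul]; exact hwpos
    have h5 : 0 < B * Real.sqrt 3 := by positivity
    refine pos_of_mul_pos_left (b := B * Real.sqrt 3) ?_ h5.le
    linarith
  have : s * Real.cos α = Real.sin (beta B) := by
    rw [← sq_eq_sq₀ hsc.le hpos.le, mul_pow, hs]
    have h5 : (4 * B ^ 2) ≠ 0 := by positivity
    apply mul_left_cancel₀ h5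
    linear_combination hq - hq'
  rw [← this, ← mul_assoc, ← pow_two, hs, one_mul]

lemma ang_neg_sub_beta (B : ℝ) : ang B (-(Real.pi / 2) - beta B) = -halfShort B := by
  rw [halfShort, ← ang_reflect]; congr 1; ring

lemma ang_add_beta (B : ℝ) : ang B (3 * Real.pi / 2 + beta B) = period B + halfShort B := by
  rw [halfShort, add_comm (period B), ← ang_add_two_pi]; congr 1; ring

section fish

/-! ### The fish-shaped network -/

/-- The polar angle on the edges of the fish-shaped network of level `B`: the short arc passes
through the angles between `-halfShort B` and `halfShort B`, the long one through the other
angles. -/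
noncomputable def fishTheta (B : ℝ) : Edge → ℝ → ℝ
  | .arc₁, x => -halfShort B + 2 * halfShort B * x
  | .arc₂, x => 2 * Real.pi - halfShort B + -(2 * Real.pi - 2 * halfShort B) * x
  | .ray₁, _ => -halfShort B
  | .ray₂, _ => halfShort B

/-- The logarithm of half the squared distance to the origin on the edges of the fish-shaped
network of level `B`. -/
noncomputable def fishX (B : ℝ) : Edge → ℝ → ℝ
  | .arc₁, x => orbX B (phase B (fishTheta B .arc₁ x))
  | .arc₂, x => orbX B (phase B (-(2 * halfShort B) + fishTheta B .arc₂ x))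
  | .ray₁, x => orbX B (-(Real.pi / 2) + beta B) + x
  | .ray₂, x => orbX B (-(Real.pi / 2) + beta B) + x

/-- The fish-shaped network of level `B`; it closes up if `fishAngle B = 2 * π`. The half-lines are
parametrized exponentially. -/
noncomputable def fish (B : ℝ) (e : Edge) (x : ℝ) : ℂ := polar (fishX B e x) (fishTheta B e x)

/-- The logarithmic derivative of the parametrizations of the fish-shaped network. -/
noncomputable def fishD (B : ℝ) : Edge → ℝ → ℂ
  | .arc₁, x => (2 * halfShort B : ℝ) *
      (orbY B (phase B (fishTheta B .arc₁ x)) + Complex.I)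
  | .arc₂, x => (-(2 * Real.pi - 2 * halfShort B) : ℝ) *
      (orbY B (phase B (-(2 * halfShort B) + fishTheta B .arc₂ x)) + Complex.I)
  | .ray₁, _ => 1 / 2
  | .ray₂, _ => 1 / 2

variable {B : ℝ}

lemma hasDerivAt_polar_left (X θ x : ℝ) :
    HasDerivAt (fun x => polar (X + x) θ) (1 / 2 * polar (X + x) θ) x := by
  have h1 : HasDerivAt (fun x : ℝ => (((X + x) / 2 : ℝ) : ℂ) + θ * Complex.I) (1 / 2) x := by
    have := ((((hasDerivAt_id x).const_add X).div_const 2).ofReal_comp).add_const (θ * Complex.I)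
    exact this.congr_deriv (by push_cast; rfl)
  refine (h1.cexp.const_mul (Real.sqrt 2 : ℂ)).congr_deriv ?_
  rw [polar]; ring

lemma contDiff_polar {f g : ℝ → ℝ} (hf : ContDiff ℝ ∞ f) (hg : ContDiff ℝ ∞ g) :
    ContDiff ℝ ∞ fun x => polar (f x) (g x) := by
  have h1 : ContDiff ℝ ∞ fun x => ((f x / 2 : ℝ) : ℂ) :=
    Complex.ofRealCLM.contDiff.comp (hf.div_const 2)
  have h2 : ContDiff ℝ ∞ fun x => (g x : ℂ) := Complex.ofRealCLM.contDiff.comp hg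
  exact contDiff_const.mul (h1.add (h2.mul contDiff_const)).cexp

lemma contDiff_fish (B : ℝ) (e : Edge) : ContDiff ℝ ∞ (fish B e) := by
  have h1 := (isOrbit_orb B).contDiff.1
  have h2 := (isOrbit_shift (isOrbit_orb B) (-(2 * halfShort B))).contDiff.1
  cases e <;> refine contDiff_polar ?_ ?_
  · exact h1.comp (g := fun θ => orbX B (phase B θ)) (by unfold fishTheta; fun_prop)
  · unfold fishTheta; fun_prop
  · exact h2.comp (g := fun θ => orbX B (phase B (-(2 * halfShort B) + θ)))
      (by unfold fishTheta; fun_prop)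
  · unfold fishTheta; fun_prop
  · unfold fishX; fun_prop
  · unfold fishTheta; fun_prop
  · unfold fishX; fun_prop
  · unfold fishTheta; fun_prop

lemma hasDerivAt_fish (B : ℝ) (e : Edge) (x : ℝ) :
    HasDerivAt (fish B e) (fishD B e x * fish B e x) x := by
  have hl : ∀ a m x : ℝ, HasDerivAt (fun x : ℝ => a + m * x) m x := fun a m x => by
    simpa using ((hasDerivAt_id x).const_mul m).const_add a
  cases e
  · have := (hasDerivAt_polar (isOrbit_orb B) (fishTheta B .arc₁ x)).scomp x
      (hl (-halfShort B) (2 * halfShort B) x)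
    refine this.congr_deriv ?_
    rw [Complex.real_smul, ← mul_assoc]; rfl
  · have := (hasDerivAt_polar (isOrbit_shift (isOrbit_orb B) (-(2 * halfShort B)))
      (fishTheta B .arc₂ x)).scomp x
      (hl (2 * Real.pi - halfShort B) (-(2 * Real.pi - 2 * halfShort B)) x)
    refine this.congr_deriv ?_
    rw [Complex.real_smul, ← mul_assoc]; rfl
  · exact hasDerivAt_polar_left _ _ x
  · exact hasDerivAt_polar_left _ _ x

lemma derivWithin_fish (B : ℝ) {e : Edge} {x : ℝ} (hx : x ∈ e.dom) :
    derivWithin (fish B e) e.dom x = fishD B e x * fish B e x :=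
  (hasDerivAt_fish B e x).hasDerivWithinAt.derivWithin (uniqueDiffOn_dom e x hx)

lemma halfShort_lt (hB : 0 < B) (hf : fishAngle B = 2 * Real.pi) : 4 * halfShort B < Real.pi := by
  have := pi_lt_period hB.le
  unfold fishAngle at hf
  linarith

lemma isShrinkerOn_fish (hB : 0 < B) (hf : fishAngle B = 2 * Real.pi) (e : Edge) :
    ∃ c₁ c₂, IsShrinkerOn e.dom (fish B e) c₁ c₂ := by
  have hδ := halfShort_pos hB
  have hδ' := halfShort_lt hB hf
  have hπ := Real.pi_pos
  have ray : ∀ X θ : ℝ, IsShrinkerOn (Ici 0) (fun x => polar (X + x) θ)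
      (fun x => 1 / 2 * polar (X + x) θ) (fun x => 1 / 2 * (1 / 2 * polar (X + x) θ)) := by
    intro X θ
    refine ⟨fun x _ => (hasDerivAt_polar_left X θ x).hasDerivWithinAt,
      fun x _ => ((hasDerivAt_polar_left X θ x).const_mul _).hasDerivWithinAt, ?_,
      fun x _ => mul_ne_zero (by norm_num) (polar_ne_zero _ _), fun x _ => ?_⟩
    · unfold polar; fun_prop
    · have h : ∀ z : ℂ, 1 / 2 * z = (1 / 2 : ℝ) • z := fun z => by simp
      simp only [h, cross_smul_right, cross_self, mul_zero, zero_div]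
  cases e
  · exact ⟨_, _, (isOrbit_orb B).isShrinkerOn (by linarith) _ _⟩
  · refine ⟨_, _, (isOrbit_shift (isOrbit_orb B) (-(2 * halfShort B))).isShrinkerOn ?_ _ _⟩
    linarith
  · exact ⟨_, _, ray _ _⟩
  · exact ⟨_, _, ray _ _⟩

/-! ### Vertices of the fish-shaped network -/

lemma phase_halfShort (B : ℝ) : phase B (halfShort B) = -(Real.pi / 2) + beta B := by
  rw [halfShort, phase_ang]

lemma phase_neg_halfShort (B : ℝ) : phase B (-halfShort B) = -(Real.pi / 2) - beta B := by
  rw [← ang_neg_sub_beta, phase_ang]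

lemma phase_long (hf : fishAngle B = 2 * Real.pi) :
    phase B (2 * Real.pi - 3 * halfShort B) = 3 * Real.pi / 2 + beta B := by
  have : 2 * Real.pi - 3 * halfShort B = ang B (3 * Real.pi / 2 + beta B) := by
    rw [ang_add_beta, ← hf, fishAngle]; ring
  rw [this, phase_ang]

lemma orbX_congr {α α' : ℝ} (h : Real.sin α = Real.sin α') : orbX B α = orbX B α' := by
  rw [orbX, orbX, h]

lemma sin_neg_sub_beta (B : ℝ) :
    Real.sin (-(Real.pi / 2) - beta B) = Real.sin (-(Real.pi / 2) + beta B) := by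
  rw [← Real.sin_pi_sub, ← Real.sin_sub_two_pi]; congr 1; ring

lemma sin_long (B : ℝ) :
    Real.sin (3 * Real.pi / 2 + beta B) = Real.sin (-(Real.pi / 2) + beta B) := by
  rw [← Real.sin_sub_two_pi]; congr 1; ring

lemma orbY_neg_add_beta (hB : 0 < B) (h3 : 1 ≤ 3 * B ^ 2) :
    orbY B (-(Real.pi / 2) + beta B) = 1 / Real.sqrt 3 := by
  refine orbY_of_cos hB h3 (by norm_num) ?_
  rw [← Real.cos_neg, neg_add, neg_neg, ← sub_eq_add_neg, Real.cos_pi_div_two_sub, one_mul]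

lemma orbY_neg_sub_beta (hB : 0 < B) (h3 : 1 ≤ 3 * B ^ 2) :
    orbY B (-(Real.pi / 2) - beta B) = -1 / Real.sqrt 3 := by
  refine orbY_of_cos hB h3 (by norm_num) ?_
  rw [← Real.cos_neg, neg_sub, sub_neg_eq_add, Real.cos_add_pi_div_two]
  ring

lemma orbY_long (hB : 0 < B) (h3 : 1 ≤ 3 * B ^ 2) :
    orbY B (3 * Real.pi / 2 + beta B) = 1 / Real.sqrt 3 := by
  rw [← orbY_neg_add_beta hB h3, orbY, orbY, sin_long]
  congr 2
  rw [← Real.cos_sub_two_pi]; congr 1; ring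

/-- The logarithm of half the squared distance of the vertices to the origin. -/
noncomputable def vertexX (B : ℝ) : ℝ := orbX B (-(Real.pi / 2) + beta B)

lemma fish_end (hf : fishAngle B = 2 * Real.pi) {v : Vertex} {e : Edge} {x σ : ℝ}
    (h : IsEnd v e x σ) : fish B e x = vertexPos (fish B) v := by
  have h1 : fish B .arc₁ 0 = polar (vertexX B) (-halfShort B) := by
    simp only [fish, fishX, fishTheta, mul_zero, add_zero, phase_neg_halfShort, vertexX]
    rw [orbX_congr (sin_neg_sub_beta B)]
  have h2 : fish B .arc₁ 1 = polar (vertexX B) (halfShort B) := by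
    simp only [fish, fishX, fishTheta, mul_one, vertexX]
    rw [show -halfShort B + 2 * halfShort B = halfShort B by ring, phase_halfShort]
  cases h
  · rfl
  · change _ = fish B .arc₁ 0
    rw [h1]
    simp only [fish, fishX, fishTheta, mul_zero, add_zero, vertexX]
    rw [show -(2 * halfShort B) + (2 * Real.pi - halfShort B) = 2 * Real.pi - 3 * halfShort B by
      ring, phase_long hf, orbX_congr (sin_long B), polar_eq_polar_iff]
    exact ⟨rfl, 1, by push_cast; ring⟩
  · change _ = fish B .arc₁ 0
    rw [h1, fish, fishX, add_zero]; rfl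
  · rfl
  · change _ = fish B .arc₁ 1
    rw [h2]
    simp only [fish, fishX, fishTheta, mul_one, vertexX]
    rw [show 2 * Real.pi - halfShort B + -(2 * Real.pi - 2 * halfShort B) = halfShort B by ring,
      show -(2 * halfShort B) + halfShort B = -halfShort B by ring, phase_neg_halfShort,
      orbX_congr (sin_neg_sub_beta B)]
  · change _ = fish B .arc₁ 1
    rw [h2, fish, fishX, add_zero]; rfl

/-- The directions in which the edges leave the vertices, as multiples of the position vector. -/
noncomputable def fishDir : Vertex → Edge → ℂ
  | .p, .arc₁ => ⟨-1 / Real.sqrt 3, 1⟩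
  | .p, .arc₂ => ⟨-1 / Real.sqrt 3, -1⟩
  | .q, .arc₁ => ⟨-1 / Real.sqrt 3, -1⟩
  | .q, .arc₂ => ⟨-1 / Real.sqrt 3, 1⟩
  | _, _ => 1

/-- At the ends of the arcs the cotangent is `1 / √3` in absolute value, and the signs are such that the
edges leave the vertices in the directions `fishDir`. -/
lemma fishD_end (hB : 0 < B) (h3 : 1 ≤ 3 * B ^ 2) (hf : fishAngle B = 2 * Real.pi) {v : Vertex}
    {e : Edge} {x σ : ℝ} (h : IsEnd v e x σ) :
    ∃ r : ℝ, 0 < r ∧ σ • fishD B e x = r • fishDir v e := by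
  have hδ := halfShort_pos hB
  have hδ' := halfShort_lt hB hf
  have hπ := Real.pi_pos
  cases h
  · refine ⟨2 * halfShort B, by positivity, ?_⟩
    simp only [fishD, fishTheta, mul_zero, add_zero, phase_neg_halfShort, orbY_neg_sub_beta hB h3]
    simp only [fishDir]
    apply Complex.ext <;> simp
  · refine ⟨2 * Real.pi - 2 * halfShort B, by linarith, ?_⟩
    simp only [fishD, fishTheta, mul_zero, add_zero]
    rw [show -(2 * halfShort B) + (2 * Real.pi - halfShort B) = 2 * Real.pi - 3 * halfShort B by
      ring, phase_long hf, orbY_long hB h3]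
    simp only [fishDir]
    generalize Real.sqrt 3 = s
    apply Complex.ext <;> simp
    ring
  · exact ⟨1 / 2, by norm_num, by simp [fishD, fishDir]⟩
  · refine ⟨2 * halfShort B, by positivity, ?_⟩
    simp only [fishD, fishTheta, mul_one]
    rw [show -halfShort B + 2 * halfShort B = halfShort B by ring, phase_halfShort,
      orbY_neg_add_beta hB h3]
    simp only [fishDir]
    generalize Real.sqrt 3 = s
    apply Complex.ext <;> simp
    ring
  · refine ⟨2 * Real.pi - 2 * halfShort B, by linarith, ?_⟩
    simp only [fishD, fishTheta, mul_one]
    rw [show 2 * Real.pi - halfShort B + -(2 * Real.pi - 2 * halfShort B) = halfShort B by ring,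
      show -(2 * halfShort B) + halfShort B = -halfShort B by ring, phase_neg_halfShort,
      orbY_neg_sub_beta hB h3]
    simp only [fishDir]
    generalize Real.sqrt 3 = s
    apply Complex.ext <;> simp
    ring
  · exact ⟨1 / 2, by norm_num, by simp [fishD, fishDir]⟩

lemma angle_of_dot {u v : ℂ} (hu : u ≠ 0) (hv : v ≠ 0) (h : dot u v = -(1 / 2) * (‖u‖ * ‖v‖)) :
    InnerProductGeometry.angle u v = 2 * Real.pi / 3 := by
  have : 0 < ‖u‖ * ‖v‖ := mul_pos (norm_pos_iff.2 hu) (norm_pos_iff.2 hv)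
  have hc : Real.cos (2 * Real.pi / 3) = -(1 / 2) := by
    rw [show 2 * Real.pi / 3 = Real.pi - Real.pi / 3 by ring, Real.cos_pi_sub,
      Real.cos_pi_div_three]
  rw [InnerProductGeometry.angle, inner_eq_dot, h, mul_div_cancel_right₀ _ this.ne', ← hc,
    Real.arccos_cos (by positivity) (by linarith [Real.pi_pos])]

lemma angle_fishDir {v : Vertex} {e e' : Edge} {x x' σ σ' : ℝ} (h : IsEnd v e x σ)
    (h' : IsEnd v e' x' σ') (hne : e ≠ e') :
    InnerProductGeometry.angle (fishDir v e) (fishDir v e') = 2 * Real.pi / 3 := by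
  have hs : (Real.sqrt 3)⁻¹ ^ 2 = 1 / 3 := by rw [inv_pow, Real.sq_sqrt (by norm_num)]; norm_num
  have hn : ∀ s : ℝ, s ^ 2 = 1 → ‖(⟨-1 / Real.sqrt 3, s⟩ : ℂ)‖ = 2 * (Real.sqrt 3)⁻¹ := by
    intro s h1
    rw [← sq_eq_sq₀ (norm_nonneg _) (by positivity), ← dot_self]
    simp only [dot]
    linear_combination -3 * hs + h1
  have h0 : ∀ s : ℝ, s ^ 2 = 1 → (⟨-1 / Real.sqrt 3, s⟩ : ℂ) ≠ 0 := fun s h1 h2 => by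
    have := congrArg Complex.im h2
    simp only [Complex.zero_im] at this
    rw [this] at h1; norm_num at h1
  have a1 : ∀ s : ℝ, s ^ 2 = 1 →
      InnerProductGeometry.angle (⟨-1 / Real.sqrt 3, s⟩ : ℂ) 1 = 2 * Real.pi / 3 := by
    intro s h1
    refine angle_of_dot (h0 s h1) one_ne_zero ?_
    rw [hn s h1]; simp [dot]; ring
  have a2 : ∀ s : ℝ, s ^ 2 = 1 → InnerProductGeometry.angle (⟨-1 / Real.sqrt 3, s⟩ : ℂ)
      ⟨-1 / Real.sqrt 3, -s⟩ = 2 * Real.pi / 3 := by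
    intro s h1
    refine angle_of_dot (h0 s h1) (h0 _ (by rw [neg_sq, h1])) ?_
    rw [hn s h1, hn _ (by rw [neg_sq, h1])]; simp only [dot]
    linear_combination 3 * hs - h1
  have a1p := a1 1 (by norm_num)
  have a1m := a1 (-1) (by norm_num)
  have b1p := (InnerProductGeometry.angle_comm _ _).trans a1p
  have b1m := (InnerProductGeometry.angle_comm _ _).trans a1m
  have c1 := a2 1 (by norm_num)
  have c2 := (InnerProductGeometry.angle_comm _ _).trans c1
  cases h <;> cases h' <;> first
    | exact absurd rfl hne
    | simp only [fishDir, a1p, a1m, b1p, b1m, c1, c2]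

/-! ### Embeddedness of the fish-shaped network -/

lemma fishX_end (hf : fishAngle B = 2 * Real.pi) {v : Vertex} {e : Edge} {x σ : ℝ}
    (h : IsEnd v e x σ) : fishX B e x = vertexX B := by
  have key : ∀ {e' : Edge}, fish B e x = fish B e' 0 → fishX B e x = fishX B e' 0 := fun h =>
    (polar_eq_polar_iff.1 (by exact h)).1
  cases v
  · exact (key ((fish_end hf h).trans (fish_end hf .ray₁_p).symm)).trans (add_zero _)
  · exact (key ((fish_end hf h).trans (fish_end hf .ray₂_q).symm)).trans (add_zero _)

lemma fishTheta_mem (hB : 0 < B) (hf : fishAngle B = 2 * Real.pi) {e : Edge} {x : ℝ}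
    (hx : x ∈ e.dom) :
    -halfShort B ≤ fishTheta B e x ∧ fishTheta B e x ≤ 2 * Real.pi - halfShort B := by
  have hδ := halfShort_pos hB
  have hδ' := halfShort_lt hB hf
  have hπ := Real.pi_pos
  cases e <;> simp only [fishTheta, Edge.dom, mem_Icc, mem_Ici] at hx ⊢
  · constructor <;> nlinarith
  · constructor <;> nlinarith
  · constructor <;> linarith
  · constructor <;> linarith

lemma samePoint_symm {e e' : Edge} {x x' : ℝ} (h : SamePoint e x e' x') :
    SamePoint e' x' e x := by
  rcases h with ⟨rfl, rfl⟩ | ⟨v, σ, σ', h, h'⟩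
  · exact Or.inl ⟨rfl, rfl⟩
  · exact Or.inr ⟨v, σ', σ, h', h⟩

/-- The largest polar angle and the smallest one differ by `2 * π`; both belong to the vertex `p` and its
half-line. The values of `fishX` are needed only if a half-line is involved. -/
lemma samePoint_of_fishTheta_add (hB : 0 < B) (hf : fishAngle B = 2 * Real.pi) {e e' : Edge}
    {x x' : ℝ} (hx : x ∈ e.dom) (hx' : x' ∈ e'.dom)
    (hX : (e = .ray₁ ∨ e = .ray₂ ∨ e' = .ray₁ ∨ e' = .ray₂) → fishX B e x = fishX B e' x')
    (hθ : fishTheta B e x = 2 * Real.pi - halfShort B) (hθ' : fishTheta B e' x' = -halfShort B) :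
    SamePoint e x e' x' := by
  have hδ := halfShort_pos hB
  have hδ' := halfShort_lt hB hf
  have hπ := Real.pi_pos
  cases e <;> simp only [fishTheta, Edge.dom, mem_Icc, mem_Ici] at hx hθ
  · nlinarith
  · have : x = 0 := by
      have h : (2 * Real.pi - 2 * halfShort B) * x = 0 := by linarith
      exact (mul_eq_zero.1 h).resolve_left (by linarith)
    subst this
    cases e' <;> simp only [fishTheta, Edge.dom, mem_Icc, mem_Ici] at hx' hθ'
    · have : x' = 0 := by
        have h : halfShort B * x' = 0 := by linarith
        exact (mul_eq_zero.1 h).resolve_left (by linarith)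
      subst this
      exact Or.inr ⟨_, _, _, .arc₂_p, .arc₁_p⟩
    · nlinarith
    · have hX := hX (by simp)
      rw [fishX_end hf .arc₂_p, fishX, vertexX, left_eq_add] at hX
      subst hX
      exact Or.inr ⟨_, _, _, .arc₂_p, .ray₁_p⟩
    · linarith
  · linarith
  · linarith

/-- The short arc and the long arc cover complementary ranges of polar angles, which meet only at the
vertices. The values of `fishX` are needed only if a half-line is involved. -/
lemma samePoint_of_fishTheta_eq (hB : 0 < B) (hf : fishAngle B = 2 * Real.pi) {e e' : Edge}
    {x x' : ℝ} (hx : x ∈ e.dom) (hx' : x' ∈ e'.dom)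
    (hX : (e = .ray₁ ∨ e = .ray₂ ∨ e' = .ray₁ ∨ e' = .ray₂) → fishX B e x = fishX B e' x')
    (hθ : fishTheta B e x = fishTheta B e' x') : SamePoint e x e' x' := by
  have hδ := halfShort_pos hB
  have hδ' := halfShort_lt hB hf
  have hπ := Real.pi_pos
  have z₁ : ∀ {x : ℝ}, halfShort B * x = 0 → x = 0 := fun h =>
    (mul_eq_zero.1 h).resolve_left hδ.ne'
  have z₂ : ∀ {x : ℝ}, (Real.pi - halfShort B) * x = 0 → x = 0 := fun h =>
    (mul_eq_zero.1 h).resolve_left (by linarith)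
  have arcs : ∀ {x x' : ℝ}, x ∈ Icc (0 : ℝ) 1 → x' ∈ Icc (0 : ℝ) 1 →
      fishTheta B .arc₁ x = fishTheta B .arc₂ x' → SamePoint .arc₁ x .arc₂ x' := by
    intro x x' hx hx' h
    simp only [fishTheta] at h
    have a1 : 0 ≤ (Real.pi - halfShort B) * (1 - x') :=
      mul_nonneg (by linarith) (by linarith [hx'.2])
    have a2 : 0 ≤ halfShort B * (1 - x) := mul_nonneg hδ.le (by linarith [hx.2])
    have b1 : x = 1 := by linarith [z₁ (x := 1 - x) (by linarith)]
    have b2 : x' = 1 := by linarith [z₂ (x := 1 - x') (by linarith)]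
    subst b1 b2
    exact Or.inr ⟨_, _, _, .arc₁_q, .arc₂_q⟩
  have rays₁ : ∀ {x x' : ℝ}, fishX B .arc₁ x = fishX B .ray₁ x' →
      fishTheta B .arc₁ x = fishTheta B .ray₁ x' → SamePoint .arc₁ x .ray₁ x' := by
    intro x x' hX h
    simp only [fishTheta] at h
    have b1 : x = 0 := z₁ (by linarith)
    subst b1
    rw [fishX_end hf .arc₁_p, fishX, vertexX, left_eq_add] at hX
    subst hX
    exact Or.inr ⟨_, _, _, .arc₁_p, .ray₁_p⟩
  have rays₂ : ∀ {x x' : ℝ}, fishX B .arc₁ x = fishX B .ray₂ x' →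
      fishTheta B .arc₁ x = fishTheta B .ray₂ x' → SamePoint .arc₁ x .ray₂ x' := by
    intro x x' hX h
    simp only [fishTheta] at h
    have b1 : x = 1 := by linarith [z₁ (x := 1 - x) (by linarith)]
    subst b1
    rw [fishX_end hf .arc₁_q, fishX, vertexX, left_eq_add] at hX
    subst hX
    exact Or.inr ⟨_, _, _, .arc₁_q, .ray₂_q⟩
  have rays₃ : ∀ {x x' : ℝ}, fishX B .arc₂ x = fishX B .ray₂ x' →
      fishTheta B .arc₂ x = fishTheta B .ray₂ x' → SamePoint .arc₂ x .ray₂ x' := by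
    intro x x' hX h
    simp only [fishTheta] at h
    have b1 : x = 1 := by linarith [z₂ (x := 1 - x) (by linarith)]
    subst b1
    rw [fishX_end hf .arc₂_q, fishX, vertexX, left_eq_add] at hX
    subst hX
    exact Or.inr ⟨_, _, _, .arc₂_q, .ray₂_q⟩
  have rays₄ : ∀ {x x' : ℝ}, x ∈ Icc (0 : ℝ) 1 →
      fishTheta B .arc₂ x ≠ fishTheta B .ray₁ x' := by
    intro x x' hx h
    simp only [fishTheta] at h
    have a1 : 0 ≤ (Real.pi - halfShort B) * (1 - x) :=
      mul_nonneg (by linarith) (by linarith [hx.2])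
    linarith
  cases e <;> cases e'
  · simp only [fishTheta] at hθ
    exact Or.inl ⟨rfl, by linarith [z₁ (x := x - x') (by linarith)]⟩
  · exact arcs hx hx' hθ
  · exact rays₁ (hX (by simp)) hθ
  · exact rays₂ (hX (by simp)) hθ
  · exact samePoint_symm (arcs hx' hx hθ.symm)
  · simp only [fishTheta] at hθ
    exact Or.inl ⟨rfl, by linarith [z₂ (x := x - x') (by linarith)]⟩
  · exact absurd hθ (rays₄ hx)
  · exact rays₃ (hX (by simp)) hθ
  · exact samePoint_symm (rays₁ (hX (by simp)).symm hθ.symm)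
  · exact absurd hθ.symm (rays₄ hx')
  · exact Or.inl ⟨rfl, add_left_cancel (hX (by simp))⟩
  · simp only [fishTheta] at hθ
    linarith
  · exact samePoint_symm (rays₂ (hX (by simp)).symm hθ.symm)
  · exact samePoint_symm (rays₃ (hX (by simp)).symm hθ.symm)
  · simp only [fishTheta] at hθ
    linarith
  · exact Or.inl ⟨rfl, add_left_cancel (hX (by simp))⟩

lemma samePoint_of_fish_eq (hB : 0 < B) (hf : fishAngle B = 2 * Real.pi) {e e' : Edge} {x x' : ℝ}
    (hx : x ∈ e.dom) (hx' : x' ∈ e'.dom) (h : fish B e x = fish B e' x') :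
    SamePoint e x e' x' := by
  have hπ := Real.pi_pos
  obtain ⟨hX, n, hn⟩ := polar_eq_polar_iff.1 h
  have h1 := fishTheta_mem hB hf hx
  have h2 := fishTheta_mem hB hf hx'
  have hn1 : n < 2 := by
    by_contra! h3
    have : (2 : ℝ) ≤ n := by exact_mod_cast h3
    nlinarith
  have hn2 : -2 < n := by
    by_contra! h3
    have : (n : ℝ) ≤ -2 := by exact_mod_cast h3
    nlinarith
  obtain rfl | rfl | rfl : n = -1 ∨ n = 0 ∨ n = 1 := by omega
  · push_cast at hn
    exact samePoint_symm (samePoint_of_fishTheta_add hB hf hx' hx (fun _ => hX.symm) (by linarith)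
      (by linarith))
  · exact samePoint_of_fishTheta_eq hB hf hx hx' (fun _ => hX) (by simpa using hn)
  · push_cast at hn
    exact samePoint_of_fishTheta_add hB hf hx hx' (fun _ => hX) (by linarith) (by linarith)

lemma isGeneralizedLens_fish (hB : 0 < B) (h3 : 1 ≤ 3 * B ^ 2) (hf : fishAngle B = 2 * Real.pi) :
    IsGeneralizedLens (fish B) where
  smooth e := (contDiff_fish B e).contDiffOn
  regular e x hx := by
    obtain ⟨c₁, c₂, h⟩ := isShrinkerOn_fish hB hf e
    rw [(h.hasDeriv x hx).derivWithin (uniqueDiffOn_dom e x hx)]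
    exact h.ne_zero x hx
  injective e x hx e' x' hx' := by
    refine ⟨samePoint_of_fish_eq hB hf hx hx', ?_⟩
    rintro (⟨rfl, rfl⟩ | ⟨v, σ, σ', h, h'⟩)
    · rfl
    · rw [fish_end hf h, fish_end hf h']
  angle v e x σ e' x' σ' h h' hne := by
    obtain ⟨r, hr, h1⟩ := fishD_end hB h3 hf h
    obtain ⟨r', hr', h1'⟩ := fishD_end hB h3 hf h'
    rw [derivWithin_fish B h.mem_dom, derivWithin_fish B h'.mem_dom, fish_end hf h,
      fish_end hf h', ← smul_mul_assoc, ← smul_mul_assoc, h1, h1']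
    have hv : vertexPos (fish B) v ≠ 0 := by cases v <;> exact polar_ne_zero _ _
    rw [Complex.angle_mul_right hv, InnerProductGeometry.angle_smul_left_of_pos _ _ hr,
      InnerProductGeometry.angle_smul_right_of_pos _ _ hr']
    exact angle_fishDir h h' hne
  infinite e he := by
    have h : ∀ X θ : ℝ, Tendsto (fun x => ‖polar (X + x) θ‖) atTop atTop := by
      intro X θ
      simp only [norm_polar]
      refine Tendsto.const_mul_atTop (by positivity) (Real.tendsto_exp_atTop.comp ?_)
      exact (tendsto_atTop_add_const_left _ X tendsto_id).atTop_div_const two_pos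
    rcases he with rfl | rfl <;> exact h _ _
  asymptotic e he := by
    have h : ∀ X θ : ℝ, ∃ a v : ℂ, v ≠ 0 ∧
        Tendsto (fun x => Metric.infDist (polar (X + x) θ) (halfLine a v)) atTop (𝓝 0) := by
      intro X θ
      refine ⟨polar X θ, polar X θ, polar_ne_zero _ _, tendsto_const_nhds.congr' ?_⟩
      filter_upwards [eventually_ge_atTop 0] with x hx
      have hmem : polar (X + x) θ ∈ halfLine (polar X θ) (polar X θ) := by
        refine ⟨Real.exp (x / 2) - 1, ?_, ?_⟩
        · linarith [Real.one_le_exp (show 0 ≤ x / 2 by positivity)]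
        · rw [polar_eq, polar_eq, add_div, Real.exp_add]; module
      exact (Metric.infDist_zero_of_mem hmem).symm
    rcases he with rfl | rfl <;> exact h _ _

end fish
end Network
namespace Network

lemma polar_re (X θ : ℝ) : (polar X θ).re = Real.sqrt 2 * Real.exp (X / 2) * Real.cos θ := by
  rw [polar_eq, Complex.smul_re, Complex.exp_ofReal_mul_I_re, smul_eq_mul]

lemma polar_im (X θ : ℝ) : (polar X θ).im = Real.sqrt 2 * Real.exp (X / 2) * Real.sin θ := by
  rw [polar_eq, Complex.smul_im, Complex.exp_ofReal_mul_I_im, smul_eq_mul]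

lemma polar_add_left (X x θ : ℝ) : polar (X + x) θ = Real.exp (x / 2) • polar X θ := by
  rw [polar_eq, polar_eq, add_div, Real.exp_add, smul_smul]; congr 1; ring

lemma smul_polar {k : ℝ} (hk : 0 < k) (X θ : ℝ) : k • polar X θ = polar (X + 2 * Real.log k) θ := by
  rw [polar_add_left, mul_div_cancel_left₀ _ two_ne_zero, Real.exp_log hk]

lemma mem_halfLine_self {w z : ℂ} : z ∈ halfLine w w ↔ ∃ k : ℝ, 1 ≤ k ∧ z = k • w := by
  constructor
  · rintro ⟨s, hs, rfl⟩
    exact ⟨1 + s, by linarith, by module⟩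
  · rintro ⟨k, hk, rfl⟩
    exact ⟨k - 1, by linarith, by module⟩

lemma image_polar_ray (X θ : ℝ) :
    (fun x => polar (X + x) θ) '' Ici 0 = halfLine (polar X θ) (polar X θ) := by
  ext z
  rw [mem_halfLine_self]
  constructor
  · rintro ⟨x, hx, rfl⟩
    exact ⟨_, Real.one_le_exp (div_nonneg hx two_pos.le), polar_add_left X x θ⟩
  · rintro ⟨k, hk, rfl⟩
    exact ⟨2 * Real.log k, mul_nonneg two_pos.le (Real.log_nonneg hk),
      (smul_polar (one_pos.trans_le hk) X θ).symm⟩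

section fish
variable {B : ℝ}

/-! ### The bounded component of the fish-shaped network -/

/-- The union of the two arcs of the fish-shaped network. -/
noncomputable def fishLoop (B : ℝ) : Set ℂ := fish B .arc₁ '' Icc 0 1 ∪ fish B .arc₂ '' Icc 0 1

lemma exists_of_mem_fishLoop {w : ℂ} (h : w ∈ fishLoop B) :
    ∃ e x, (e = .arc₁ ∨ e = .arc₂) ∧ x ∈ Edge.dom e ∧ fish B e x = w := by
  rcases h with ⟨x, hx, rfl⟩ | ⟨x, hx, rfl⟩
  · exact ⟨.arc₁, x, by simp, hx, rfl⟩
  · exact ⟨.arc₂, x, by simp, hx, rfl⟩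

lemma isCompact_fishLoop (B : ℝ) : IsCompact (fishLoop B) :=
  (isCompact_Icc.image (contDiff_fish B _).continuous).union
    (isCompact_Icc.image (contDiff_fish B _).continuous)

lemma fishLoop_subset_trace (B : ℝ) : fishLoop B ⊆ trace (fish B) := by
  intro w hw
  obtain ⟨e, x, _, hx, rfl⟩ := exists_of_mem_fishLoop hw
  exact mem_trace hx

lemma zero_notMem_trace_fish (B : ℝ) : (0 : ℂ) ∉ trace (fish B) := by
  intro h
  obtain ⟨e, x, _, hx⟩ := mem_iUnion.1 h
  exact polar_ne_zero _ _ hx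

/-- The loop of the fish-shaped network meets every half-line issuing from the origin. -/
lemma exists_mem_fishLoop_smul (hB : 0 < B) (hf : fishAngle B = 2 * Real.pi) {z : ℂ}
    (hz : z ≠ 0) : ∃ k : ℝ, 0 < k ∧ ∃ w ∈ fishLoop B, z = k • w := by
  have hδ := halfShort_pos hB
  have hδ' := halfShort_lt hB hf
  have hπ := Real.pi_pos
  have key : ∀ (X : ℝ) (e : Edge) (x : ℝ), (e = .arc₁ ∨ e = .arc₂) → x ∈ Icc (0 : ℝ) 1 →
      ∃ k : ℝ, 0 < k ∧ ∃ w ∈ fishLoop B, polar X (fishTheta B e x) = k • w := by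
    intro X e x he hx
    refine ⟨Real.exp ((X - fishX B e x) / 2), Real.exp_pos _, fish B e x, ?_, ?_⟩
    · rcases he with rfl | rfl
      · exact Or.inl ⟨x, hx, rfl⟩
      · exact Or.inr ⟨x, hx, rfl⟩
    · rw [fish, ← polar_add_left]; congr 1; ring
  set X := Real.log (dot z z / 2)
  set θ := toIcoMod Real.two_pi_pos (-halfShort B) z.arg
  have hθ : θ ∈ Ico (-halfShort B) (-halfShort B + 2 * Real.pi) := toIcoMod_mem_Ico _ _ _
  have hz' : z = polar X θ := by
    rw [exists_polar hz, polar_eq_polar_iff]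
    refine ⟨rfl, toIcoDiv Real.two_pi_pos (-halfShort B) z.arg, ?_⟩
    have := toIcoMod_add_toIcoDiv_zsmul Real.two_pi_pos (-halfShort B) z.arg
    rw [zsmul_eq_mul] at this
    exact this.symm
  rw [hz']
  rcases le_total θ (halfShort B) with h | h
  · have : θ = fishTheta B .arc₁ ((θ + halfShort B) / (2 * halfShort B)) := by
      simp only [fishTheta]; field_simp; ring
    rw [this]
    refine key X .arc₁ _ (Or.inl rfl) ⟨div_nonneg (by linarith [hθ.1]) (by linarith), ?_⟩
    rw [div_le_one (by linarith)]; linarith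
  · have h2 : 0 < 2 * Real.pi - 2 * halfShort B := by linarith
    have : θ = fishTheta B .arc₂
        ((2 * Real.pi - halfShort B - θ) / (2 * Real.pi - 2 * halfShort B)) := by
      simp only [fishTheta]
      rw [neg_mul, mul_div_cancel₀ _ h2.ne']; ring
    rw [this]
    refine key X .arc₂ _ (Or.inr rfl) ⟨div_nonneg (by linarith [hθ.2]) h2.le, ?_⟩
    rw [div_le_one h2]; linarith

/-- The loop of the fish-shaped network is star-shaped about the origin. -/
lemma eq_of_mem_fishLoop_smul (hB : 0 < B) (hf : fishAngle B = 2 * Real.pi) {k : ℝ} (hk : 0 < k)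
    {w : ℂ} (hw : w ∈ fishLoop B) (hkw : k • w ∈ fishLoop B) : k • w = w := by
  have hπ := Real.pi_pos
  obtain ⟨e, x, he, hx, rfl⟩ := exists_of_mem_fishLoop hw
  obtain ⟨e', x', he', hx', h⟩ := exists_of_mem_fishLoop hkw
  have hpol : fish B e' x' = polar (fishX B e x + 2 * Real.log k) (fishTheta B e x) := by
    rw [h, fish, smul_polar hk]
  rw [← h]
  obtain ⟨-, n, hn⟩ := polar_eq_polar_iff.1 (by exact hpol)
  have hX : ¬ (e = .ray₁ ∨ e = .ray₂ ∨ e' = .ray₁ ∨ e' = .ray₂) := by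
    rcases he with rfl | rfl <;> rcases he' with rfl | rfl <;> simp
  have hX' : ¬ (e' = .ray₁ ∨ e' = .ray₂ ∨ e = .ray₁ ∨ e = .ray₂) := by
    rcases he with rfl | rfl <;> rcases he' with rfl | rfl <;> simp
  have h1 := fishTheta_mem hB hf hx
  have h2 := fishTheta_mem hB hf hx'
  have hn1 : n < 2 := by
    by_contra! h3
    have : (2 : ℝ) ≤ n := by exact_mod_cast h3
    nlinarith
  have hn2 : -2 < n := by
    by_contra! h3
    have : (n : ℝ) ≤ -2 := by exact_mod_cast h3
    nlinarith
  have hS : SamePoint e x e' x' := by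
    obtain rfl | rfl | rfl : n = -1 ∨ n = 0 ∨ n = 1 := by omega
    · push_cast at hn
      exact samePoint_of_fishTheta_add hB hf hx hx' (fun h => absurd h hX) (by linarith)
        (by linarith)
    · exact samePoint_of_fishTheta_eq hB hf hx hx' (fun h => absurd h hX)
        (by simpa using hn.symm)
    · push_cast at hn
      exact samePoint_symm (samePoint_of_fishTheta_add hB hf hx' hx (fun h => absurd h hX')
        (by linarith) (by linarith))
  rcases hS with ⟨rfl, rfl⟩ | ⟨v, σ, σ', h, h'⟩
  · rfl
  · rw [fish_end hf h, fish_end hf h']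

/-- The loop is star-shaped about the origin, so that it separates the origin from infinity. -/
lemma zero_mem_boundedPart_fish (hB : 0 < B) (hf : fishAngle B = 2 * Real.pi) :
    (0 : ℂ) ∈ boundedPart (trace (fish B)) := by
  refine ⟨zero_notMem_trace_fish B, ?_⟩
  obtain ⟨R, hR⟩ := (isCompact_fishLoop B).isBounded.exists_norm_le
  refine (isBounded_iff_forall_norm_le.2 ⟨R, fun z hz => ?_⟩)
  by_contra! hzR
  have hclosed := (isCompact_fishLoop B).isClosed
  -- the closed sets of the points on or inside the loop and on or outside of it, which cover the plane
  -- and have only the loop in common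
  set A₁ : Set ℂ := (fun p : ℝ × ℂ => p.1 • p.2) '' (Icc 0 1 ×ˢ fishLoop B)
  set A₂ : Set ℂ := Prod.snd '' {p : Icc (0 : ℝ) 1 × ℂ | (p.1 : ℝ) • p.2 ∈ fishLoop B}
  have c₁ : IsClosed A₁ :=
    ((isCompact_Icc.prod (isCompact_fishLoop B)).image (by fun_prop)).isClosed
  have c₂ : IsClosed A₂ := isClosedMap_snd_of_compactSpace _
    (hclosed.preimage (f := fun p : Icc (0 : ℝ) 1 × ℂ => (p.1 : ℝ) • p.2) (by fun_prop))
  have m₁ : ∀ y ∈ A₁, ‖y‖ ≤ R := by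
    rintro _ ⟨⟨s, w⟩, ⟨hs, hw⟩, rfl⟩
    simp only [norm_smul, Real.norm_of_nonneg hs.1]
    exact (mul_le_of_le_one_left (norm_nonneg _) hs.2).trans (hR w hw)
  have z₁ : (0 : ℂ) ∈ A₁ := by
    refine ⟨⟨0, fish B .arc₁ 0⟩, ⟨⟨le_rfl, zero_le_one⟩, Or.inl ⟨0, by simp, rfl⟩⟩, by simp⟩
  have cover : ∀ y, y ∈ A₁ ∪ A₂ := by
    intro y
    rcases eq_or_ne y 0 with rfl | hy
    · exact Or.inl z₁
    · obtain ⟨k, hk, w, hw, rfl⟩ := exists_mem_fishLoop_smul hB hf hy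
      rcases le_total k 1 with h | h
      · exact Or.inl ⟨⟨k, w⟩, ⟨⟨hk.le, h⟩, hw⟩, rfl⟩
      · refine Or.inr ⟨⟨⟨k⁻¹, inv_nonneg.2 hk.le, inv_le_one_of_one_le₀ h⟩, k • w⟩, ?_, rfl⟩
        change k⁻¹ • k • w ∈ fishLoop B
        rwa [smul_smul, inv_mul_cancel₀ hk.ne', one_smul]
  obtain ⟨y, hyC, hy₁, hy₂⟩ := isPreconnected_closed_iff.1
    (isPreconnected_connectedComponentIn (x := (0 : ℂ)) (F := (trace (fish B))ᶜ)) A₁ A₂ c₁ c₂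
    (fun y _ => cover y)
    ⟨0, mem_connectedComponentIn (zero_notMem_trace_fish B), z₁⟩
    ⟨z, hz, (cover z).resolve_left fun h => (m₁ z h).not_gt hzR⟩
  obtain ⟨⟨s, w⟩, ⟨hs, hw⟩, rfl⟩ := hy₁
  obtain ⟨⟨⟨s', hs'⟩, y⟩, hw', hy⟩ := hy₂
  simp only at hy
  subst hy
  change s' • s • w ∈ fishLoop B at hw'
  rw [smul_smul] at hw'
  have hne : ∀ u ∈ fishLoop B, u ≠ 0 := by
    rintro u hu rfl
    exact zero_notMem_trace_fish B (fishLoop_subset_trace B hu)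
  have hss : s' * s ≠ 0 := fun h => hne _ hw' (by rw [h, zero_smul])
  have hpos : 0 < s' * s := lt_of_le_of_ne (mul_nonneg hs'.1 hs.1) hss.symm
  have heq := eq_of_mem_fishLoop_smul hB hf hpos hw hw'
  have h1 : s' * s = 1 := smul_left_injective ℝ (hne w hw) (by simpa using heq)
  have h2 : s = 1 := le_antisymm hs.2 (by
    simp only at hs
    nlinarith [mul_nonneg (sub_nonneg.2 hs'.2) hs.1])
  refine connectedComponentIn_subset _ _ hyC (fishLoop_subset_trace B ?_)
  simpa [h2] using hw

/-- A point outside a large disc escapes to infinity in the radial direction without meeting the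
network, since the half-lines of the network are radial. -/
lemma norm_le_of_mem_boundedPart_fish :
    ∃ R, ∀ z ∈ boundedPart (trace (fish B)), ‖z‖ ≤ R := by
  obtain ⟨R, hR⟩ := (isCompact_fishLoop B).isBounded.exists_norm_le
  refine ⟨max R (‖polar (vertexX B) 0‖), fun z hz => ?_⟩
  by_contra! hzR
  obtain ⟨h1, h2⟩ := max_lt_iff.1 hzR
  have hz0 : 0 < ‖z‖ := (norm_nonneg _).trans_lt h2
  have hray : ∀ (s x θ : ℝ), 1 ≤ s → s • z = polar (vertexX B + x) θ →
      z ∈ (fun x => polar (vertexX B + x) θ) '' Ici 0 := by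
    intro s x θ hs h
    have hs0 : 0 < s := one_pos.trans_le hs
    have hz' : z = polar (vertexX B + (x + 2 * Real.log s⁻¹)) θ := by
      rw [← add_assoc, ← smul_polar (inv_pos.2 hs0), ← h, smul_smul, inv_mul_cancel₀ hs0.ne',
        one_smul]
    refine ⟨_, ?_, hz'.symm⟩
    rw [hz', norm_polar, norm_polar] at h2
    have h3 := Real.exp_lt_exp.1 ((mul_lt_mul_iff_right₀ (by positivity)).1 h2)
    simp only [mem_Ici]
    linarith
  have hsub : (fun s : ℝ => s • z) '' Ici 1 ⊆ (trace (fish B))ᶜ := by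
    rintro _ ⟨s, hs, rfl⟩ hmem
    have hs' : (1 : ℝ) ≤ s := hs
    obtain ⟨e, x, hx, hxe⟩ := mem_iUnion.1 hmem
    have hloop : s • z ∉ fishLoop B := fun h => by
      have := hR _ h
      rw [norm_smul, Real.norm_of_nonneg (by linarith)] at this
      nlinarith
    cases e
    · exact hloop (Or.inl ⟨x, hx, hxe⟩)
    · exact hloop (Or.inr ⟨x, hx, hxe⟩)
    · obtain ⟨x', hx', h'⟩ := hray s x _ hs' hxe.symm
      exact hz.1 (mem_iUnion.2 ⟨.ray₁, x', hx', h'⟩)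
    · obtain ⟨x', hx', h'⟩ := hray s x _ hs' hxe.symm
      exact hz.1 (mem_iUnion.2 ⟨.ray₂, x', hx', h'⟩)
  have hconn : IsPreconnected ((fun s : ℝ => s • z) '' Ici 1) :=
    isPreconnected_Ici.image _ (by fun_prop)
  have hcomp := hconn.subset_connectedComponentIn ⟨1, by simp, one_smul _ _⟩ hsub
  obtain ⟨K, hK⟩ := isBounded_iff_forall_norm_le.1 (hz.2.subset hcomp)
  have := hK _ ⟨max 1 ((K + 1) / ‖z‖), mem_Ici.2 (le_max_left _ _), rfl⟩
  rw [norm_smul, Real.norm_of_nonneg (by positivity)] at this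
  have h3 : K + 1 ≤ max 1 ((K + 1) / ‖z‖) * ‖z‖ := (div_le_iff₀ hz0).1 (le_max_right _ _)
  linarith

/-! ### The half-lines of the fish-shaped network -/

lemma cross_polar (X X' θ θ' : ℝ) : cross (polar X θ) (polar X' θ') =
    Real.sqrt 2 * Real.exp (X / 2) * (Real.sqrt 2 * Real.exp (X' / 2)) * Real.sin (θ' - θ) := by
  simp only [cross, polar_re, polar_im, Real.sin_sub]; ring

lemma cross_fish_rays_pos (hB : 0 < B) (hf : fishAngle B = 2 * Real.pi) (X X' : ℝ) :
    0 < cross (polar X (-halfShort B)) (polar X' (halfShort B)) := by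
  have hδ := halfShort_pos hB
  have hδ' := halfShort_lt hB hf
  rw [cross_polar]
  have : 0 < Real.sin (halfShort B - -halfShort B) :=
    Real.sin_pos_of_pos_of_lt_pi (by linarith) (by linarith)
  positivity

lemma cross_circle_mul (a : Circle) (z w : ℂ) : cross (a * z) (a * w) = cross z w := by
  have h : (a : ℂ).re * (a : ℂ).re + (a : ℂ).im * (a : ℂ).im = 1 := by
    rw [← Complex.normSq_apply, Complex.normSq_eq_norm_sq, Circle.norm_coe, one_pow]
  simp only [cross, Complex.mul_re, Complex.mul_im]
  linear_combination (z.re * w.im - z.im * w.re) * h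

/-- Outside a disc a symmetric lens is contained in the first coordinate axis. -/
lemma IsSymmetricLens.eventually_real {N : Set ℂ} (h : IsSymmetricLens N) :
    ∃ R, ∀ z ∈ N, R < ‖z‖ → z.im = 0 := by
  obtain ⟨γ, hγ, -, -, -, -, -, -, -, -, rfl⟩ := h
  obtain ⟨R, hR⟩ := (isCompact_Icc.image_of_continuousOn hγ.continuousOn).isBounded.exists_norm_le
  refine ⟨R, ?_⟩
  rintro z (((⟨x, hx, rfl⟩ | ⟨x, hx, rfl⟩) | h) | h) hz
  · exact absurd (hR _ ⟨x, hx, rfl⟩) hz.not_ge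
  · have := hR _ ⟨x, hx, rfl⟩
    rw [Complex.norm_conj] at hz
    exact absurd this hz.not_ge
  · exact h.1
  · exact h.1

/-- The half-lines of a symmetric lens are parallel, those of the fish-shaped network are not. -/
lemma not_isSymmetricLens_fish (hB : 0 < B) (h3 : 1 ≤ 3 * B ^ 2) (hf : fishAngle B = 2 * Real.pi)
    (a : Circle) : ¬ IsSymmetricLens (rotation a '' trace (fish B)) := by
  intro h
  obtain ⟨R, hR⟩ := h.eventually_real
  have key : ∀ e, (e = .ray₁ ∨ e = .ray₂) → ∃ x, ((a : ℂ) * fish B e x).im = 0 := by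
    intro e he
    obtain ⟨x, hx0, hx⟩ := ((eventually_ge_atTop 0).and
      (((isGeneralizedLens_fish hB h3 hf).infinite e he).eventually_gt_atTop R)).exists
    refine ⟨x, hR _ ⟨fish B e x, mem_trace ?_, rfl⟩ ?_⟩
    · rcases he with rfl | rfl <;> exact hx0
    · rwa [norm_mul, Circle.norm_coe, one_mul]
  obtain ⟨x, hx⟩ := key .ray₁ (by simp)
  obtain ⟨y, hy⟩ := key .ray₂ (by simp)
  have h1 : cross ((a : ℂ) * fish B .ray₁ x) (a * fish B .ray₂ y) = 0 := by
    rw [cross, hx, hy]; ring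
  rw [cross_circle_mul] at h1
  exact (cross_fish_rays_pos hB hf _ _).ne' h1

lemma fish_ray₁_image (B : ℝ) :
    fish B .ray₁ '' Edge.dom .ray₁ = halfLine (fish B .ray₁ 0) (fish B .ray₁ 0) := by
  have h : fish B .ray₁ 0 = polar (vertexX B) (-halfShort B) := by
    rw [fish, fishX, add_zero]; rfl
  rw [h]
  exact image_polar_ray (vertexX B) (-halfShort B)

lemma fish_ray₂_image (B : ℝ) :
    fish B .ray₂ '' Edge.dom .ray₂ = halfLine (fish B .ray₂ 0) (fish B .ray₂ 0) := by
  have h : fish B .ray₂ 0 = polar (vertexX B) (halfShort B) := by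
    rw [fish, fishX, add_zero]; rfl
  rw [h]
  exact image_polar_ray (vertexX B) (halfShort B)

lemma hasNonParallelHalfLines_fish (hB : 0 < B) (h3 : 1 ≤ 3 * B ^ 2)
    (hf : fishAngle B = 2 * Real.pi) {t : ℝ} (ht : t < 0) :
    HasNonParallelHalfLines (shrinking (trace (fish B)) t) := by
  have hk : 0 < Real.sqrt (-t) := Real.sqrt_pos.2 (neg_pos.2 ht)
  refine ⟨_, (isGeneralizedLens_fish hB h3 hf).shrinking ht, shrinking_eq_trace _ _,
    Real.sqrt (-t) * fish B .ray₁ 0, Real.sqrt (-t) * fish B .ray₂ 0, ?_, ?_, ?_⟩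
  · have hc : cross (Real.sqrt (-t) * fish B .ray₁ 0) (Real.sqrt (-t) * fish B .ray₂ 0) ≠ 0 := by
      rw [← Complex.real_smul, ← Complex.real_smul, cross_smul_left, cross_smul_right]
      exact (mul_pos hk (mul_pos hk (cross_fish_rays_pos hB hf _ _))).ne'
    rw [LinearIndependent.pair_iff]
    intro r s h
    have h1 := congrArg (cross (Real.sqrt (-t) * fish B .ray₁ 0)) h
    have h2 := congrArg (cross (Real.sqrt (-t) * fish B .ray₂ 0)) h
    rw [cross_add_right, cross_smul_right, cross_smul_right, cross_self] at h1 h2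
    have h0 : ∀ z, cross z 0 = 0 := fun z => by simp [cross]
    rw [h0, mul_zero] at h1 h2
    rw [cross_comm] at h2
    constructor
    · simpa [hc] using h2
    · simpa [hc] using h1
  all_goals
    have hm : ∀ (k : ℝ) (S : Set ℂ) (w : ℂ), S = halfLine w w →
        (fun z => (k : ℂ) * z) '' S = halfLine (k * w) (k * w) := by
      rintro k _ w rfl
      ext z
      simp only [mem_image, mem_halfLine_self]
      constructor
      · rintro ⟨_, ⟨r, hr, rfl⟩, rfl⟩
        exact ⟨r, hr, mul_smul_comm _ _ _⟩
      · rintro ⟨r, hr, rfl⟩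
        exact ⟨_, ⟨r, hr, rfl⟩, mul_smul_comm _ _ _⟩
    rw [← image_image (fun z => (Real.sqrt (-t) : ℂ) * z)]
    refine hm _ _ _ ?_
  · exact fish_ray₁_image B
  · exact fish_ray₂_image B

lemma isNonLensShrinker_fish (hB : 0 < B) (h3 : 1 ≤ 3 * B ^ 2) (hf : fishAngle B = 2 * Real.pi) :
    IsNonLensShrinker (shrinking (trace (fish B))) where
  evolves := evolvesByCurveShortening_shrinking (isGeneralizedLens_fish hB h3 hf)
    (isShrinkerOn_fish hB hf)
  homothetic := isHomotheticFamily_shrinking _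
  shrinks := by
    obtain ⟨R, hR⟩ := norm_le_of_mem_boundedPart_fish (B := B)
    exact shrinksToOrigin_shrinking ⟨0, zero_mem_boundedPart_fish hB hf⟩ hR
  ne_lens a h := by
    have := h.2.2.1 (-1) (by norm_num)
    simp only [shrinking_neg_one] at this
    exact not_isSymmetricLens_fish hB h3 hf a this

end fish
end Network
namespace Network

/-! ### The edges of a self-similarly shrinking network -/

lemma eq_smul_of_cross_eq_zero {v w : ℂ} (hw : w ≠ 0) (h : cross v w = 0) :
    v = (dot v w / dot w w) • w := by
  have h1 := dot_self_pos hw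
  apply Complex.ext <;> simp only [Complex.smul_re, Complex.smul_im, smul_eq_mul] <;>
    field_simp <;> simp only [cross, dot] at *
  · linear_combination w.im * h
  · linear_combination (-w.re) * h

lemma dot_mul_dot (w u v : ℂ) :
    dot w w * dot u v = dot w u * dot w v + cross w u * cross w v := by
  simp only [dot, cross]; ring

lemma dot_mul_cross (w u v : ℂ) :
    dot w w * cross u v = dot w u * cross w v - cross w u * dot w v := by
  simp only [dot, cross]; ring

lemma IsShrinkerOn.conj {D : Set ℝ} {c c₁ c₂ : ℝ → ℂ} (h : IsShrinkerOn D c c₁ c₂) :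
    IsShrinkerOn D (fun x => starRingEnd ℂ (c x)) (fun x => starRingEnd ℂ (c₁ x))
      (fun x => starRingEnd ℂ (c₂ x)) where
  hasDeriv x hx := Complex.conjCLE.hasFDerivAt.comp_hasDerivWithinAt x (h.hasDeriv x hx)
  hasDeriv₂ x hx := Complex.conjCLE.hasFDerivAt.comp_hasDerivWithinAt x (h.hasDeriv₂ x hx)
  continuousOn := Complex.continuous_conj.comp_continuousOn h.continuousOn
  ne_zero x hx := by simpa using h.ne_zero x hx
  eq x hx := by
    have := h.eq x hx
    simp only [cross, dot, Complex.conj_re, Complex.conj_im] at *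
    linarith

lemma conj_polar (X θ : ℝ) : starRingEnd ℂ (polar X θ) = polar X (-θ) := by
  apply Complex.ext <;> simp [polar_re, polar_im]

/-- The arc `c`, parametrized by `[0, 1]`, runs along the orbit of level `B` with the phase `a`,
starting at the phase `α` and the polar angle `ϑ`; it runs counterclockwise if `s = 1` and
clockwise if `s = -1`. -/
structure IsPhase (B α ϑ s : ℝ) (c : ℝ → ℂ) (a : ℝ → ℝ) : Prop where
  continuousOn : ContinuousOn a (Icc 0 1)
  strictMonoOn : StrictMonoOn a (Icc 0 1)
  zero : a 0 = α
  eq : ∀ x ∈ Icc (0 : ℝ) 1, c x = polar (orbX B (a x)) (ϑ + s * (ang B (a x) - ang B α))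

/-- Clockwise arcs are reduced to counterclockwise ones by complex conjugation. -/
lemma IsShrinkerOn.exists_isPhase {c c₁ c₂ : ℝ → ℂ} (h : IsShrinkerOn (Icc 0 1) c c₁ c₂)
    {s : ℝ} (hs : s = 1 ∨ s = -1) (hpos : ∀ x ∈ Icc (0 : ℝ) 1, 0 < s * cross (c x) (c₁ x))
    {B α ϑ : ℝ} (hc : c 0 = polar (orbX B α) ϑ)
    (hY : dot (c 0) (c₁ 0) = orbY B α * (s * cross (c 0) (c₁ 0))) :
    ∃ a : ℝ → ℝ, IsPhase B α ϑ s c a ∧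
      dot (c 1) (c₁ 1) = orbY B (a 1) * (s * cross (c 1) (c₁ 1)) := by
  rcases hs with rfl | rfl
  · simp only [one_mul] at *
    obtain ⟨a, h1, h2, h3, h4⟩ := h.exists_phase hpos hc hY
    exact ⟨a, ⟨h1, h2, h3, fun x hx => by rw [(h4 x hx).1, one_mul]⟩, (h4 1 (by simp)).2⟩
  · have hcr : ∀ z w : ℂ, cross (starRingEnd ℂ z) (starRingEnd ℂ w) = -1 * cross z w := by
      intro z w; simp [cross]; ring
    have hdt : ∀ z w : ℂ, dot (starRingEnd ℂ z) (starRingEnd ℂ w) = dot z w := by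
      intro z w; simp [dot]
    obtain ⟨a, h1, h2, h3, h4⟩ := h.conj.exists_phase (B := B) (α := α) (ϑ := -ϑ)
      (fun x hx => by rw [hcr]; exact hpos x hx) (by rw [hc, conj_polar])
      (by rw [hcr, hdt]; exact hY)
    refine ⟨a, ⟨h1, h2, h3, fun x hx => ?_⟩, ?_⟩
    · have := congrArg (starRingEnd ℂ) (h4 x hx).1
      rw [Complex.conj_conj, conj_polar] at this
      rw [this]; congr 1; ring
    · have := (h4 1 (by simp)).2
      rwa [hcr, hdt] at this

section
variable {F : Edge → ℝ → ℂ}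

/-- A shrinking curve which tends to infinity is a half-line in a line through the origin. -/
lemma IsShrinkerOn.exists_halfLine {c c₁ c₂ : ℝ → ℂ} (h : IsShrinkerOn (Ici 0) c c₁ c₂)
    (hinf : Tendsto (fun x => ‖c x‖) atTop atTop) :
    cross (c 0) (c₁ 0) = 0 ∧ c '' Ici 0 = halfLine (c 0) (c₁ 0) := by
  have hD : Convex ℝ (Ici (0 : ℝ)) := convex_Ici 0
  have h0 : (0 : ℝ) ∈ Ici (0 : ℝ) := self_mem_Ici
  have hcr : cross (c 0) (c₁ 0) = 0 := by
    by_contra hne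
    obtain ⟨R, hR⟩ := h.bounded hD h0 hne
    obtain ⟨x, hx0, hx⟩ := ((eventually_ge_atTop 0).and (hinf.eventually_gt_atTop R)).exists
    exact (hR x hx0).not_gt hx
  refine ⟨hcr, ?_⟩
  set w := c₁ 0
  have hw : w ≠ 0 := h.ne_zero 0 h0
  have hww := dot_self_pos hw
  set L : ℝ → ℝ := fun x => dot (c x - c 0) w / dot w w with hL
  set l : ℝ → ℝ := fun x => Real.sqrt (dot (c₁ x) (c₁ x)) / Real.sqrt (dot w w)
  have hl : ∀ x ∈ Ici (0 : ℝ), c₁ x = l x • w := fun x hx => h.straight hD h0 hcr hx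
  have hlpos : ∀ x ∈ Ici (0 : ℝ), 0 ≤ l x := fun x _ => by positivity
  have hpar : ∀ x ∈ Ici (0 : ℝ), cross (c x - c 0) w = 0 := by
    intro x hx
    have hd : ∀ y ∈ Ici (0 : ℝ), HasDerivWithinAt (fun x => cross (c x - c 0) w) 0 (Ici 0) y := by
      intro y hy
      refine (hasDerivWithinAt_cross ((h.hasDeriv y hy).sub_const (c 0))
        (hasDerivWithinAt_const y _ w)).congr_deriv ?_
      rw [hl y hy, cross_smul_left, cross_self]
      simp [cross]
    have := eq_of_hasDerivWithinAt_zero hD hd hx h0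
    simp only [this, sub_self]
    simp [cross]
  have hcL : ∀ x ∈ Ici (0 : ℝ), c x = c 0 + L x • w := fun x hx => by
    rw [hL, ← eq_smul_of_cross_eq_zero hw (hpar x hx)]; ring
  have hLc : ContinuousOn L (Ici 0) :=
    (continuousOn_dot ((ContinuousOn.sub (fun x hx => (h.hasDeriv x hx).continuousWithinAt)
      continuousOn_const)) continuousOn_const).div_const _
  have hL0 : L 0 = 0 := by simp [hL, dot]
  have hLd : ∀ x ∈ Ici (0 : ℝ), HasDerivWithinAt L (l x) (Ici 0) x := by
    intro x hx
    refine ((hasDerivWithinAt_dot ((h.hasDeriv x hx).sub_const (c 0))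
      (hasDerivWithinAt_const x _ w)).div_const _).congr_deriv ?_
    rw [hl x hx, dot_smul_left]
    have hz : dot (c x - c 0) 0 = 0 := by simp [dot]
    rw [hz, add_zero, mul_div_cancel_right₀ _ hww.ne']
  have hmono : MonotoneOn L (Ici 0) := monotoneOn_of_hasDerivWithinAt_nonneg hD hLc
    (fun x hx => (hLd x (interior_subset hx)).mono interior_subset)
    (fun x hx => hlpos x (interior_subset hx))
  ext z
  constructor
  · rintro ⟨x, hx, rfl⟩
    refine ⟨L x, ?_, hcL x hx⟩
    rw [← hL0]
    exact hmono h0 hx hx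
  · rintro ⟨r, hr, rfl⟩
    have hlarge : ∃ x ∈ Ici (0 : ℝ), r ≤ L x := by
      obtain ⟨x, hx0, hx⟩ := ((eventually_ge_atTop 0).and
        (hinf.eventually_gt_atTop (‖c 0‖ + r * ‖w‖))).exists
      refine ⟨x, hx0, ?_⟩
      by_contra! hlt
      have h1 : 0 ≤ L x := by rw [← hL0]; exact hmono h0 hx0 hx0
      have h2 := norm_add_le (c 0) (L x • w)
      rw [← hcL x hx0, norm_smul, Real.norm_of_nonneg h1] at h2
      have := mul_le_mul_of_nonneg_right hlt.le (norm_nonneg w)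
      linarith
    obtain ⟨x, hx0, hx⟩ := hlarge
    obtain ⟨y, hy, hyr⟩ := intermediate_value_Icc (mem_Ici.1 hx0)
      (hLc.mono Icc_subset_Ici_self) ⟨by rw [hL0]; exact hr, hx⟩
    exact ⟨y, hy.1, by rw [hcL y hy.1, hyr]⟩

/-- The time `-1` slice of a network which shrinks self-similarly towards the origin. -/
structure IsShrinkingNetwork (F : Edge → ℝ → ℂ) : Prop where
  lens : IsGeneralizedLens F
  edge : ∀ e, IsShrinkerOn (Edge.dom e) (F e) (derivWithin (F e) e.dom)
    (derivWithin (derivWithin (F e) e.dom) e.dom)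

/-- The half-line at a vertex. -/
def Vertex.ray : Vertex → Edge
  | .p => .ray₁
  | .q => .ray₂

lemma Vertex.isEnd_ray (v : Vertex) : IsEnd v v.ray 0 1 := by
  cases v
  · exact .ray₁_p
  · exact .ray₂_q

lemma IsShrinkingNetwork.ray (h : IsShrinkingNetwork F) (v : Vertex) :
    cross (vertexPos F v) (derivWithin (F v.ray) v.ray.dom 0) = 0 ∧
    F v.ray '' v.ray.dom = halfLine (vertexPos F v) (derivWithin (F v.ray) v.ray.dom 0) := by
  rw [← h.lens.eq_vertexPos v.isEnd_ray]
  cases v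
  · exact (h.edge .ray₁).exists_halfLine (h.lens.infinite _ (Or.inl rfl))
  · exact (h.edge .ray₂).exists_halfLine (h.lens.infinite _ (Or.inr rfl))

lemma IsShrinkingNetwork.exists_vertexPos_ne_zero (h : IsShrinkingNetwork F) :
    ∃ v, vertexPos F v ≠ 0 := by
  by_contra! h0
  exact h.lens.p_ne_q ((h0 .p).trans (h0 .q).symm)

/-- The arcs are not radial: otherwise an arc and a half-line would be tangent at a vertex. -/
lemma IsShrinkingNetwork.cross_ne_zero (h : IsShrinkingNetwork F) {e : Edge}
    (he : e = .arc₁ ∨ e = .arc₂) {x : ℝ} (hx : x ∈ e.dom) :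
    cross (F e x) (derivWithin (F e) e.dom x) ≠ 0 := by
  intro h0
  obtain ⟨v, hv⟩ := h.exists_vertexPos_ne_zero
  obtain ⟨y, σ, hy⟩ : ∃ y σ, IsEnd v e y σ := by
    rcases he with rfl | rfl <;> cases v
    exacts [⟨_, _, .arc₁_p⟩, ⟨_, _, .arc₁_q⟩, ⟨_, _, .arc₂_p⟩, ⟨_, _, .arc₂_q⟩]
  have hne : e ≠ v.ray := by
    rcases he with rfl | rfl <;> cases v <;> simp [Vertex.ray]
  have h1 := (h.edge e).cross_eq_zero (convex_dom e) hx hy.mem_dom h0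
  rw [h.lens.eq_vertexPos hy] at h1
  have h2 := (h.ray v).1
  have hang := h.lens.angle v _ _ _ _ _ _ hy v.isEnd_ray hne
  have hσ : σ ≠ 0 := by cases hy <;> norm_num
  have h3 := cross_ne_zero_of_angle (smul_ne_zero hσ (h.lens.regular e y hy.mem_dom))
    (smul_ne_zero one_ne_zero (h.lens.regular _ 0 (zero_mem_dom _))) hang
  rw [cross_smul_left, one_smul] at h3
  have h4 := dot_mul_cross (vertexPos F v) (derivWithin (F e) e.dom y)
    (derivWithin (F v.ray) v.ray.dom 0)
  rw [h1, h2, mul_zero, zero_mul, sub_zero, mul_eq_zero] at h4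
  rcases h4 with h4 | h4
  · exact (dot_self_pos hv).ne' h4
  · exact h3 (by rw [h4, mul_zero])

lemma IsShrinkingNetwork.vertexPos_ne_zero (h : IsShrinkingNetwork F) (v : Vertex) :
    vertexPos F v ≠ 0 := by
  intro h0
  have key : ∀ x ∈ Icc (0 : ℝ) 1, F .arc₁ x ≠ 0 := fun x hx h0 => by
    refine h.cross_ne_zero (Or.inl rfl) hx ?_
    rw [h0]; simp [cross]
  cases v
  · exact key 0 (by simp) h0
  · exact key 1 (by simp) h0

/-- At a vertex the half-line points away from the origin or towards it, and this determines the
angles between the arcs and the position vector. -/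
lemma IsShrinkingNetwork.exists_sign (h : IsShrinkingNetwork F) (v : Vertex) :
    ∃ ε : ℝ, (ε = 1 ∨ ε = -1) ∧
      F v.ray '' v.ray.dom = halfLine (vertexPos F v) (ε • vertexPos F v) ∧
      ∀ e x σ, (e = .arc₁ ∨ e = .arc₂) → IsEnd v e x σ →
        σ * dot (F e x) (derivWithin (F e) e.dom x) =
          -ε / Real.sqrt 3 * |cross (F e x) (derivWithin (F e) e.dom x)| := by
  have hw := h.vertexPos_ne_zero v
  obtain ⟨h1, h2⟩ := h.ray v
  have hT : derivWithin (F v.ray) v.ray.dom 0 ≠ 0 := h.lens.regular _ 0 (zero_mem_dom _)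
  set w := vertexPos F v
  set T := derivWithin (F v.ray) v.ray.dom 0
  have hT' := eq_smul_of_cross_eq_zero hw (by rw [cross_comm, h1, neg_zero] : cross T w = 0)
  set ρ := dot T w / dot w w
  have hρ : ρ ≠ 0 := by
    rintro h0
    rw [h0, zero_smul] at hT'
    exact hT hT'
  obtain ⟨ε, r, hε, hr, hεr⟩ : ∃ ε r : ℝ, (ε = 1 ∨ ε = -1) ∧ 0 < r ∧ ρ = r * ε := by
    rcases lt_or_gt_of_ne hρ with h0 | h0
    · exact ⟨-1, -ρ, Or.inr rfl, by linarith, by ring⟩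
    · exact ⟨1, ρ, Or.inl rfl, h0, by ring⟩
  have hε2 : ε ^ 2 = 1 := by rcases hε with rfl | rfl <;> norm_num
  refine ⟨ε, hε, ?_, fun e x σ he hx => ?_⟩
  · rw [h2, hT', hεr]
    ext z
    constructor
    · rintro ⟨k, hk, rfl⟩
      exact ⟨k * r, by positivity, by module⟩
    · rintro ⟨k, hk, rfl⟩
      refine ⟨k / r, by positivity, ?_⟩
      rw [smul_smul, smul_smul, ← mul_assoc, div_mul_cancel₀ _ hr.ne']
  · have hne : e ≠ v.ray := by
      rcases he with rfl | rfl <;> cases v <;> simp [Vertex.ray]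
    have hσ : σ ^ 2 = 1 := by cases hx <;> norm_num
    have h3 := dot_of_angle (h.lens.angle v _ _ _ _ _ _ hx v.isEnd_ray hne)
    rw [h.lens.eq_vertexPos hx]
    change dot _ (_ • T) = _ * (_ * ‖_ • T‖) at h3
    change _ * dot w _ = _ * |cross w _|
    rw [one_smul, hT', hεr] at h3
    set u := derivWithin (F e) e.dom x
    have habs : ∀ t : ℝ, t ^ 2 = 1 → |t| = 1 := fun t ht => by
      rw [← Real.sqrt_sq_eq_abs, ht, Real.sqrt_one]
    have hu : ‖σ • u‖ = ‖u‖ := by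
      rw [norm_smul, Real.norm_eq_abs, habs _ hσ, one_mul]
    have hw' : ‖(r * ε) • w‖ = r * ‖w‖ := by
      rw [norm_smul, Real.norm_eq_abs, abs_mul, abs_of_pos hr, habs _ hε2, mul_one]
    rw [dot_smul_left, dot_smul_right, hu, hw'] at h3
    have hcomm : dot u w = dot w u := by simp [dot]; ring
    rw [hcomm] at h3
    have h4 : σ * dot w u = -ε / 2 * (‖u‖ * ‖w‖) := by
      have h5 : r * ε * (σ * dot w u) = r * ε * (-ε / 2 * (‖u‖ * ‖w‖)) := by
        linear_combination h3 + r / 2 * ‖u‖ * ‖w‖ * hε2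
      have h6 : r * ε ≠ 0 := hεr ▸ hρ
      exact mul_left_cancel₀ h6 h5
    have h5 : |cross w u| = Real.sqrt 3 / 2 * (‖u‖ * ‖w‖) := by
      rw [← abs_of_nonneg (show 0 ≤ Real.sqrt 3 / 2 * (‖u‖ * ‖w‖) by positivity),
        ← sq_eq_sq_iff_abs_eq_abs]
      have h6 := cross_sq_add_dot_sq w u
      rw [dot_self, dot_self] at h6
      have h7 : dot w u ^ 2 = 1 / 4 * (‖u‖ * ‖w‖) ^ 2 := by
        have : (σ * dot w u) ^ 2 = (-ε / 2 * (‖u‖ * ‖w‖)) ^ 2 := by rw [h4]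
        linear_combination this - dot w u ^ 2 * hσ + 1 / 4 * (‖u‖ * ‖w‖) ^ 2 * hε2
      rw [mul_pow, div_pow, Real.sq_sqrt (by norm_num)]
      linear_combination h6 - h7
    have h3' : (0 : ℝ) < Real.sqrt 3 := by positivity
    rw [h4, h5]
    field_simp

/-- The two arcs run around the origin in opposite directions. -/
lemma IsShrinkingNetwork.cross_mul_cross_neg (h : IsShrinkingNetwork F) :
    cross (F .arc₁ 0) (derivWithin (F .arc₁) (Edge.dom .arc₁) 0) *
      cross (F .arc₂ 0) (derivWithin (F .arc₂) (Edge.dom .arc₂) 0) < 0 := by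
  obtain ⟨ε, hε, -, h1⟩ := h.exists_sign .p
  have a1 := h1 _ _ _ (Or.inl rfl) .arc₁_p
  have a2 := h1 _ _ _ (Or.inr rfl) .arc₂_p
  have c1 := h.cross_ne_zero (Or.inl rfl) (zero_mem_dom .arc₁)
  have c2 := h.cross_ne_zero (Or.inr rfl) (zero_mem_dom .arc₂)
  have hang := dot_of_angle (h.lens.angle .p _ _ _ _ _ _ .arc₁_p .arc₂_p (by simp))
  have hu := norm_pos_iff.2 (h.lens.regular .arc₁ 0 (zero_mem_dom _))
  have hv := norm_pos_iff.2 (h.lens.regular .arc₂ 0 (zero_mem_dom _))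
  have e1 : F .arc₂ 0 = F .arc₁ 0 := h.lens.eq_vertexPos .arc₂_p
  have hw : F .arc₁ 0 ≠ 0 := h.vertexPos_ne_zero .p
  rw [e1, one_mul] at a2
  rw [one_mul] at a1
  rw [one_smul, one_smul] at hang
  rw [e1] at c2 ⊢
  have h3 := dot_mul_dot (F .arc₁ 0) (derivWithin (F .arc₁) (Edge.dom .arc₁) 0)
    (derivWithin (F .arc₂) (Edge.dom .arc₂) 0)
  have hwpos := dot_self_pos hw
  rw [hang, a1, a2] at h3
  have h4 : 0 ≤ -ε / Real.sqrt 3 * |cross (F .arc₁ 0) (derivWithin (F .arc₁) (Edge.dom .arc₁) 0)| *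
    (-ε / Real.sqrt 3 * |cross (F .arc₁ 0) (derivWithin (F .arc₂) (Edge.dom .arc₂) 0)|) := by
    have : (-ε / Real.sqrt 3) * (-ε / Real.sqrt 3) = (ε / Real.sqrt 3) ^ 2 := by ring
    rw [mul_mul_mul_comm, this]
    positivity
  have h5 := mul_pos hwpos (mul_pos hu hv)
  nlinarith

/-- Description of the arcs of a self-similarly shrinking network by a common level `B`: both start at
the same phase `α`, in opposite directions, and the signs `εp`, `εq` tell whether the half-lines at
the vertices point away from the origin or towards it. -/
lemma IsShrinkingNetwork.exists_arcs (h : IsShrinkingNetwork F) :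
    ∃ B α ϑ s εp εq : ℝ, ∃ a₁ a₂ : ℝ → ℝ, 0 < B ∧ (s = 1 ∨ s = -1) ∧ (εp = 1 ∨ εp = -1) ∧
      (εq = 1 ∨ εq = -1) ∧ IsPhase B α ϑ s (F .arc₁) a₁ ∧ IsPhase B α ϑ (-s) (F .arc₂) a₂ ∧
      orbY B α = -εp / Real.sqrt 3 ∧ orbY B (a₁ 1) = εq / Real.sqrt 3 ∧
      orbY B (a₂ 1) = εq / Real.sqrt 3 ∧
      F .ray₁ '' Edge.dom .ray₁ = halfLine (F .arc₁ 0) (εp • F .arc₁ 0) ∧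
      F .ray₂ '' Edge.dom .ray₂ = halfLine (F .arc₁ 1) (εq • F .arc₁ 1) := by
  obtain ⟨εp, hεp, rp, hp⟩ := h.exists_sign .p
  obtain ⟨εq, hεq, rq, hq⟩ := h.exists_sign .q
  have hs3 : (0 : ℝ) < Real.sqrt 3 := by positivity
  have hw : F .arc₁ 0 ≠ 0 := h.vertexPos_ne_zero .p
  have e1 : F .arc₂ 0 = F .arc₁ 0 := h.lens.eq_vertexPos .arc₂_p
  obtain ⟨B, α, hB, hX, hY⟩ := exists_level_phase
    (Real.log (dot (F .arc₁ 0) (F .arc₁ 0) / 2)) (-εp / Real.sqrt 3)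
    (by refine div_ne_zero ?_ hs3.ne'; rcases hεp with rfl | rfl <;> norm_num)
  have hc : F .arc₁ 0 = polar (orbX B α) (F .arc₁ 0).arg := by
    rw [hX]; exact exists_polar hw
  have hneg := h.cross_mul_cross_neg
  -- a single arc, traversed in the direction `s`
  have arc : ∀ (e : Edge) (s : ℝ), (e = .arc₁ ∨ e = .arc₂) → e.dom = Icc 0 1 →
      IsEnd .p e 0 1 → IsEnd .q e 1 (-1) → (s = 1 ∨ s = -1) →
      0 < s * cross (F e 0) (derivWithin (F e) e.dom 0) →
      ∃ a, IsPhase B α (F .arc₁ 0).arg s (F e) a ∧ orbY B (a 1) = εq / Real.sqrt 3 := by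
    intro e s he hdom h0 h1 hs hpos0
    have hsh := h.edge e
    rw [hdom] at hsh hpos0
    have hpos : ∀ x ∈ Icc (0 : ℝ) 1, 0 < s * cross (F e x) (derivWithin (F e) (Icc 0 1) x) := by
      intro x hx
      rcases hs with rfl | rfl
      · rw [one_mul] at *
        exact hsh.cross_pos (convex_Icc 0 1) (by simp) hx hpos0
      · have hc0 := h.cross_ne_zero he (hdom ▸ hx)
        rw [hdom] at hc0
        rcases lt_or_gt_of_ne hc0 with hlt | hgt
        · linarith
        · have := hsh.cross_pos (convex_Icc 0 1) hx (y := 0) (by simp) hgt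
          linarith
    have habs : ∀ x ∈ Icc (0 : ℝ) 1, |cross (F e x) (derivWithin (F e) (Icc 0 1) x)| =
        s * cross (F e x) (derivWithin (F e) (Icc 0 1) x) := by
      intro x hx
      have := hpos x hx
      rcases hs with rfl | rfl
      · rw [one_mul] at *
        exact abs_of_pos this
      · rw [abs_of_neg (by linarith)]; ring
    have b0 := hp e 0 1 he h0
    have b1 := hq e 1 (-1) he h1
    rw [hdom, habs 0 (by simp), one_mul, ← hY] at b0
    rw [hdom, habs 1 (by simp)] at b1
    obtain ⟨a, ha, ha1⟩ := hsh.exists_isPhase hs hpos (B := B) (α := α) (ϑ := (F .arc₁ 0).arg)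
      ((h.lens.eq_vertexPos h0).trans hc) b0
    refine ⟨a, ha, ?_⟩
    have hpos1 := hpos 1 (by simp)
    rw [ha1] at b1
    apply mul_right_cancel₀ hpos1.ne'
    linear_combination -b1
  obtain ⟨s, hs, h1, h2⟩ : ∃ s : ℝ, (s = 1 ∨ s = -1) ∧
      0 < s * cross (F .arc₁ 0) (derivWithin (F .arc₁) (Edge.dom .arc₁) 0) ∧
      0 < -s * cross (F .arc₂ 0) (derivWithin (F .arc₂) (Edge.dom .arc₂) 0) := by
    rcases mul_neg_iff.1 hneg with ⟨h1, h2⟩ | ⟨h1, h2⟩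
    · exact ⟨1, Or.inl rfl, by linarith, by linarith⟩
    · exact ⟨-1, Or.inr rfl, by linarith, by linarith⟩
  obtain ⟨a₁, ha₁, hb₁⟩ := arc .arc₁ s (Or.inl rfl) rfl .arc₁_p .arc₁_q hs h1
  obtain ⟨a₂, ha₂, hb₂⟩ := arc .arc₂ (-s) (Or.inr rfl) rfl .arc₂_p .arc₂_q
    (by rcases hs with rfl | rfl <;> simp) h2
  exact ⟨B, α, _, s, εp, εq, a₁, a₂, hB, hs, hεp, hεq, ha₁, ha₂, hY, hb₁, hb₂, rp, rq⟩

end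
end Network
namespace Network

/-! ### The closed curve formed by the arcs -/

lemma polar_eq_smul (X X' θ : ℝ) : polar X θ = Real.exp ((X - X') / 2) • polar X' θ := by
  rw [← polar_add_left]; congr 1; ring

lemma exists_smul_polar (X X' θ : ℝ) : ∃ k : ℝ, 0 < k ∧ polar X θ = k • polar X' θ :=
  ⟨_, Real.exp_pos _, polar_eq_smul X X' θ⟩

lemma polar_add_pi {s : ℝ} (hs : s = 1 ∨ s = -1) (X θ : ℝ) :
    polar X (θ + s * Real.pi) = -polar X θ := by
  apply Complex.ext <;> rcases hs with rfl | rfl <;>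
    simp [polar_re, polar_im, ← sub_eq_add_neg, Real.cos_sub_pi, Real.sin_sub_pi]

lemma polar_add_two_pi {s : ℝ} (hs : s = 1 ∨ s = -1) (X θ : ℝ) :
    polar X (θ + s * (2 * Real.pi)) = polar X θ := by
  rw [polar_eq_polar_iff]
  rcases hs with rfl | rfl
  · exact ⟨rfl, 1, by push_cast; ring⟩
  · exact ⟨rfl, -1, by push_cast; ring⟩

/-- The part of the orbit of level `B` between the phases `α` and `e`, starting at the polar
angle `ϑ` and running counterclockwise if `s = 1`, clockwise if `s = -1`. -/
noncomputable def orbitArc (B α e ϑ s : ℝ) : Set ℂ :=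
  (fun a => polar (orbX B a) (ϑ + s * (ang B a - ang B α))) '' Icc α e

section
variable {B α ϑ s : ℝ} {c : ℝ → ℂ} {a : ℝ → ℝ}

lemma IsPhase.hits (h : IsPhase B α ϑ s c a) {η : ℝ}
    (hη : η ∈ Icc 0 (ang B (a 1) - ang B α)) :
    ∃ x ∈ Icc (0 : ℝ) 1, ang B (a x) - ang B α = η ∧
      c x = polar (orbX B (phase B (ang B α + η))) (ϑ + s * η) := by
  have hc : ContinuousOn (fun x => ang B (a x) - ang B α) (Icc 0 1) :=
    ((continuous_ang B).comp_continuousOn h.continuousOn).sub continuousOn_const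
  have h0 : ang B (a 0) - ang B α = 0 := by rw [h.zero, sub_self]
  obtain ⟨x, hx, hxη⟩ := intermediate_value_Icc zero_le_one hc (by simpa only [h0] using hη)
  simp only at hxη
  refine ⟨x, hx, hxη, ?_⟩
  rw [h.eq x hx, hxη, show ang B α + η = ang B (a x) by linarith, phase_ang]

lemma IsPhase.lt_one (h : IsPhase B α ϑ s c a) : α < a 1 := by
  have := h.strictMonoOn (show (0 : ℝ) ∈ Icc 0 1 by simp) (show (1 : ℝ) ∈ Icc 0 1 by simp)
    zero_lt_one
  rwa [h.zero] at this

lemma IsPhase.angle_pos (h : IsPhase B α ϑ s c a) :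
    0 < ang B (a 1) - ang B α := sub_pos.2 (strictMono_ang B h.lt_one)

lemma IsPhase.image (h : IsPhase B α ϑ s c a) :
    c '' Icc 0 1 = orbitArc B α (a 1) ϑ s := by
  ext z
  constructor
  · rintro ⟨x, hx, rfl⟩
    refine ⟨a x, ⟨?_, ?_⟩, (h.eq x hx).symm⟩
    · rw [← h.zero]; exact h.strictMonoOn.monotoneOn (by simp) hx hx.1
    · exact h.strictMonoOn.monotoneOn hx (by simp) hx.2
  · rintro ⟨b, hb, rfl⟩
    obtain ⟨x, hx, rfl⟩ := intermediate_value_Icc zero_le_one h.continuousOn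
      (by rwa [h.zero] : b ∈ Icc (a 0) (a 1))
    exact ⟨x, hx, h.eq x hx⟩

end

section
variable {F : Edge → ℝ → ℂ} {B α ϑ s : ℝ} {a : ℝ → ℝ} {e : Edge}

lemma IsGeneralizedLens.eq_vertexPos_of_mem_ray (hF : IsGeneralizedLens F) {v : Vertex}
    (he : e = .arc₁ ∨ e = .arc₂) {x : ℝ} (hx : x ∈ e.dom)
    (h : F e x ∈ F v.ray '' v.ray.dom) : F e x = vertexPos F v := by
  obtain ⟨y, hy, hyx⟩ := h
  rcases (hF.injective _ y hy _ x hx).1 hyx with ⟨h1, -⟩ | ⟨v', σ, σ', h1, h2⟩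
  · rcases he with rfl | rfl <;> cases v <;> simp [Vertex.ray] at h1
  · have : v' = v := by
      cases v
      · exact (isEnd_ray₁ h1).1
      · exact (isEnd_ray₂ h1).1
    subst this
    exact hF.eq_vertexPos h2

lemma isEnd_arc_p (he : e = .arc₁ ∨ e = .arc₂) : IsEnd .p e 0 1 := by
  rcases he with rfl | rfl
  exacts [.arc₁_p, .arc₂_p]

lemma isEnd_arc_q (he : e = .arc₁ ∨ e = .arc₂) : IsEnd .q e 1 (-1) := by
  rcases he with rfl | rfl
  exacts [.arc₁_q, .arc₂_q]

lemma dom_arc (he : e = .arc₁ ∨ e = .arc₂) : e.dom = Icc 0 1 := by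
  rcases he with rfl | rfl <;> rfl

lemma trace_eq (F : Edge → ℝ → ℂ) : trace F =
    F .arc₁ '' Edge.dom .arc₁ ∪ F .arc₂ '' Edge.dom .arc₂ ∪
      (F .ray₁ '' Edge.dom .ray₁ ∪ F .ray₂ '' Edge.dom .ray₂) := by
  ext z
  simp only [trace, mem_iUnion, mem_union]
  constructor
  · rintro ⟨e, he⟩
    cases e <;> simp [he]
  · rintro ((h | h) | (h | h))
    exacts [⟨_, h⟩, ⟨_, h⟩, ⟨_, h⟩, ⟨_, h⟩]

/-- If an arc runs through an angle of at least `π`, it meets the half-lines opposite to both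
vertices. Hence the half-lines at the vertices do not pass through the origin. -/
lemma IsShrinkingNetwork.ray_outward (h : IsShrinkingNetwork F) (he : e = .arc₁ ∨ e = .arc₂)
    (hs : s = 1 ∨ s = -1) (ha : IsPhase B α ϑ s (F e) a)
    (hπ : Real.pi ≤ ang B (a 1) - ang B α) (v : Vertex) :
    F v.ray '' v.ray.dom ≠ halfLine (vertexPos F v) ((-1 : ℝ) • vertexPos F v) := by
  have hp := Real.pi_pos
  obtain ⟨x, hx, k, hk, hxk⟩ : ∃ x ∈ Icc (0 : ℝ) 1, ∃ k : ℝ, 0 < k ∧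
      F e x = -(k • vertexPos F v) := by
    cases v
    · obtain ⟨x, hx, -, hxp⟩ := ha.hits ⟨hp.le, hπ⟩
      obtain ⟨k, hk, hkX⟩ := exists_smul_polar (orbX B (phase B (ang B α + Real.pi))) (orbX B α) ϑ
      refine ⟨x, hx, k, hk, ?_⟩
      rw [hxp, polar_add_pi hs, ← h.lens.eq_vertexPos (isEnd_arc_p he), ha.eq 0 (by simp),
        ha.zero, sub_self, mul_zero, add_zero, hkX]
    · obtain ⟨x, hx, -, hxp⟩ := ha.hits (η := ang B (a 1) - ang B α - Real.pi)
        ⟨by linarith, by linarith⟩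
      obtain ⟨k, hk, hkX⟩ := exists_smul_polar
        (orbX B (phase B (ang B α + (ang B (a 1) - ang B α - Real.pi)))) (orbX B (a 1))
        (ϑ + s * (ang B (a 1) - ang B α - Real.pi))
      refine ⟨x, hx, k, hk, ?_⟩
      rw [hxp, ← h.lens.eq_vertexPos (isEnd_arc_q he), ha.eq 1 (by simp),
        show ϑ + s * (ang B (a 1) - ang B α) =
          ϑ + s * (ang B (a 1) - ang B α - Real.pi) + s * Real.pi by ring, polar_add_pi hs,
        smul_neg, neg_neg, hkX]
  intro hray
  have hw := h.vertexPos_ne_zero v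
  have hmem : F e x ∈ F v.ray '' v.ray.dom := by
    rw [hray]
    exact ⟨1 + k, by positivity, by rw [hxk]; module⟩
  have h1 := h.lens.eq_vertexPos_of_mem_ray he (by rwa [dom_arc he]) hmem
  rw [hxk, neg_eq_iff_add_eq_zero] at h1
  have h2 : (1 + k) • vertexPos F v = 0 := by rw [← h1]; module
  rcases smul_eq_zero.1 h2 with h3 | h3
  · linarith
  · exact hw h3

/-- An arc does not wind around the origin: otherwise the distances from the origin of consecutive
turns would be ordered in opposite ways near the two vertices. -/
lemma IsShrinkingNetwork.angle_lt_two_pi (h : IsShrinkingNetwork F) (he : e = .arc₁ ∨ e = .arc₂)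
    (hs : s = 1 ∨ s = -1) (ha : IsPhase B α ϑ s (F e) a)
    (hray : ∀ v : Vertex, F v.ray '' v.ray.dom = halfLine (vertexPos F v) (vertexPos F v)) :
    ang B (a 1) - ang B α < 2 * Real.pi := by
  by_contra! hge
  have hp := Real.pi_pos
  set X : ℝ → ℝ := fun η => orbX B (phase B (ang B α + η)) with hXdef
  have hXc : Continuous X := (isOrbit_shift (isOrbit_orb B) (ang B α)).contDiff.1.continuous
  set Δ := ang B (a 1) - ang B α with hΔ
  -- a turn which crosses the line through the vertex does so between the origin and the vertex, because the
  -- half-line already occupies the points beyond the vertex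
  have ray : ∀ (v : Vertex) (x η Y : ℝ), x ∈ Icc (0 : ℝ) 1 → F e x = polar (X η) (ϑ + s * η) →
      vertexPos F v = polar Y (ϑ + s * η) → F e x ≠ vertexPos F v → X η < Y := by
    intro v x η Y hx h1 h2 hne
    by_contra! hle
    refine hne (h.lens.eq_vertexPos_of_mem_ray he (by rwa [dom_arc he]) ?_)
    rw [hray, mem_halfLine_self]
    refine ⟨Real.exp ((X η - Y) / 2), Real.one_le_exp (by linarith), ?_⟩
    rw [h1, h2, ← polar_eq_smul]
  have hp0 : vertexPos F .p = polar (X 0) ϑ := by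
    rw [← h.lens.eq_vertexPos (isEnd_arc_p he), ha.eq 0 (by simp), ha.zero, hXdef]
    simp
  have hq0 : vertexPos F .q = polar (X Δ) (ϑ + s * Δ) := by
    rw [← h.lens.eq_vertexPos (isEnd_arc_q he), ha.eq 1 (by simp), hXdef]
    simp only [hΔ, add_sub_cancel, phase_ang]
  have inj : ∀ x ∈ Icc (0 : ℝ) 1, ∀ y ∈ Icc (0 : ℝ) 1, F e x = F e y → x = y := by
    intro x hx y hy hxy
    rcases (h.lens.injective e x (by rwa [dom_arc he]) e y (by rwa [dom_arc he])).1 hxy with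
      ⟨-, h1⟩ | ⟨v, σ, σ', h1, h2⟩
    · exact h1
    · rcases he with rfl | rfl <;> cases h1 <;> cases h2 <;> rfl
  -- `X (η + 2 * π) - X η` changes sign, and a zero of it is a self-intersection of the arc
  have g0 : X (0 + 2 * Real.pi) - X 0 ≤ 0 := by
    obtain ⟨x, hx, hxη, hxp⟩ := ha.hits (η := 2 * Real.pi) ⟨by linarith, hge⟩
    have := ray .p x (2 * Real.pi) (X 0) hx hxp (by rw [polar_add_two_pi hs, hp0]) (by
      intro heq
      have := inj x hx 0 (by simp) (heq.trans (h.lens.eq_vertexPos (isEnd_arc_p he)).symm)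
      rw [this, ha.zero, sub_self] at hxη
      linarith)
    rw [zero_add]
    linarith
  have g1 : 0 ≤ X (Δ - 2 * Real.pi + 2 * Real.pi) - X (Δ - 2 * Real.pi) := by
    obtain ⟨x, hx, hxη, hxp⟩ := ha.hits (η := Δ - 2 * Real.pi) ⟨by linarith, by linarith⟩
    have := ray .q x (Δ - 2 * Real.pi) (X Δ) hx hxp
      (by rw [hq0, ← polar_add_two_pi hs (X Δ) (ϑ + s * (Δ - 2 * Real.pi))]; congr 1; ring) (by
      intro heq
      have := inj x hx 1 (by simp) (heq.trans (h.lens.eq_vertexPos (isEnd_arc_q he)).symm)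
      rw [this] at hxη
      linarith)
    rw [sub_add_cancel]
    linarith
  obtain ⟨η, hη, hη0⟩ := intermediate_value_Icc (by linarith : 0 ≤ Δ - 2 * Real.pi)
    (f := fun η => X (η + 2 * Real.pi) - X η) (by fun_prop) ⟨g0, g1⟩
  obtain ⟨x, hx, hxη, hxp⟩ := ha.hits (η := η) ⟨hη.1, by linarith [hη.2]⟩
  obtain ⟨y, hy, hyη, hyp⟩ := ha.hits (η := η + 2 * Real.pi) ⟨by linarith [hη.1], by
    linarith [hη.2]⟩
  have hXX : X (η + 2 * Real.pi) = X η := by simp only at hη0; linarith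
  have hxy : F e x = F e y := by
    rw [hxp, hyp]
    change polar (X η) _ = polar (X (η + 2 * Real.pi)) _
    rw [hXX, ← polar_add_two_pi hs]
    congr 1; ring
  have := inj x hx y hy hxy
  rw [this] at hxη
  linarith

/-- Description of a self-similarly shrinking network: both half-lines point away from the origin,
and the arcs run along the same orbit and once around the origin. -/
theorem IsShrinkingNetwork.exists_normal_form (h : IsShrinkingNetwork F) :
    ∃ B α ϑ s e₁ e₂ : ℝ, 0 < B ∧ (s = 1 ∨ s = -1) ∧ α < e₁ ∧ α < e₂ ∧
      orbY B α = -1 / Real.sqrt 3 ∧ orbY B e₁ = 1 / Real.sqrt 3 ∧ orbY B e₂ = 1 / Real.sqrt 3 ∧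
      orbX B e₁ = orbX B e₂ ∧
      (ang B e₁ - ang B α) + (ang B e₂ - ang B α) = 2 * Real.pi ∧
      trace F = orbitArc B α e₁ ϑ s ∪ orbitArc B α e₂ ϑ (-s) ∪
        (halfLine (polar (orbX B α) ϑ) (polar (orbX B α) ϑ) ∪
        halfLine (polar (orbX B e₁) (ϑ + s * (ang B e₁ - ang B α)))
          (polar (orbX B e₁) (ϑ + s * (ang B e₁ - ang B α)))) := by
  obtain ⟨B, α, ϑ, s, εp, εq, a₁, a₂, hB, hs, hεp, hεq, ha₁, ha₂, hY, hY₁, hY₂, rp, rq⟩ :=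
    h.exists_arcs
  have hp := Real.pi_pos
  have hs' : -s = 1 ∨ -s = -1 := by rcases hs with rfl | rfl <;> simp
  have l₁ : (Edge.arc₁ = .arc₁ ∨ Edge.arc₁ = .arc₂) := Or.inl rfl
  have l₂ : (Edge.arc₂ = .arc₁ ∨ Edge.arc₂ = .arc₂) := Or.inr rfl
  have hq : F .arc₁ 1 = F .arc₂ 1 := (h.lens.eq_vertexPos .arc₂_q).symm
  rw [ha₁.eq 1 (by simp), ha₂.eq 1 (by simp), polar_eq_polar_iff] at hq
  obtain ⟨hX, n, hn⟩ := hq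
  have p₁ := ha₁.angle_pos
  have p₂ := ha₂.angle_pos
  obtain ⟨m, hm⟩ : ∃ m : ℤ, (ang B (a₁ 1) - ang B α) + (ang B (a₂ 1) - ang B α) =
      m * (2 * Real.pi) := by
    rcases hs with rfl | rfl
    · exact ⟨n, by linarith⟩
    · exact ⟨-n, by push_cast; linarith⟩
  -- the total winding `m` is positive, and less than two as neither arc winds around the origin
  have hm1 : 1 ≤ m := by
    by_contra! hlt
    have : (m : ℝ) ≤ 0 := by exact_mod_cast (by omega : m ≤ 0)
    nlinarith
  have hm1' : (1 : ℝ) ≤ m := by exact_mod_cast hm1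
  -- the longer of the two arcs runs through an angle of at least `π`
  have hout : ∀ v : Vertex,
      F v.ray '' v.ray.dom ≠ halfLine (vertexPos F v) ((-1 : ℝ) • vertexPos F v) := by
    rcases le_total Real.pi (ang B (a₁ 1) - ang B α) with h1 | h1
    · exact h.ray_outward l₁ hs ha₁ h1
    · refine h.ray_outward l₂ hs' ha₂ ?_
      nlinarith
  have hp1 : εp = 1 := hεp.resolve_right fun h1 => hout .p (by rw [← h1]; exact rp)
  have hq1 : εq = 1 := hεq.resolve_right fun h1 => hout .q (by rw [← h1]; exact rq)
  subst hp1 hq1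
  rw [one_smul] at rp rq
  have hray : ∀ v : Vertex,
      F v.ray '' v.ray.dom = halfLine (vertexPos F v) (vertexPos F v) := by
    intro v; cases v
    exacts [rp, rq]
  have w₁ := h.angle_lt_two_pi l₁ hs ha₁ hray
  have w₂ := h.angle_lt_two_pi l₂ hs' ha₂ hray
  have hm2 : m = 1 := by
    have : (m : ℝ) < 2 := by nlinarith
    have : m < 2 := by exact_mod_cast this
    omega
  subst hm2
  refine ⟨B, α, ϑ, s, a₁ 1, a₂ 1, hB, hs, ha₁.lt_one, ha₂.lt_one, hY, hY₁, hY₂, hX,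
    by simpa using hm, ?_⟩
  rw [trace_eq, rp, rq, ← ha₁.image, ← ha₂.image, ← ha₁.eq 1 (by simp)]
  have : F .arc₁ 0 = polar (orbX B α) ϑ := by rw [ha₁.eq 0 (by simp), ha₁.zero]; simp
  rw [this]
  rfl

end
end Network
namespace Network

/-! ### The possible phases of the arcs -/

lemma ang_add_beta_of_reflect (B : ℝ) :
    ang B (-(3 * Real.pi / 2) + beta B) = -ang B (Real.pi / 2 - beta B) := by
  rw [← ang_reflect]; congr 1; ring

/-- The phase `π/2 - β` lies beyond the phase `0`, up to which the orbit has already turned by at least a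
quarter of a period, the density being larger nearer to the origin. -/
lemma quarter_period_le {B : ℝ} (hB : 0 < B) :
    period B / 4 ≤ ang B (Real.pi / 2 - beta B) := by
  have h1 := ang_pi_div_two_sub_le hB.le (y := Real.pi / 2) (by positivity) le_rfl
  have h2 := two_mul_ang_pi_div_two B
  rw [neg_add_cancel, sub_self] at h1
  have h3 := (strictMono_ang B).monotone (show 0 ≤ Real.pi / 2 - beta B by linarith [beta_le B])
  linarith

/-- The closing condition leaves only the two arcs of equal length and, for the fish-shaped
network, one further turn on the second arc. Modulo `2 * π` there are two possible initial phases `S`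
and two possible final phases `E`; since the period exceeds `π`, all combinations but one turn too
far. -/
lemma turns_eq {B α e : ℝ} {n : ℤ} (hB : 0 < B) (hα : Real.cos α = -1 * Real.sin (beta B))
    (he : Real.cos e = 1 * Real.sin (beta B)) (hαe : α < e) (hn : 0 ≤ n)
    (hsum : 2 * (ang B e - ang B α) + n * period B = 2 * Real.pi) :
    n = 0 ∨ n = 1 ∧ fishAngle B = 2 * Real.pi ∧ ∃ i : ℤ,
      α = -(Real.pi / 2) - beta B + i * (2 * Real.pi) ∧
      e = -(Real.pi / 2) + beta B + i * (2 * Real.pi) := by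
  have hπ := Real.pi_pos
  have hβ := beta_pos hB
  have hβ' := beta_le B
  have hΘ := pi_lt_period hB.le
  have hδ := halfShort_pos hB
  have hh := half_period_le hB
  have hh4 := quarter_period_le hB
  have aS₁ := ang_neg_sub_beta B
  have aS₂ := ang_add_beta_of_reflect B
  have aE₁ : ang B (-(Real.pi / 2) + beta B) = halfShort B := rfl
  set h := ang B (Real.pi / 2 - beta B)
  obtain ⟨i, S, hS, hSα⟩ : ∃ i : ℤ, ∃ S,
      (S = -(Real.pi / 2) - beta B ∨ S = -(3 * Real.pi / 2) + beta B) ∧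
      α = S + i * (2 * Real.pi) := by
    have : Real.cos (-(Real.pi / 2) - beta B) = Real.cos α := by
      rw [hα, ← Real.cos_neg, neg_sub, sub_neg_eq_add, Real.cos_add_pi_div_two]; ring
    obtain ⟨k, hk | hk⟩ := Real.cos_eq_cos_iff.1 this
    · exact ⟨k, _, Or.inl rfl, by rw [hk]; ring⟩
    · exact ⟨k + 1, _, Or.inr rfl, by rw [hk]; push_cast; ring⟩
  obtain ⟨k, E, hE, hEe⟩ : ∃ k : ℤ, ∃ E,
      (E = -(Real.pi / 2) + beta B ∨ E = Real.pi / 2 - beta B) ∧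
      e = E + k * (2 * Real.pi) := by
    have : Real.cos (-(Real.pi / 2) + beta B) = Real.cos e := by
      rw [he, ← Real.cos_neg, neg_add, neg_neg, ← sub_eq_add_neg, Real.cos_pi_div_two_sub, one_mul]
    obtain ⟨k, hk | hk⟩ := Real.cos_eq_cos_iff.1 this
    · exact ⟨k, _, Or.inl rfl, by rw [hk]; ring⟩
    · exact ⟨k, _, Or.inr rfl, by rw [hk]; ring⟩
  have hSle : -(3 * Real.pi / 2) + beta B ≤ S := by rcases hS with rfl | rfl <;> linarith
  have hEle : E ≤ Real.pi / 2 - beta B := by rcases hE with rfl | rfl <;> linarith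
  have hik : i ≤ k := by
    by_contra! hlt
    have : (k : ℝ) ≤ i - 1 := by exact_mod_cast (by omega : k ≤ i - 1)
    nlinarith
  rw [hSα, hEe, ang_add_int_mul, ang_add_int_mul] at hsum
  have aS : ang B S = -halfShort B ∨ ang B S = -h := by
    rcases hS with rfl | rfl
    exacts [Or.inl aS₁, Or.inr aS₂]
  have aE : ang B E = halfShort B ∨ ang B E = h := by
    rcases hE with rfl | rfl
    exacts [Or.inl aE₁, Or.inr rfl]
  have hpos : 0 < ang B E - ang B S := by
    rcases aS with h1 | h1 <;> rcases aE with h2 | h2 <;> rw [h1, h2] <;> linarith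
  have hm : 2 * (k - i) + n < 2 := by
    by_contra! hge
    have : (2 : ℝ) ≤ 2 * (k - i) + n := by exact_mod_cast hge
    nlinarith
  obtain rfl : k = i := by omega
  obtain rfl | rfl : n = 0 ∨ n = 1 := by omega
  · exact Or.inl rfl
  · push_cast at hsum
    refine Or.inr ⟨rfl, ?_, k, ?_⟩
    · rcases hS with rfl | rfl <;> rcases hE with rfl | rfl
      · rw [aS₁, aE₁] at hsum
        rw [fishAngle]; linarith
      · have : ang B (Real.pi / 2 - beta B) = h := rfl
        rw [aS₁, this] at hsum
        linarith
      · rw [aS₂, aE₁] at hsum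
        linarith
      · have : ang B (Real.pi / 2 - beta B) = h := rfl
        rw [aS₂, this] at hsum
        linarith
    · rcases hS with rfl | rfl <;> rcases hE with rfl | rfl
      · exact ⟨hSα, hEe⟩
      · have : ang B (Real.pi / 2 - beta B) = h := rfl
        rw [aS₁, this] at hsum
        linarith
      · rw [aS₂, aE₁] at hsum
        linarith
      · have : ang B (Real.pi / 2 - beta B) = h := rfl
        rw [aS₂, this] at hsum
        linarith

/-- Position and tangent at the final vertex determine the final phase up to full oscillations. -/
lemma exists_turns {B e₁ e₂ : ℝ} (hB : 0 < B) (hc : Real.cos e₁ = Real.cos e₂)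
    (hX : orbX B e₁ = orbX B e₂) : ∃ n : ℤ, e₂ = e₁ + n * (2 * Real.pi) := by
  have hs : Real.sin e₂ = Real.sin e₁ :=
    (mul_left_cancel₀ hB.ne' (strictMono_xi.injective hX)).symm
  obtain ⟨n, hn⟩ := Real.Angle.angle_eq_iff_two_pi_dvd_sub.1 (Real.Angle.cos_sin_inj hc.symm hs)
  exact ⟨n, by linarith⟩

/-! ### Arcs of orbits -/

lemma orbX_reflect (B a : ℝ) : orbX B (-Real.pi - a) = orbX B a := by
  refine orbX_congr ?_
  rw [← neg_add', Real.sin_neg, add_comm, Real.sin_add_pi, neg_neg]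

lemma orbX_pi_sub (B a : ℝ) : orbX B (Real.pi - a) = orbX B a := orbX_congr (Real.sin_pi_sub a)

/-- Traversing an arc of an orbit backwards amounts to a reflection of the phase about an apsis. -/
lemma orbitArc_reverse {B r K : ℝ} (hX : ∀ a, orbX B (r - a) = orbX B a)
    (hA : ∀ a, ang B (r - a) = K - ang B a) (α e ϑ s : ℝ) :
    orbitArc B α e ϑ s =
      orbitArc B (r - e) (r - α) (ϑ + s * (ang B e - ang B α)) (-s) := by
  have key : ∀ a, polar (orbX B (r - a)) (ϑ + s * (ang B e - ang B α) +
      -s * (ang B (r - a) - ang B (r - e))) = polar (orbX B a) (ϑ + s * (ang B a - ang B α)) := by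
    intro a
    rw [hX, hA, hA]; congr 1; ring
  ext z
  constructor
  · rintro ⟨a, ha, rfl⟩
    exact ⟨r - a, ⟨by linarith [ha.2], by linarith [ha.1]⟩, key a⟩
  · rintro ⟨b, hb, rfl⟩
    refine ⟨r - b, ⟨by linarith [hb.2], by linarith [hb.1]⟩, ?_⟩
    have := key (r - b)
    rw [sub_sub_cancel] at this
    exact this.symm

lemma orbitArc_add_int (B α e ϑ s : ℝ) (i : ℤ) :
    orbitArc B (α + i * (2 * Real.pi)) (e + i * (2 * Real.pi)) ϑ s = orbitArc B α e ϑ s := by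
  have hX : ∀ a, orbX B (a + i * (2 * Real.pi)) = orbX B a := fun a =>
    orbX_congr (Real.sin_add_int_mul_two_pi a i)
  have key : ∀ a, polar (orbX B (a + i * (2 * Real.pi)))
      (ϑ + s * (ang B (a + i * (2 * Real.pi)) - ang B (α + i * (2 * Real.pi)))) =
      polar (orbX B a) (ϑ + s * (ang B a - ang B α)) := by
    intro a
    rw [hX, ang_add_int_mul, ang_add_int_mul]; congr 1; ring
  ext z
  constructor
  · rintro ⟨a, ha, rfl⟩
    refine ⟨a - i * (2 * Real.pi), ⟨by linarith [ha.1], by linarith [ha.2]⟩, ?_⟩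
    have := key (a - i * (2 * Real.pi))
    rw [sub_add_cancel] at this
    exact this.symm
  · rintro ⟨a, ha, rfl⟩
    exact ⟨a + i * (2 * Real.pi), ⟨by linarith [ha.1], by linarith [ha.2]⟩, key a⟩

lemma orbitArc_add_two_pi {s' : ℝ} (hs : s' = 1 ∨ s' = -1) (B α e ϑ s : ℝ) :
    orbitArc B α e (ϑ + s' * (2 * Real.pi)) s = orbitArc B α e ϑ s := by
  refine image_congr fun a _ => ?_
  rw [← polar_add_two_pi hs _ (ϑ + s * (ang B a - ang B α))]
  congr 1; ring

lemma rotation_polar (φ X θ : ℝ) :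
    rotation (Circle.exp φ) (polar X θ) = polar X (φ + θ) := by
  rw [rotation_apply, Circle.coe_exp, polar_add]

lemma rotation_orbitArc (φ B α e ϑ s : ℝ) :
    rotation (Circle.exp φ) '' orbitArc B α e ϑ s = orbitArc B α e (φ + ϑ) s := by
  rw [orbitArc, image_image]
  refine image_congr fun a _ => ?_
  rw [rotation_polar, add_assoc]

lemma rotation_halfLine (φ X θ : ℝ) :
    rotation (Circle.exp φ) '' halfLine (polar X θ) (polar X θ) =
      halfLine (polar X (φ + θ)) (polar X (φ + θ)) := by
  rw [← rotation_polar]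
  ext z
  simp only [mem_image, mem_halfLine_self]
  constructor
  · rintro ⟨_, ⟨k, hk, rfl⟩, rfl⟩
    exact ⟨k, hk, map_smul _ _ _⟩
  · rintro ⟨k, hk, rfl⟩
    exact ⟨_, ⟨k, hk, rfl⟩, map_smul _ _ _⟩

/-! ### Uniqueness of the fish-shaped network -/

/-- The fish-shaped network, in the position where one vertex has the polar angle `ϑ` and the short
arc leaves this vertex in the direction `s`. -/
noncomputable def fishSet (B ϑ s : ℝ) : Set ℂ :=
  orbitArc B (-(Real.pi / 2) - beta B) (-(Real.pi / 2) + beta B) ϑ s ∪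
    orbitArc B (-(Real.pi / 2) - beta B) (3 * Real.pi / 2 + beta B) ϑ (-s) ∪
    (halfLine (polar (vertexX B) ϑ) (polar (vertexX B) ϑ) ∪
      halfLine (polar (vertexX B) (ϑ + s * (2 * halfShort B)))
        (polar (vertexX B) (ϑ + s * (2 * halfShort B))))

lemma rotation_fishSet (φ B ϑ s : ℝ) :
    rotation (Circle.exp φ) '' fishSet B ϑ s = fishSet B (φ + ϑ) s := by
  simp only [fishSet, image_union, rotation_orbitArc, rotation_halfLine, add_assoc]

lemma orbitArc_short (B ϑ s : ℝ) :
    orbitArc B (-(Real.pi / 2) - beta B) (-(Real.pi / 2) + beta B) ϑ s =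
    orbitArc B (-(Real.pi / 2) - beta B) (-(Real.pi / 2) + beta B)
      (ϑ + s * (2 * halfShort B)) (-s) := by
  have h := orbitArc_reverse (orbX_reflect B) (K := 0) (fun a => by rw [ang_reflect, zero_sub])
    (-(Real.pi / 2) - beta B) (-(Real.pi / 2) + beta B) ϑ s
  rw [h, ang_neg_sub_beta]
  change orbitArc B _ _ (ϑ + s * (halfShort B - -halfShort B)) _ = _
  congr 1 <;> ring

lemma orbitArc_long {B s : ℝ} (hf : fishAngle B = 2 * Real.pi) (hs : s = 1 ∨ s = -1) (ϑ : ℝ) :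
    orbitArc B (-(Real.pi / 2) - beta B) (3 * Real.pi / 2 + beta B) ϑ (-s) =
    orbitArc B (-(Real.pi / 2) - beta B) (3 * Real.pi / 2 + beta B)
      (ϑ + s * (2 * halfShort B)) s := by
  have h := orbitArc_reverse (orbX_pi_sub B) (ang_pi_sub B)
    (-(Real.pi / 2) - beta B) (3 * Real.pi / 2 + beta B) ϑ (-s)
  rw [h, ang_neg_sub_beta, ang_add_beta, ← orbitArc_add_two_pi hs, neg_neg]
  unfold fishAngle at hf
  congr 1
  · ring
  · ring
  · rw [← hf]; ring

/-- The reflection symmetry of the fish-shaped network. -/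
lemma fishSet_symm {B s : ℝ} (hf : fishAngle B = 2 * Real.pi) (hs : s = 1 ∨ s = -1) (ϑ : ℝ) :
    fishSet B ϑ s = fishSet B (ϑ + s * (2 * halfShort B)) (-s) := by
  have h1 : ϑ + s * (2 * halfShort B) + -s * (2 * halfShort B) = ϑ := by ring
  rw [fishSet, fishSet, h1, ← orbitArc_short, neg_neg, ← orbitArc_long hf hs,
    union_comm (halfLine (polar (vertexX B) ϑ) _)]

lemma exists_rotation_fishSet {B s : ℝ} (hf : fishAngle B = 2 * Real.pi) (hs : s = 1 ∨ s = -1)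
    (ϑ : ℝ) : ∃ a : Circle, fishSet B ϑ s = rotation a '' fishSet B (-halfShort B) 1 := by
  rcases hs with rfl | rfl
  · exact ⟨Circle.exp (ϑ + halfShort B), by rw [rotation_fishSet]; congr 1; ring⟩
  · refine ⟨Circle.exp (ϑ - halfShort B), ?_⟩
    rw [rotation_fishSet, fishSet_symm hf (Or.inr rfl), neg_neg]
    congr 1; ring

/-- The parametrization by edges and the description by phases yield the same network. -/
lemma trace_fish {B : ℝ} (hB : 0 < B) (hf : fishAngle B = 2 * Real.pi) :
    trace (fish B) = fishSet B (-halfShort B) 1 := by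
  have hδ := halfShort_pos hB
  have hδ' := halfShort_lt hB hf
  have hπ := Real.pi_pos
  have arc : ∀ (C u m α e : ℝ), m ≠ 0 → (ang B α = C + u ∧ ang B e = C + (u + m) ∧ α < e ∨
      ang B e = C + u ∧ ang B α = C + (u + m) ∧ α < e) →
      (fun x => polar (orbX B (phase B (C + (u + m * x)))) (u + m * x)) '' Icc 0 1 =
        orbitArc B α e (ang B α - C) 1 := by
    intro C u m α e hm h
    ext z
    constructor
    · rintro ⟨x, hx, rfl⟩
      refine ⟨phase B (C + (u + m * x)), ?_, ?_⟩
      · rw [← phase_ang B α, ← phase_ang B e, mem_Icc, (strictMono_phase B).le_iff_le,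
          (strictMono_phase B).le_iff_le]
        rcases h with ⟨h1, h2, h3⟩ | ⟨h1, h2, h3⟩ <;> have h4 := strictMono_ang B h3 <;>
          rw [h1, h2] at h4 ⊢ <;> constructor <;> nlinarith [hx.1, hx.2]
      · simp only [ang_phase]; congr 1; ring
    · rintro ⟨a, ha, rfl⟩
      have h5 := (strictMono_ang B).monotone ha.1
      have h6 := (strictMono_ang B).monotone ha.2
      have h7 : C + (u + m * ((ang B a - C - u) / m)) = ang B a := by
        rw [mul_div_cancel₀ _ hm]; ring
      refine ⟨(ang B a - C - u) / m, ?_, ?_⟩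
      · rcases h with ⟨h1, h2, h3⟩ | ⟨h1, h2, h3⟩
        · have h4 := strictMono_ang B h3
          have hm0 : 0 < m := by linarith
          exact ⟨div_nonneg (by linarith) hm0.le, (div_le_one hm0).2 (by linarith)⟩
        · have h4 := strictMono_ang B h3
          have hm0 : m < 0 := by linarith
          exact ⟨div_nonneg_of_nonpos (by linarith) hm0.le, (div_le_one_of_neg hm0).2 (by linarith)⟩
      · simp only [h7, phase_ang]; congr 1; linarith
  have h1 : fish B .arc₁ '' Edge.dom .arc₁ = orbitArc B (-(Real.pi / 2) - beta B)
      (-(Real.pi / 2) + beta B) (-halfShort B) 1 := by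
    have := arc 0 (-halfShort B) (2 * halfShort B) (-(Real.pi / 2) - beta B)
      (-(Real.pi / 2) + beta B) (by linarith) (Or.inl ⟨by rw [ang_neg_sub_beta, zero_add], by
        change halfShort B = _; ring, by linarith [beta_pos hB]⟩)
    simp only [zero_add, sub_zero, ang_neg_sub_beta] at this
    exact this
  have h2 : fish B .arc₂ '' Edge.dom .arc₂ = orbitArc B (-(Real.pi / 2) - beta B)
      (3 * Real.pi / 2 + beta B) (-halfShort B) (-1) := by
    have := arc (-(2 * halfShort B)) (2 * Real.pi - halfShort B)
      (-(2 * Real.pi - 2 * halfShort B)) (-(Real.pi / 2) - beta B)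
      (3 * Real.pi / 2 + beta B) (by linarith) (Or.inr ⟨by
        rw [ang_add_beta, ← hf, fishAngle]; ring, by rw [ang_neg_sub_beta]; ring,
        by linarith [beta_pos hB]⟩)
    rw [orbitArc_long hf (Or.inl rfl)]
    refine Eq.trans this ?_
    rw [ang_neg_sub_beta]; congr 1; ring
  have e1 : fish B .ray₁ 0 = polar (vertexX B) (-halfShort B) := by
    rw [fish, fishX, add_zero]; rfl
  have e2 : fish B .ray₂ 0 = polar (vertexX B) (halfShort B) := by
    rw [fish, fishX, add_zero]; rfl
  rw [trace_eq, fishSet, h1, h2, fish_ray₁_image, fish_ray₂_image, e1, e2]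
  congr 3 <;> ring_nf

end Network
namespace Network

/-! ### Symmetric lenses -/

/-- The system of `IsOrbit` is reversible. -/
lemma isOrbit_reverse {X Y : ℝ → ℝ} (h : IsOrbit X Y) (a : ℝ) :
    IsOrbit (fun θ => X (a - θ)) (fun θ => -Y (a - θ)) := by
  constructor
  · intro θ
    exact ((h.hasDerivAt_fst (a - θ)).comp_const_sub a θ).congr_deriv (by ring)
  · intro θ
    exact ((h.hasDerivAt_snd (a - θ)).comp_const_sub a θ).neg.congr_deriv (by ring)

lemma polar_zero (X : ℝ) : polar X 0 = ((Real.sqrt 2 * Real.exp (X / 2) : ℝ) : ℂ) := by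
  apply Complex.ext
  · rw [polar_re, Real.cos_zero, mul_one, Complex.ofReal_re]
  · rw [polar_im, Real.sin_zero, mul_zero, Complex.ofReal_im]

lemma polar_pi (X : ℝ) : polar X Real.pi = ((-(Real.sqrt 2 * Real.exp (X / 2)) : ℝ) : ℂ) := by
  apply Complex.ext
  · rw [polar_re, Real.cos_pi, mul_neg_one, Complex.ofReal_re]
  · rw [polar_im, Real.sin_pi, mul_zero, Complex.ofReal_im]

lemma halfLine_polar_pi (X : ℝ) : halfLine (polar X Real.pi) (polar X Real.pi) =
    {z | z.im = 0 ∧ z.re ≤ (polar X Real.pi).re} := by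
  ext z
  have hneg : (polar X Real.pi).re < 0 := by
    rw [polar_re, Real.cos_pi]
    have : 0 < Real.sqrt 2 * Real.exp (X / 2) := by positivity
    linarith
  have him : (polar X Real.pi).im = 0 := by rw [polar_im, Real.sin_pi, mul_zero]
  rw [mem_halfLine_self]
  constructor
  · rintro ⟨k, hk, rfl⟩
    simp only [mem_ofPred_eq, Complex.smul_im, Complex.smul_re, him, smul_eq_mul, mul_zero,
      true_and]
    nlinarith
  · rintro ⟨h1, h2⟩
    refine ⟨z.re / (polar X Real.pi).re, (one_le_div_of_neg hneg).2 h2, ?_⟩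
    apply Complex.ext
    · rw [Complex.smul_re, smul_eq_mul, div_mul_cancel₀ _ hneg.ne]
    · rw [Complex.smul_im, him, smul_zero, h1]

lemma halfLine_polar_zero (X : ℝ) : halfLine (polar X 0) (polar X 0) =
    {z | z.im = 0 ∧ (polar X 0).re ≤ z.re} := by
  ext z
  have hpos : 0 < (polar X 0).re := by
    rw [polar_re, Real.cos_zero]
    positivity
  have him : (polar X 0).im = 0 := by rw [polar_im, Real.sin_zero, mul_zero]
  rw [mem_halfLine_self]
  constructor
  · rintro ⟨k, hk, rfl⟩
    simp only [mem_ofPred_eq, Complex.smul_im, Complex.smul_re, him, smul_eq_mul, mul_zero,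
      true_and]
    nlinarith
  · rintro ⟨h1, h2⟩
    refine ⟨z.re / (polar X 0).re, (one_le_div hpos).2 h2, ?_⟩
    apply Complex.ext
    · rw [Complex.smul_re, smul_eq_mul, div_mul_cancel₀ _ hpos.ne']
    · rw [Complex.smul_im, him, smul_zero, h1]

lemma unit_smul_eq {r : ℝ} (hr : 0 < r) {w v : ℂ} (hw : w = r • v) (hv : ‖v‖ = 1) :
    ‖w‖⁻¹ • w = v := by
  rw [hw, norm_smul, Real.norm_of_nonneg hr.le, hv, mul_one, smul_smul, inv_mul_cancel₀ hr.ne',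
    one_smul]

/-- An orbit which turns by the angle `π` between its phases at the vertices bounds, together with
its mirror image, a symmetric lens. -/
lemma isSymmetricLens_of_orbit {B α e : ℝ} (hα : orbY B α = -1 / Real.sqrt 3)
    (he : orbY B e = 1 / Real.sqrt 3) (hπ : ang B e - ang B α = Real.pi) :
    IsSymmetricLens (orbitArc B α e Real.pi (-1) ∪ orbitArc B α e Real.pi 1 ∪
      (halfLine (polar (orbX B α) Real.pi) (polar (orbX B α) Real.pi) ∪
        halfLine (polar (orbX B e) 0) (polar (orbX B e) 0))) := by
  have hp := Real.pi_pos
  set C := ang B α + Real.pi with hC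
  set X : ℝ → ℝ := fun θ => orbX B (phase B (C - θ)) with hX
  set Y : ℝ → ℝ := fun θ => -orbY B (phase B (C - θ)) with hY
  have horb : IsOrbit X Y := isOrbit_reverse (isOrbit_orb B) C
  set T : ℝ → ℝ := fun x => Real.pi / 2 + -(Real.pi / 2) * x with hT
  set γ : ℝ → ℂ := fun x => polar (X (T x)) (T x) with hγ
  have tm : T (-1) = Real.pi := by simp only [hT]; ring
  have tp : T 1 = 0 := by simp only [hT]; ring
  have Xm : X Real.pi = orbX B α := by simp only [hX, hC, add_sub_cancel_right, phase_ang]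
  have Xp : X 0 = orbX B e := by
    simp only [hX, hC, sub_zero]
    rw [← hπ, add_sub_cancel, phase_ang]
  have Ym : Y Real.pi = 1 / Real.sqrt 3 := by
    simp only [hY, hC, add_sub_cancel_right, phase_ang, hα]; ring
  have Yp : Y 0 = -(1 / Real.sqrt 3) := by
    simp only [hY, hC, sub_zero]
    rw [← hπ, add_sub_cancel, phase_ang, he]
  have γm : γ (-1) = polar (orbX B α) Real.pi := by simp only [hγ, tm, Xm]
  have γp : γ 1 = polar (orbX B e) 0 := by simp only [hγ, tp, Xp]
  have hd : ∀ x, HasDerivAt γ (-(Real.pi / 2) * ((Y (T x) + Complex.I) * γ x)) x := by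
    intro x
    have hl : HasDerivAt T (-(Real.pi / 2)) x := by
      exact (((hasDerivAt_id x).const_mul (-(Real.pi / 2))).const_add (Real.pi / 2)).congr_deriv
        (mul_one _)
    refine ((hasDerivAt_polar horb (T x)).scomp x hl).congr_deriv ?_
    rw [Complex.real_smul]; push_cast; rfl
  have hdw : ∀ x ∈ Icc (-1 : ℝ) 1, derivWithin γ (Icc (-1) 1) x =
      -(Real.pi / 2) * ((Y (T x) + Complex.I) * γ x) := fun x hx =>
    (hd x).hasDerivWithinAt.derivWithin (uniqueDiffOn_Icc (by norm_num) x hx)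
  have hTmem : ∀ x ∈ Icc (-1 : ℝ) 1, T x ∈ Icc 0 Real.pi := by
    intro x hx
    simp only [hT]
    constructor <;> nlinarith [hx.1, hx.2]
  have hnorm : ‖(⟨1 / 2, Real.sqrt 3 / 2⟩ : ℂ)‖ = 1 ∧ ‖(⟨1 / 2, -(Real.sqrt 3 / 2)⟩ : ℂ)‖ = 1 := by
    have h3 := Real.mul_self_sqrt (show (0 : ℝ) ≤ 3 by norm_num)
    constructor <;> rw [← sq_eq_sq₀ (norm_nonneg _) zero_le_one, ← dot_self] <;>
      simp only [dot] <;> linear_combination h3 / 4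
  have h3pos : (0 : ℝ) < Real.sqrt 3 := by positivity
  have h3inv : (Real.sqrt 3)⁻¹ * Real.sqrt 3 = 1 := inv_mul_cancel₀ h3pos.ne'
  have hcurve : γ '' Icc (-1) 1 = orbitArc B α e Real.pi (-1) := by
    have key : ∀ a, polar (X (Real.pi - (ang B a - ang B α))) (Real.pi - (ang B a - ang B α)) =
        polar (orbX B a) (Real.pi + -1 * (ang B a - ang B α)) := by
      intro a
      have h1 : C - (Real.pi - (ang B a - ang B α)) = ang B a := by rw [hC]; ring
      simp only [hX, h1, phase_ang]
      congr 1; ring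
    ext z
    constructor
    · rintro ⟨x, hx, rfl⟩
      have h1 := hTmem x hx
      have h2 : ang B (phase B (C - T x)) = C - T x := ang_phase _ _
      refine ⟨phase B (C - T x), ⟨?_, ?_⟩, ?_⟩
      · rw [← (strictMono_ang B).le_iff_le, h2, hC]; linarith [h1.2]
      · rw [← (strictMono_ang B).le_iff_le, h2, hC]; linarith [h1.1]
      · refine (key _).symm.trans ?_
        rw [h2, show Real.pi - (C - T x - ang B α) = T x by rw [hC]; ring]
    · rintro ⟨a, ha, rfl⟩
      have h1 := (strictMono_ang B).monotone ha.1
      have h2 := (strictMono_ang B).monotone ha.2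
      set x := 2 / Real.pi * (ang B a - ang B α) - 1 with hx
      have hTx : T x = Real.pi - (ang B a - ang B α) := by
        simp only [hT, hx]; field_simp; ring
      refine ⟨x, ⟨?_, ?_⟩, ?_⟩
      · have : 0 ≤ 2 / Real.pi * (ang B a - ang B α) := mul_nonneg (by positivity) (by linarith)
        rw [hx]; linarith
      · have : 2 / Real.pi * (ang B a - ang B α) ≤ 2 / Real.pi * Real.pi :=
          mul_le_mul_of_nonneg_left (by linarith) (by positivity)
        rw [div_mul_cancel₀ _ hp.ne'] at this
        rw [hx]; linarith
      · simp only [hγ, hTx]; exact key a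
  have hmirror : (fun x => starRingEnd ℂ (γ x)) '' Icc (-1) 1 = orbitArc B α e Real.pi 1 := by
    rw [← image_image (starRingEnd ℂ), hcurve, orbitArc, orbitArc, image_image]
    refine image_congr fun a _ => ?_
    rw [conj_polar, polar_eq_polar_iff]
    exact ⟨rfl, -1, by push_cast; ring⟩
  refine ⟨γ, ?_, fun x hx => ?_, ?_, fun x hx => ?_, ?_, ?_, ?_, ?_, ?_, ?_⟩
  · refine (contDiff_polar (horb.contDiff.1.comp ?_) ?_).contDiffOn <;> fun_prop
  · rw [hdw x hx]
    refine mul_ne_zero ?_ (mul_ne_zero (fun h0 => ?_) (polar_ne_zero _ _))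
    · exact_mod_cast neg_ne_zero.2 (half_pos hp).ne'
    · simpa using congrArg Complex.im h0
  · intro x hx y hy hxy
    obtain ⟨-, n, hn⟩ := polar_eq_polar_iff.1 (by exact hxy)
    have h1 := hTmem x hx
    have h2 := hTmem y hy
    have hn1 : n < 1 := by
      by_contra! h3
      have : (1 : ℝ) ≤ n := by exact_mod_cast h3
      nlinarith [h1.2, h2.1]
    have hn2 : -1 < n := by
      by_contra! h3
      have : (n : ℝ) ≤ -1 := by exact_mod_cast h3
      nlinarith [h1.1, h2.2]
    obtain rfl : n = 0 := by omega
    simp only [hT] at hn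
    have : Real.pi / 2 * (x - y) = 0 := by push_cast at hn; linarith
    rcases mul_eq_zero.1 this with h3 | h3 <;> linarith
  · simp only [hγ, polar_im]
    have : 0 < Real.sin (T x) := by
      refine Real.sin_pos_of_pos_of_lt_pi ?_ ?_ <;> simp only [hT] <;> nlinarith [hx.1, hx.2]
    positivity
  · rw [γm, polar_im, Real.sin_pi, mul_zero]
  · rw [γp, polar_im, Real.sin_zero, mul_zero]
  · rw [γm, γp, polar_re, polar_re, Real.cos_pi, Real.cos_zero]
    have h1 : 0 < Real.sqrt 2 * Real.exp (orbX B α / 2) := by positivity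
    have h2 : 0 < Real.sqrt 2 * Real.exp (orbX B e / 2) := by positivity
    linarith
  · rw [hdw (-1) (by simp), tm, Ym, γm, polar_pi]
    refine unit_smul_eq (r := Real.pi / 2 * (Real.sqrt 2 * Real.exp (orbX B α / 2)) *
      (2 / Real.sqrt 3)) (by positivity) ?_ hnorm.1
    generalize Real.sqrt 2 * Real.exp (orbX B α / 2) = r
    generalize Real.sqrt 3 = w at h3inv ⊢
    apply Complex.ext <;> simp
    · ring
    · linear_combination (-Real.pi / 2 * r) * h3inv
  · rw [hdw 1 (by simp), tp, Yp, γp, polar_zero]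
    refine unit_smul_eq (r := Real.pi / 2 * (Real.sqrt 2 * Real.exp (orbX B e / 2)) *
      (2 / Real.sqrt 3)) (by positivity) ?_ hnorm.2
    generalize Real.sqrt 2 * Real.exp (orbX B e / 2) = r
    generalize Real.sqrt 3 = w at h3inv ⊢
    apply Complex.ext <;> simp
    · ring
    · linear_combination (-Real.pi / 2 * r) * h3inv
  · rw [hcurve, hmirror, halfLine_polar_pi, halfLine_polar_zero, γm, γp, union_assoc, union_assoc,
      union_assoc]

lemma IsSymmetricLens.shrinking {L : Set ℂ} (h : IsSymmetricLens L) {t : ℝ} (ht : t < 0) :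
    IsSymmetricLens (shrinking L t) := by
  have hk : 0 < Real.sqrt (-t) := Real.sqrt_pos.2 (neg_pos.2 ht)
  obtain ⟨γ, h1, h2, h3, h4, h5, h6, h7, h8, h9, rfl⟩ := h
  rw [Network.shrinking]
  generalize Real.sqrt (-t) = k at *
  have hd : ∀ x, derivWithin (fun x => k • γ x) (Icc (-1) 1) x =
      k • derivWithin γ (Icc (-1) 1) x := fun x => derivWithin_fun_const_smul_field k γ
  have hu : ∀ w : ℂ, ‖k • w‖⁻¹ • k • w = ‖w‖⁻¹ • w := by
    intro w
    rw [norm_smul, Real.norm_of_nonneg hk.le, mul_inv, smul_smul, mul_right_comm,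
      inv_mul_cancel₀ hk.ne', one_mul]
  refine ⟨fun x => k • γ x, h1.const_smul k, fun x hx => ?_, fun x hx y hy hxy => ?_,
    fun x hx => ?_, ?_, ?_, ?_, ?_, ?_, ?_⟩
  · rw [hd]; exact smul_ne_zero hk.ne' (h2 x hx)
  · exact h3 hx hy (smul_right_injective ℂ hk.ne' hxy)
  · rw [Complex.smul_im]; exact mul_pos hk (h4 x hx)
  · rw [Complex.smul_im, h5, smul_zero]
  · rw [Complex.smul_im, h6, smul_zero]
  · rw [Complex.smul_re, Complex.smul_re]; exact mul_lt_mul_of_pos_left h7 hk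
  · rw [hd, hu, h8]
  · rw [hd, hu, h9]
  · have hray : ∀ p : ℝ → Prop, ∀ p' : ℝ → Prop, (∀ r, p' (k * r) ↔ p r) →
        (fun z : ℂ => k • z) '' {z | z.im = 0 ∧ p z.re} = {z | z.im = 0 ∧ p' z.re} := by
      intro p p' hpp
      ext z
      constructor
      · rintro ⟨w, ⟨h1, h2⟩, rfl⟩
        exact ⟨by simp [h1], by simpa using (hpp _).2 h2⟩
      · rintro ⟨h1, h2⟩
        refine ⟨k⁻¹ • z, ⟨by simp [h1], ?_⟩, ?_⟩
        · rw [← hpp, Complex.smul_re, smul_eq_mul, mul_inv_cancel_left₀ hk.ne']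
          exact h2
        · simp only [smul_smul, mul_inv_cancel₀ hk.ne', one_smul]
    rw [image_union, image_union, image_union, image_image, image_image]
    congr 1
    · congr 1
      · congr 1
        refine image_congr fun x _ => ?_
        simp
      · exact hray (· ≤ (γ (-1)).re) (· ≤ (k • γ (-1)).re) fun r => by
          rw [Complex.smul_re]; exact mul_le_mul_iff_right₀ hk
    · exact hray ((γ 1).re ≤ ·) ((k • γ 1).re ≤ ·) fun r => by
        rw [Complex.smul_re]; exact mul_le_mul_iff_right₀ hk

/-- A symmetric lens differs from the axis only within a disc, which is scaled down to the origin. -/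
lemma IsSymmetricLens.tendsto_hausdorffEDist {L : Set ℂ} (h : IsSymmetricLens L) :
    Tendsto (fun t => Metric.hausdorffEDist (Network.shrinking L t) {z | z.im = 0}) (𝓝[<] 0)
      (𝓝 0) := by
  obtain ⟨γ, h1, -, -, -, h5, h6, h7, -, -, rfl⟩ := h
  obtain ⟨R, hR⟩ := (isCompact_Icc.image_of_continuousOn h1.continuousOn).isBounded.exists_norm_le
  have hR0 : ∀ x ∈ Icc (-1 : ℝ) 1, ‖γ x‖ ≤ R := fun x hx => hR _ ⟨x, hx, rfl⟩
  have hRnn : 0 ≤ R := (norm_nonneg _).trans (hR0 1 (by simp))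
  have hlim : Tendsto (fun t : ℝ => ENNReal.ofReal (Real.sqrt (-t) * (2 * R))) (𝓝[<] 0) (𝓝 0) := by
    have := ENNReal.tendsto_ofReal (tendsto_sqrt_neg.mul_const (2 * R))
    simpa using this
  refine tendsto_of_tendsto_of_tendsto_of_le_of_le' tendsto_const_nhds hlim
    (Eventually.of_forall fun _ => zero_le) ?_
  filter_upwards [self_mem_nhdsWithin] with t ht
  have hk : 0 < Real.sqrt (-t) := Real.sqrt_pos.2 (neg_pos.2 ht)
  rw [Network.shrinking]
  generalize Real.sqrt (-t) = k at *
  have hdist : ∀ z w : ℂ, ‖z - w‖ ≤ 2 * R → edist (k • z) (k • w) ≤ ENNReal.ofReal (k * (2 * R)) := by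
    intro z w hzw
    rw [edist_dist, dist_eq_norm, ← smul_sub, norm_smul, Real.norm_of_nonneg hk.le]
    exact ENNReal.ofReal_le_ofReal (mul_le_mul_of_nonneg_left hzw hk.le)
  have hre : ∀ z : ℂ, ‖z‖ ≤ R → ‖z - (z.re : ℂ)‖ ≤ 2 * R := by
    intro z hz
    refine (norm_sub_le _ _).trans ?_
    have := Complex.abs_re_le_norm z
    rw [Complex.norm_real, Real.norm_eq_abs]
    linarith
  refine Metric.hausdorffEDist_le_of_mem_edist ?_ ?_
  · rintro _ ⟨z, hz, rfl⟩
    have harc : ‖z‖ ≤ R → ∃ y ∈ {z : ℂ | z.im = 0}, edist (k • z) y ≤ ENNReal.ofReal (k * (2 * R)) :=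
      fun hzR => ⟨k • (z.re : ℂ), by simp, hdist _ _ (hre z hzR)⟩
    rcases hz with ((⟨x, hx, rfl⟩ | ⟨x, hx, rfl⟩) | hz) | hz
    · exact harc (hR0 x hx)
    · exact harc (by simpa using hR0 x hx)
    · exact ⟨k • z, by simp [hz.1], by simp⟩
    · exact ⟨k • z, by simp [hz.1], by simp⟩
  · intro z hz
    have hz0 : z.im = 0 := hz
    have hzk : k • (k⁻¹ • z) = z := by rw [smul_smul, mul_inv_cancel₀ hk.ne', one_smul]
    set w := k⁻¹ • z with hw
    have hw0 : w.im = 0 := by simp [hw, hz0]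
    rcases le_or_gt w.re (γ (-1)).re with hl | hl
    · exact ⟨z, ⟨w, Or.inl (Or.inr ⟨hw0, hl⟩), hzk⟩, by simp⟩
    rcases le_or_gt (γ 1).re w.re with hr | hr
    · exact ⟨z, ⟨w, Or.inr ⟨hw0, hr⟩, hzk⟩, by simp⟩
    refine ⟨k • γ 1, ⟨γ 1, Or.inl (Or.inl (Or.inl ⟨1, by simp, rfl⟩)), rfl⟩, ?_⟩
    rw [← hzk]
    refine hdist _ _ ?_
    have hreal : w - γ 1 = ((w.re - (γ 1).re : ℝ) : ℂ) := by
      apply Complex.ext <;> simp [hw0, h6]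
    rw [hreal, Complex.norm_real, Real.norm_eq_abs, abs_of_neg (by linarith)]
    have b1 := (Complex.abs_re_le_norm (γ 1)).trans (hR0 1 (by simp))
    have b2 := (Complex.abs_re_le_norm (γ (-1))).trans (hR0 (-1) (by simp))
    have := (abs_le.1 b1).2
    have := (abs_le.1 b2).1
    linarith

/-! ### Existence and uniqueness -/

/-- A self-similarly shrinking network is a symmetric lens or fish-shaped, up to rotation. The arcs end
at phases which differ by `n` oscillations; `n = 0` yields the lens, `n = 1` and `n = -1` yield the
fish with either arc as the short one. -/
theorem IsShrinkingNetwork.lens_or_fish {F : Edge → ℝ → ℂ} (h : IsShrinkingNetwork F) :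
    (∃ a : Circle, IsSymmetricLens (rotation a '' trace F)) ∨
    ∃ B, 0 < B ∧ 1 ≤ 3 * B ^ 2 ∧ fishAngle B = 2 * Real.pi ∧
      ∃ a : Circle, trace F = rotation a '' trace (fish B) := by
  obtain ⟨B, α, ϑ, s, e₁, e₂, hB, hs, h₁, h₂, hY, hY₁, hY₂, hX, hsum, htr⟩ := h.exists_normal_form
  obtain ⟨h3, cα⟩ := cos_of_orbY hB (by norm_num) hY
  have c₁ := (cos_of_orbY hB (by norm_num) hY₁).2
  have c₂ := (cos_of_orbY hB (by norm_num) hY₂).2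
  obtain ⟨n, hn⟩ := exists_turns hB (c₁.trans c₂.symm) hX
  have hs' : -s = 1 ∨ -s = -1 := by rcases hs with rfl | rfl <;> simp
  have hang : ang B e₂ = ang B e₁ + n * period B := by rw [hn, ang_add_int_mul]
  have hn' : e₁ = e₂ + (-n : ℤ) * (2 * Real.pi) := by rw [hn]; push_cast; ring
  -- the fish-shaped network, with the short arc in the direction `σ`
  have fishCase : ∀ (σ : ℝ) (i : ℤ), (σ = 1 ∨ σ = -1) → fishAngle B = 2 * Real.pi →
      α = -(Real.pi / 2) - beta B + i * (2 * Real.pi) →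
      trace F = orbitArc B α (-(Real.pi / 2) + beta B + i * (2 * Real.pi)) ϑ σ ∪
        orbitArc B α (3 * Real.pi / 2 + beta B + i * (2 * Real.pi)) ϑ (-σ) ∪
        (halfLine (polar (orbX B α) ϑ) (polar (orbX B α) ϑ) ∪
        halfLine (polar (vertexX B) (ϑ + σ * (2 * halfShort B)))
          (polar (vertexX B) (ϑ + σ * (2 * halfShort B)))) →
      ∃ a : Circle, trace F = rotation a '' trace (fish B) := by
    intro σ i hσ hf hα ht
    obtain ⟨a, ha⟩ := exists_rotation_fishSet hf hσ ϑ
    refine ⟨a, ?_⟩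
    have hXα : orbX B α = vertexX B := by
      rw [hα, vertexX]
      exact orbX_congr ((Real.sin_add_int_mul_two_pi _ i).trans (sin_neg_sub_beta B))
    rw [trace_fish hB hf, ← ha, ht, hXα, hα, orbitArc_add_int, orbitArc_add_int, fishSet]
  have lensCase : n = 0 → ∃ a : Circle, IsSymmetricLens (rotation a '' trace F) := by
    intro hn0
    have hee : e₂ = e₁ := by rw [hn, hn0]; simp
    subst hee
    have hπ : ang B e₂ - ang B α = Real.pi := by linarith
    refine ⟨Circle.exp (Real.pi - ϑ), ?_⟩
    have hq : halfLine (polar (orbX B e₂) (Real.pi + s * Real.pi))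
        (polar (orbX B e₂) (Real.pi + s * Real.pi)) =
        halfLine (polar (orbX B e₂) 0) (polar (orbX B e₂) 0) := by
      have : polar (orbX B e₂) (Real.pi + s * Real.pi) = polar (orbX B e₂) 0 := by
        rw [polar_eq_polar_iff]
        rcases hs with rfl | rfl
        · exact ⟨rfl, 1, by push_cast; ring⟩
        · exact ⟨rfl, 0, by push_cast; ring⟩
      rw [this]
    have hlens := isSymmetricLens_of_orbit hY hY₁ hπ
    rw [htr, image_union, image_union, image_union, rotation_orbitArc, rotation_orbitArc,
      rotation_halfLine, rotation_halfLine, ← add_assoc, sub_add_cancel, hπ, hq]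
    rcases hs with rfl | rfl
    · rwa [union_comm (orbitArc B α e₂ Real.pi 1)]
    · rwa [neg_neg]
  rcases le_total 0 n with hn0 | hn0
  · rcases turns_eq hB cα c₁ h₁ hn0 (by rw [hang] at hsum; linarith) with rfl | ⟨rfl, hf, i, hα, he⟩
    · exact Or.inl (lensCase rfl)
    · right
      refine ⟨B, hB, h3, hf, fishCase s i hs hf hα ?_⟩
      have he₂ : e₂ = 3 * Real.pi / 2 + beta B + i * (2 * Real.pi) := by
        rw [hn, he]; push_cast; ring
      have hXe : orbX B e₁ = vertexX B := by
        rw [he]; exact orbX_congr (Real.sin_add_int_mul_two_pi _ i)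
      have hA : ang B e₁ - ang B α = 2 * halfShort B := by
        rw [he, hα, ang_add_int_mul, ang_add_int_mul, ang_neg_sub_beta]
        change halfShort B + _ - _ = _
        ring
      rw [htr, hXe, hA, ← he₂, he]
  · rcases turns_eq hB cα c₂ h₂ (n := -n) (by omega) (by
      rw [hang] at hsum ⊢; push_cast; linarith) with hn1 | ⟨hn1, hf, i, hα, he⟩
    · exact Or.inl (lensCase (by omega))
    · right
      refine ⟨B, hB, h3, hf, fishCase (-s) i hs' hf hα ?_⟩
      have he₁ : e₁ = 3 * Real.pi / 2 + beta B + i * (2 * Real.pi) := by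
        rw [hn', hn1, he]; push_cast; ring
      have hXe : orbX B e₁ = vertexX B := by
        rw [hX, he]; exact orbX_congr (Real.sin_add_int_mul_two_pi _ i)
      have hA : ang B e₂ - ang B α = 2 * halfShort B := by
        rw [he, hα, ang_add_int_mul, ang_add_int_mul, ang_neg_sub_beta]
        change halfShort B + _ - _ = _
        ring
      have hq : polar (vertexX B) (ϑ + s * (ang B e₁ - ang B α)) =
          polar (vertexX B) (ϑ + -s * (2 * halfShort B)) := by
        rw [← polar_add_two_pi hs _ (ϑ + -s * (2 * halfShort B)), ← hsum, ← hA]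
        congr 1; ring
      rw [htr, hXe, hq, ← he₁, ← he, neg_neg, union_comm (orbitArc B α e₁ ϑ s)]

end Network

theorem theoremA2 :
    ∃ M : ℝ → Set ℂ,
      Network.IsNonLensShrinker M ∧
      (∀ t < 0, Network.HasNonParallelHalfLines (M t)) ∧
      ∀ M' : ℝ → Set ℂ, Network.IsNonLensShrinker M' →
        ∃ a : Circle, ∀ t < 0, M' t = rotation a '' M t := by
  open Network in
  obtain ⟨B, hB, h3, hf⟩ := exists_fishAngle_eq
  refine ⟨shrinking (trace (fish B)), isNonLensShrinker_fish hB h3 hf,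
    fun t ht => hasNonParallelHalfLines_fish hB h3 hf ht, fun M' hM' => ?_⟩
  obtain ⟨F, hF, hS, hM⟩ := exists_static hM'.evolves hM'.homothetic hM'.shrinks
  have hnet : IsShrinkingNetwork F := ⟨hF, hS⟩
  rcases hnet.lens_or_fish with ⟨a, ha⟩ | ⟨B', hB', h3', hf', a, ha⟩
  · refine absurd ⟨hM'.evolves.rotate a, hM'.homothetic.rotate a, ?_, ?_⟩ (hM'.ne_lens a)
    · intro t ht
      have : rotation a '' M' t = shrinking (rotation a '' trace F) t := by
        rw [hM t ht, ← rotation_image_shrinking]; rfl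
      simp only [this]
      exact ha.shrinking ht
    · refine ha.tendsto_hausdorffEDist.congr' ?_
      filter_upwards [self_mem_nhdsWithin] with t ht
      rw [hM t ht, ← rotation_image_shrinking]; rfl
  · have hBB : B' = B := fishAngle_strictAntiOn.injOn ⟨hB', h3'⟩ ⟨hB, h3⟩ (hf'.trans hf.symm)
    subst hBB
    refine ⟨a, fun t ht => ?_⟩
    rw [rotation_image_shrinking, ← ha, hM t ht]; rfl
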